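/- Let $\mathbb F$ be an algebraically closed field of characteristic $3$, let $r\ge 1$ and let $\underline n=(n_1,\dots,n_{2r})$ be a tuple of positive integers, $|n|=n_1+\dots+n_{2r}$. Let $\mathcal O(2r;\underline n)$ be the divided power algebra with basis $x^{(a)}$, $0\le a_i<3^{n_i}$, and product $x^{(a)}x^{(b)}=\prod_i\binom{a_i+b_i}{a_i}\,x^{(a+b)}$ (where $x^{(c)}=0$ if some $c_i\ge 3^{n_i}$), and let $\partial_i$ be the derivation of it with $\partial_i x^{(a)}=x^{(a-\varepsilon_i)}$ if $a_i>0$ and $\partial_i x^{(a)}=0$ if $a_i=0$. Put $i'=i+r$, $\sigma(i)=1$ for $1\le i\le r$ and $i'=i-r$, $\sigma(i)=-1$ for $r<i\le 2r$, and $D_H(f)=\sum_{i=1}^{2r}\sigma(i)\,\partial_i(f)\,\partial_{i'}$. Let $\tau=(3^{n_1}-1,\dots,3^{n_{2r}}-1)$ and let $$\mathfrak g=H(2r;\underline n)^{(2)}=\operatorname{span}\{D_H(x^{(a)})\mid 0<a<\tau\}$$ (componentwise partial order), a Lie algebra under the commutator of derivations of $\mathcal O(2r;\underline n)$. Let $\operatorname{Out}(\mathfrak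 g)=\operatorname{Der}(\mathfrak g)/\operatorname{Inn}(\mathfrak g)$ be its Lie algebra of outer derivations. If $r=1$ and $1<n_1\le n_2$, then $\operatorname{Out}(\mathfrak g)$ is solvable of derived length exactly $3$. If $r>1$, then $\operatorname{Out}(\mathfrak g)$ is solvable of derived length exactly $2$. More precisely, as Lie algebras, $$\operatorname{Out}(\mathfrak g)\cong\begin{cases}(\mathfrak h_3(\mathbb F)\rtimes\mathbb F)\oplus\mathbb F^{|n|-2} & \text{if } r=1,\ 1<n_1\le n_2,\\ (\mathbb F^{2r+1}\rtimes\mathbb F)\oplus\mathbb F^{|n|-2r} & \text{if } r>1,\ r\equiv 0 \bmod 3,\\ (\mathbb F^{2r+1}\rtimes\mathbb F)\oplus\mathbb F^{|n|-2r} & \text{if } r>1,\ r\equiv 1 \bmod 3,\\ (\mathbb F^{2r}\rtimes\mathbb F)\oplus\mathbb F^{|n|-2r+1} & \text{if } r>1,\ r\equiv 2 \bmod 3.\end{cases}$$ Here $\mathbb F^k$ is the abelian Lie algebra of dimension $k$, $\mathfrak h_3(\mathbb F)$ is the Heisenberg Lie algebra with basis $e_1,e_2,e_3$, $[e_1,e_2]=e_3$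 and $e_3$ central, and $K\rtimes\mathbb F$ is the semidirect sum in which $t\in\mathbb F$ acts on $K$ by $tD$, where $D=\operatorname{diag}(1,1,-1)$ in the first case, $D=\mathrm{id}$ in the second, $D=\operatorname{diag}(1,\dots,1,-1)$ in the third, and $D=\mathrm{id}$ in the fourth. -/

import Mathlib

set_option linter.unusedSectionVars false

/-! ### Divided power algebras -/

/-- The underlying space of the divided power algebra `O(m; n)` in the variables `x_i`, `i : ι`
(so `m` is the number of elements of `ι`): the free module on the monomials
`x^(a) = ∏ x_i^(a_i)`, `0 ≤ a_i < p ^ n_i`.  An element is given by its coefficients. -/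
def DivPow (F : Type*) (p : ℕ) {ι : Type*} (n : ι → ℕ) : Type _ :=
  (∀ i, Fin (p ^ n i)) → F

namespace DivPow

variable {F : Type*} [CommRing F] {p : ℕ} {ι : Type*} [Fintype ι] [DecidableEq ι] {n : ι → ℕ}

instance : AddCommGroup (DivPow F p n) :=
  inferInstanceAs (AddCommGroup ((∀ i, Fin (p ^ n i)) → F))

instance : Module F (DivPow F p n) :=
  inferInstanceAs (Module F ((∀ i, Fin (p ^ n i)) → F))

variable (F p n) in
/-- The monomial `x^(a)`, for all `a : ι → ℕ`; it is zero if `a_i ≥ p ^ n_i` for some `i`. -/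
def mon (a : ι → ℕ) : DivPow F p n :=
  fun c => if (fun i => (c i : ℕ)) = a then 1 else 0

/-- The product of `O(m; n)`, the bilinear extension of
`x^(a) x^(b) = (∏ i, (a_i + b_i choose a_i)) x^(a + b)`; see `mon_mul_mon`. -/
instance : Mul (DivPow F p n) where
  mul f g := fun c => ∑ a : (∀ i, Fin (p ^ n i)), ∑ b : (∀ i, Fin (p ^ n i)),
    if ∀ i, (a i : ℕ) + b i = c i then
      ((∏ i, (c i : ℕ).choose (a i) : ℕ) : F) * (f a * g b) else 0

instance : One (DivPow F p n) where
  one := mon F p n 0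

theorem mul_apply (f g : DivPow F p n) (c : ∀ i, Fin (p ^ n i)) :
    (f * g) c = ∑ a : (∀ i, Fin (p ^ n i)), ∑ b : (∀ i, Fin (p ^ n i)),
      if ∀ i, (a i : ℕ) + b i = c i then
        ((∏ i, (c i : ℕ).choose (a i) : ℕ) : F) * (f a * g b) else 0 := rfl

theorem add_apply (f g : DivPow F p n) (c : ∀ i, Fin (p ^ n i)) : (f + g) c = f c + g c := rfl

theorem smul_apply (t : F) (f : DivPow F p n) (c : ∀ i, Fin (p ^ n i)) :
    (t • f) c = t * f c := rfl

variable (F p n) in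
/-- The monomials with exponents in range form a basis. -/
noncomputable def monBasis : Module.Basis (∀ i, Fin (p ^ n i)) F (DivPow F p n) :=
  Pi.basisFun F (∀ i, Fin (p ^ n i))

theorem val_inj {a b : ∀ i, Fin (p ^ n i)} :
    (fun i => (a i : ℕ)) = (fun i => (b i : ℕ)) ↔ a = b := by
  constructor
  · intro h; funext i; exact Fin.ext (congrFun h i)
  · rintro rfl; rfl

theorem monBasis_apply (a : ∀ i, Fin (p ^ n i)) :
    monBasis F p n a = mon F p n (fun i => (a i : ℕ)) := by
  funext c
  have : (monBasis F p n a) c = (Pi.single a (1 : F) : (∀ i, Fin (p ^ n i)) → F) c := by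
    exact congrFun (Pi.basisFun_apply F _ a) c
  rw [this, Pi.single_apply, mon]
  simp only [val_inj]

theorem mon_eq_zero {a : ι → ℕ} {i : ι} (h : p ^ n i ≤ a i) : mon F p n a = 0 := by
  funext c
  have : ¬ (fun i => (c i : ℕ)) = a := by
    intro hc
    have := congrFun hc i
    have := (c i).isLt
    omega
  simp only [mon, if_neg this]
  rfl

theorem mon_mul_mon (a b : ι → ℕ) (ha : ∀ i, a i < p ^ n i) (hb : ∀ i, b i < p ^ n i) :
    mon F p n a * mon F p n b =
      ((∏ i, (a i + b i).choose (a i) : ℕ) : F) • mon F p n (a + b) := by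
  funext c
  rw [mul_apply, Finset.sum_eq_single (fun i => (⟨a i, ha i⟩ : Fin (p ^ n i))),
    Finset.sum_eq_single (fun i => (⟨b i, hb i⟩ : Fin (p ^ n i))), smul_apply]
  · simp only [mon, if_true, mul_one]
    by_cases h : (fun i => (c i : ℕ)) = a + b
    · have h' : ∀ i, a i + b i = c i := fun i => (congrFun h i).symm
      simp [h, h']
    · have h' : ¬ ∀ i, a i + b i = c i := fun h' => h (funext fun i => (h' i).symm)
      simp [h, h']
  · intro b' _ hb'
    have : ¬ (fun i => (b' i : ℕ)) = b := fun h => hb' (funext fun i => Fin.ext (congrFun h i))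
    simp [mon, this]
  · simp
  · intro a' _ ha'
    have : ¬ (fun i => (a' i : ℕ)) = a := fun h => ha' (funext fun i => Fin.ext (congrFun h i))
    simp [mon, this]
  · simp

variable (F p n) in
/-- Multiplication as a bilinear map. -/
def mulLin : DivPow F p n →ₗ[F] DivPow F p n →ₗ[F] DivPow F p n :=
  LinearMap.mk₂ F (fun f g => f * g)
    (by
      intro f g h; funext c
      simp only [add_apply, mul_apply, ← Finset.sum_add_distrib]
      refine Finset.sum_congr rfl fun a _ => Finset.sum_congr rfl fun b _ => ?_
      split_ifs <;> ring)
    (by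
      intro t f g; funext c
      simp only [smul_apply, mul_apply, Finset.mul_sum]
      refine Finset.sum_congr rfl fun a _ => Finset.sum_congr rfl fun b _ => ?_
      split_ifs <;> ring)
    (by
      intro f g h; funext c
      simp only [add_apply, mul_apply, ← Finset.sum_add_distrib]
      refine Finset.sum_congr rfl fun a _ => Finset.sum_congr rfl fun b _ => ?_
      split_ifs <;> ring)
    (by
      intro t f g; funext c
      simp only [smul_apply, mul_apply, Finset.mul_sum]
      refine Finset.sum_congr rfl fun a _ => Finset.sum_congr rfl fun b _ => ?_
      split_ifs <;> ring)

theorem mulLin_apply (f g : DivPow F p n) : mulLin F p n f g = f * g := rfl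

theorem mul_comm' (f g : DivPow F p n) : f * g = g * f := by
  have : mulLin F p n = (mulLin F p n).flip := by
    refine (monBasis F p n).ext fun a => (monBasis F p n).ext fun b => ?_
    simp only [LinearMap.flip_apply, mulLin_apply, monBasis_apply]
    rw [mon_mul_mon _ _ (fun i => (a i).isLt) (fun i => (b i).isLt),
      mon_mul_mon _ _ (fun i => (b i).isLt) (fun i => (a i).isLt), add_comm]
    congr 2
    refine Finset.prod_congr rfl fun i _ => ?_
    rw [add_comm (b i : ℕ), Nat.choose_symm_add]
  exact congrArg (fun φ => φ f g) this

/-- `mon_mul_mon` when one factor is possibly out of range. -/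
theorem mon_mul_mon' (a b : ι → ℕ) (hb : ∀ i, b i < p ^ n i) :
    mon F p n a * mon F p n b =
      ((∏ i, (a i + b i).choose (a i) : ℕ) : F) • mon F p n (a + b) := by
  by_cases ha : ∀ i, a i < p ^ n i
  · exact mon_mul_mon a b ha hb
  · push Not at ha
    obtain ⟨i, hi⟩ := ha
    rw [mon_eq_zero hi, mon_eq_zero (i := i) (a := a + b) (by simp only [Pi.add_apply]; omega),
      smul_zero, ← mulLin_apply, map_zero, LinearMap.zero_apply]

theorem mul_assoc' (f g h : DivPow F p n) : f * g * h = f * (g * h) := by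
  have h3 : ∀ a b c : (∀ i, Fin (p ^ n i)),
      monBasis F p n a * monBasis F p n b * monBasis F p n c =
        monBasis F p n a * (monBasis F p n b * monBasis F p n c) := by
    intro a b c
    simp only [monBasis_apply]
    rw [mul_comm' (mon F p n fun i => (a i : ℕ)) (_ * _),
      mon_mul_mon _ _ (fun i => (a i).isLt) (fun i => (b i).isLt),
      mon_mul_mon _ _ (fun i => (b i).isLt) (fun i => (c i).isLt)]
    simp only [← mulLin_apply, map_smul, LinearMap.smul_apply]
    simp only [mulLin_apply]
    rw [mon_mul_mon' _ _ (fun i => (c i).isLt), mon_mul_mon' _ _ (fun i => (a i).isLt), smul_smul,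
      smul_smul, ← Nat.cast_mul, ← Nat.cast_mul, ← Finset.prod_mul_distrib,
      ← Finset.prod_mul_distrib, add_comm _ (fun i => (a i : ℕ)), add_assoc]
    congr 2
    refine Finset.prod_congr rfl fun i _ => ?_
    simp only [Pi.add_apply]
    have e1 := Nat.add_choose_mul_factorial_mul_factorial (a i : ℕ) (b i : ℕ)
    have e2 := Nat.add_choose_mul_factorial_mul_factorial (a i + b i : ℕ) (c i : ℕ)
    have e3 := Nat.add_choose_mul_factorial_mul_factorial (b i : ℕ) (c i : ℕ)
    have e4 := Nat.add_choose_mul_factorial_mul_factorial (b i + c i : ℕ) (a i : ℕ)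
    rw [← Nat.choose_symm_add] at e1 e2 e3 e4
    have pos : 0 < (a i : ℕ).factorial * (b i : ℕ).factorial * (c i : ℕ).factorial := by positivity
    refine Nat.eq_of_mul_eq_mul_right pos ?_
    have e5 : (b i + c i + a i : ℕ) = a i + b i + c i := by ring
    rw [e5] at e4 ⊢
    calc _ = ((a i + b i : ℕ).choose (a i) * (a i : ℕ).factorial * (b i : ℕ).factorial) *
          ((a i + b i + c i : ℕ).choose (a i + b i) * (c i : ℕ).factorial) := by ring
      _ = (a i + b i + c i : ℕ).factorial := by rw [e1, ← e2]; ring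
      _ = ((b i + c i : ℕ).choose (b i) * (b i : ℕ).factorial * (c i : ℕ).factorial) *
          ((a i + b i + c i : ℕ).choose (b i + c i) * (a i : ℕ).factorial) := by
            rw [e3, ← e4]; ring
      _ = _ := by ring
  have h2 : ∀ a b : (∀ i, Fin (p ^ n i)), ∀ h : DivPow F p n,
      monBasis F p n a * monBasis F p n b * h = monBasis F p n a * (monBasis F p n b * h) := by
    intro a b h
    have : mulLin F p n (monBasis F p n a * monBasis F p n b) =
        mulLin F p n (monBasis F p n a) ∘ₗ mulLin F p n (monBasis F p n b) :=
      (monBasis F p n).ext fun c => h3 a b c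
    exact congrArg (fun φ => φ h) this
  have h1 : ∀ a : (∀ i, Fin (p ^ n i)), ∀ g h : DivPow F p n,
      monBasis F p n a * g * h = monBasis F p n a * (g * h) := by
    intro a g h
    have : (mulLin F p n).flip h ∘ₗ mulLin F p n (monBasis F p n a) =
        mulLin F p n (monBasis F p n a) ∘ₗ (mulLin F p n).flip h :=
      (monBasis F p n).ext fun b => h2 a b h
    exact congrArg (fun φ => φ g) this
  have : (mulLin F p n).flip h ∘ₗ (mulLin F p n).flip g = (mulLin F p n).flip (g * h) :=
    (monBasis F p n).ext fun a => h1 a g h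
  exact congrArg (fun φ => φ f) this

theorem mul_one' [Fact p.Prime] (f : DivPow F p n) : f * 1 = f := by
  have hp : ∀ i, 0 < p ^ n i := fun i => pow_pos (Fact.out : p.Prime).pos _
  have : (mulLin F p n).flip (mon F p n 0) = LinearMap.id := by
    refine (monBasis F p n).ext fun a => ?_
    rw [LinearMap.flip_apply, mulLin_apply, monBasis_apply,
      mon_mul_mon _ 0 (fun i => (a i).isLt) (fun i => hp i)]
    simp [LinearMap.id]
  exact congrArg (fun φ => φ f) this

instance [Fact p.Prime] : CommRing (DivPow F p n) where
  __ := (inferInstance : AddCommGroup (DivPow F p n))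
  mul_assoc := mul_assoc'
  mul_comm := mul_comm'
  mul_one := mul_one'
  one_mul f := by rw [mul_comm', mul_one']
  left_distrib f g h := (mulLin F p n f).map_add g h
  right_distrib f g h := by
    rw [← mulLin_apply, map_add, LinearMap.add_apply, mulLin_apply, mulLin_apply]
  zero_mul f := by rw [← mulLin_apply, map_zero, LinearMap.zero_apply]
  mul_zero f := (mulLin F p n f).map_zero

instance [Fact p.Prime] : Algebra F (DivPow F p n) :=
  Algebra.ofModule
    (fun t f g => by
      rw [← mulLin_apply, map_smul, LinearMap.smul_apply, mulLin_apply])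
    (fun t f g => (mulLin F p n f).map_smul t g)

variable (F p n) in
/-- The partial derivative `∂_i` as a linear map: `∂_i x^(a) = x^(a - ε_i)` if `0 < a_i`, and
`∂_i x^(a) = 0` if `a_i = 0`; see `pderivLin_mon`. -/
def pderivLin (i : ι) : DivPow F p n →ₗ[F] DivPow F p n where
  toFun f := fun c =>
    if h : (c i : ℕ) + 1 < p ^ n i then f (Function.update c i ⟨c i + 1, h⟩) else 0
  map_add' f g := by
    have key : ∀ c : (∀ i, Fin (p ^ n i)),
        (if h : (c i : ℕ) + 1 < p ^ n i then
          f (Function.update c i ⟨c i + 1, h⟩) + g (Function.update c i ⟨c i + 1, h⟩) else 0) =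
        (if h : (c i : ℕ) + 1 < p ^ n i then f (Function.update c i ⟨c i + 1, h⟩) else 0) +
        (if h : (c i : ℕ) + 1 < p ^ n i then g (Function.update c i ⟨c i + 1, h⟩) else 0) := by
      intro c; split_ifs <;> simp
    exact funext key
  map_smul' t f := by
    have key : ∀ c : (∀ i, Fin (p ^ n i)),
        (if h : (c i : ℕ) + 1 < p ^ n i then
          t * f (Function.update c i ⟨c i + 1, h⟩) else 0) =
        t * (if h : (c i : ℕ) + 1 < p ^ n i then
          f (Function.update c i ⟨c i + 1, h⟩) else 0) := by
      intro c; split_ifs <;> simp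
    exact funext key

theorem pderivLin_apply (i : ι) (f : DivPow F p n) (c : ∀ i, Fin (p ^ n i)) :
    pderivLin F p n i f c =
      if h : (c i : ℕ) + 1 < p ^ n i then f (Function.update c i ⟨c i + 1, h⟩) else 0 := rfl

theorem pderivLin_mon (i : ι) (a : ι → ℕ) (ha : a i < p ^ n i) :
    pderivLin F p n i (mon F p n a) =
      if a i = 0 then 0 else mon F p n (Function.update a i (a i - 1)) := by
  funext c
  have key : ∀ h : (c i : ℕ) + 1 < p ^ n i,
      ((fun j => ((Function.update c i ⟨c i + 1, h⟩ : ∀ i, Fin (p ^ n i)) j : ℕ)) = a ↔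
        a i ≠ 0 ∧ (fun j => (c j : ℕ)) = Function.update a i (a i - 1)) := by
    intro h
    constructor
    · intro e
      have ei := congrFun e i
      simp only [Function.update_self] at ei
      refine ⟨by omega, funext fun j => ?_⟩
      by_cases hj : j = i
      · subst hj
        rw [Function.update_self]; omega
      · have ej := congrFun e j
        simp only [Function.update_of_ne hj] at ej
        rw [Function.update_of_ne hj, ej]
    · rintro ⟨h0, e⟩
      funext j
      have ej := congrFun e j
      by_cases hj : j = i
      · subst hj
        simp only [Function.update_self] at ej ⊢
        omega
      · simp only [Function.update_of_ne hj] at ej ⊢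
        exact ej
  rw [pderivLin_apply]
  by_cases h0 : a i = 0
  · rw [if_pos h0]
    split_ifs with h
    · simp only [mon]
      rw [if_neg]
      · rfl
      · rw [key h]; exact fun h' => h'.1 h0
    · rfl
  · rw [if_neg h0]
    split_ifs with h
    · simp only [mon, key h, h0, ne_eq, not_false_eq_true, true_and]
    · simp only [mon]
      rw [if_neg]
      intro e
      have ei := congrFun e i
      simp only [Function.update_self] at ei
      omega

theorem mon_mul_pderivLin_mon (i : ι) (a b : ι → ℕ) (ha : ∀ j, a j < p ^ n j)
    (hb : ∀ j, b j < p ^ n j) :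
    mon F p n a * pderivLin F p n i (mon F p n b) =
      (((if b i = 0 then 0 else (a i + b i - 1).choose (a i)) *
        ∏ j ∈ Finset.univ.erase i, (a j + b j).choose (a j) : ℕ) : F) •
        mon F p n (Function.update (a + b) i (a i + b i - 1)) := by
  rw [pderivLin_mon i b (hb i)]
  by_cases h0 : b i = 0
  · rw [if_pos h0, if_pos h0, ← mulLin_apply, map_zero, zero_mul, Nat.cast_zero, zero_smul]
  · rw [if_neg h0, if_neg h0, mon_mul_mon _ _ ha, ← Finset.mul_prod_erase _ _ (Finset.mem_univ i)]
    · have e : a + Function.update b i (b i - 1) =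
          Function.update (a + b) i (a i + b i - 1) := by
        funext j
        by_cases hj : j = i
        · subst hj
          simp only [Pi.add_apply, Function.update_self]
          omega
        · simp only [Pi.add_apply, Function.update_of_ne hj]
      rw [e, Function.update_self, Nat.add_sub_assoc (by omega)]
      congr 3
      refine Finset.prod_congr rfl fun j hj => ?_
      rw [Function.update_of_ne (Finset.ne_of_mem_erase hj)]
    · intro j
      by_cases hj : j = i
      · subst hj
        rw [Function.update_self]
        have := hb j
        omega
      · rw [Function.update_of_ne hj]
        exact hb j

theorem pderivLin_mon_mul_mon [Fact p.Prime] [CharP F p] (i : ι) (a b : ι → ℕ)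
    (ha : ∀ j, a j < p ^ n j) (hb : ∀ j, b j < p ^ n j) :
    pderivLin F p n i (mon F p n a * mon F p n b) =
      (((if a i + b i = 0 then 0 else (a i + b i).choose (a i)) *
        ∏ j ∈ Finset.univ.erase i, (a j + b j).choose (a j) : ℕ) : F) •
        mon F p n (Function.update (a + b) i (a i + b i - 1)) := by
  rw [mon_mul_mon _ _ ha hb, map_smul, ← Finset.mul_prod_erase _ _ (Finset.mem_univ i)]
  have hai := ha i
  have hbi := hb i
  by_cases h : a i + b i < p ^ n i
  · rw [pderivLin_mon i (a + b) h]
    simp only [Pi.add_apply]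
    by_cases h0 : a i + b i = 0
    · rw [if_pos h0, if_pos h0, smul_zero, zero_mul, Nat.cast_zero, zero_smul]
    · rw [if_neg h0, if_neg h0]
  · push Not at h
    rw [mon_eq_zero (a := a + b) (i := i) h, map_zero, smul_zero, if_neg (by omega)]
    rcases Nat.lt_or_ge (p ^ n i) (a i + b i) with h1 | h1
    · rw [mon_eq_zero (i := i), smul_zero]
      rw [Function.update_self]
      omega
    · have e : a i + b i = p ^ n i := le_antisymm h1 h
      have d : p ∣ (a i + b i).choose (a i) := by
        rw [e]
        exact (Fact.out : p.Prime).dvd_choose_pow (by omega) (by omega)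
      rw [(CharP.cast_eq_zero_iff F p _).2 (Dvd.dvd.mul_right d _), zero_smul]

theorem pderivLin_mul [Fact p.Prime] [CharP F p] (i : ι) (f g : DivPow F p n) :
    pderivLin F p n i (f * g) = f • pderivLin F p n i g + g • pderivLin F p n i f := by
  have key : ∀ a b : (∀ i, Fin (p ^ n i)),
      pderivLin F p n i (monBasis F p n a * monBasis F p n b) =
        monBasis F p n a * pderivLin F p n i (monBasis F p n b) +
          monBasis F p n b * pderivLin F p n i (monBasis F p n a) := by
    intro a b
    simp only [monBasis_apply]
    rw [pderivLin_mon_mul_mon i _ _ (fun i => (a i).isLt) (fun i => (b i).isLt),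
      mon_mul_pderivLin_mon i _ _ (fun i => (a i).isLt) (fun i => (b i).isLt),
      mon_mul_pderivLin_mon i _ _ (fun i => (b i).isLt) (fun i => (a i).isLt),
      add_comm (fun i => (b i : ℕ)) (fun i => (a i : ℕ)), add_comm (b i : ℕ) (a i : ℕ), ← add_smul,
      ← Nat.cast_add]
    have e : ∏ j ∈ Finset.univ.erase i, (b j + a j : ℕ).choose (b j) =
        ∏ j ∈ Finset.univ.erase i, (a j + b j : ℕ).choose (a j) :=
      Finset.prod_congr rfl fun j _ => by rw [add_comm, Nat.choose_symm_add]
    rw [e, ← add_mul]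
    congr 3
    rcases Nat.eq_zero_or_pos (a i : ℕ) with h1 | h1 <;>
      rcases Nat.eq_zero_or_pos (b i : ℕ) with h2 | h2
    · simp [h1, h2]
    · simp [h1, h2.ne']
    · simp [h1.ne', h2]
    · obtain ⟨x, hx⟩ := Nat.exists_eq_add_of_lt h1
      obtain ⟨y, hy⟩ := Nat.exists_eq_add_of_lt h2
      have hs : (y + 1 + x).choose (y + 1) = (y + 1 + x).choose x := Nat.choose_symm_add
      have hp : (y + 1 + x + 1).choose (x + 1) =
        (y + 1 + x).choose x + (y + 1 + x).choose (x + 1) := Nat.choose_succ_succ _ _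
      have e1 : 0 + x + 1 + (0 + y + 1) = y + 1 + x + 1 := by ring
      rw [hx, hy, e1]
      simp only [zero_add, Nat.add_sub_cancel]
      rw [if_neg (by omega), if_neg (by omega), if_neg (by omega), hs, hp, add_comm]
  have h1 : ∀ (a : ∀ i, Fin (p ^ n i)) (g : DivPow F p n),
      pderivLin F p n i (monBasis F p n a * g) =
        monBasis F p n a * pderivLin F p n i g + g * pderivLin F p n i (monBasis F p n a) := by
    intro a g
    have : pderivLin F p n i ∘ₗ mulLin F p n (monBasis F p n a) =
        mulLin F p n (monBasis F p n a) ∘ₗ pderivLin F p n i +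
          (mulLin F p n).flip (pderivLin F p n i (monBasis F p n a)) :=
      (monBasis F p n).ext fun b => key a b
    exact congrArg (fun φ => φ g) this
  have : pderivLin F p n i ∘ₗ (mulLin F p n).flip g =
      (mulLin F p n).flip (pderivLin F p n i g) + mulLin F p n g ∘ₗ pderivLin F p n i :=
    (monBasis F p n).ext fun a => h1 a g
  exact congrArg (fun φ => φ f) this

variable (F p n) in
/-- The partial derivative `∂_i` as a derivation of the algebra `O(m; n)`. -/
def pderiv [Fact p.Prime] [CharP F p] (i : ι) : Derivation F (DivPow F p n) (DivPow F p n) :=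
  Derivation.mk' (pderivLin F p n i) (pderivLin_mul i)

end DivPow

/-! ### Hamiltonian algebras

The `2r` indices are `Fin r ⊕ Fin r`: the index `i ≤ r` is `Sum.inl i` and the index `r + i` is
`Sum.inr i`, so that `i'` is `i.swap`. -/

namespace Hamiltonian

open DivPow

/-- The sign `σ(i)`: `1` on the first `r` indices, `-1` on the last `r`. -/
def sgn {r : ℕ} : Fin r ⊕ Fin r → ℤ := Sum.elim (fun _ => 1) (fun _ => -1)

variable (F : Type*) [Field F] (p : ℕ) [Fact p.Prime] [CharP F p] {r : ℕ} (n : Fin r ⊕ Fin r → ℕ)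

/-- The operator `D_H(f) = ∑ i, σ(i) ∂_i(f) ∂_{i'}` from `O(2r; n)` to the derivations of
`O(2r; n)`. -/
def DH : DivPow F p n →ₗ[F] Derivation F (DivPow F p n) (DivPow F p n) where
  toFun f := ∑ i, sgn i • (pderiv F p n i f • pderiv F p n i.swap)
  map_add' f g := by
    simp only [map_add, add_smul, smul_add, Finset.sum_add_distrib]
  map_smul' t f := by
    simp only [Derivation.map_smul, smul_assoc, RingHom.id_apply, Finset.smul_sum]
    refine Finset.sum_congr rfl fun i _ => smul_comm _ _ _

/-- The tuple `τ(n) = (p ^ n_1 - 1, …, p ^ n_{2r} - 1)`. -/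
def tau : Fin r ⊕ Fin r → ℕ := fun i => p ^ n i - 1

variable {F p n}

theorem DH_apply (f g : DivPow F p n) :
    DH F p n f g = ∑ i, sgn i • (pderiv F p n i f * pderiv F p n i.swap g) := by
  change (∑ i, sgn i • (pderiv F p n i f • pderiv F p n i.swap)) g = _
  rw [← Derivation.coeFnAddMonoidHom_apply, map_sum, Finset.sum_apply]
  rfl

theorem pderiv_comm (i j : Fin r ⊕ Fin r) (f : DivPow F p n) :
    pderiv F p n i (pderiv F p n j f) = pderiv F p n j (pderiv F p n i f) := by
  rcases eq_or_ne i j with rfl | hij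
  · rfl
  funext c
  change pderivLin F p n i (pderivLin F p n j f) c = pderivLin F p n j (pderivLin F p n i f) c
  simp only [pderivLin_apply, Function.update_of_ne hij, Function.update_of_ne hij.symm]
  split_ifs <;> try rfl
  rw [Function.update_comm hij]

theorem sgn_swap (i : Fin r ⊕ Fin r) : sgn i.swap = -sgn i := by
  cases i <;> simp [sgn]

theorem DH_apply_DH (f g h : DivPow F p n) : DH F p n f (DH F p n g h) =
    (∑ j, ∑ i, sgn j • sgn i • (pderiv F p n j g *
      (pderiv F p n i f * pderiv F p n i.swap (pderiv F p n j.swap h)))) +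
    ∑ j, ∑ i, sgn j • sgn i • (pderiv F p n j.swap h *
      (pderiv F p n i f * pderiv F p n i.swap (pderiv F p n j g))) := by
  rw [DH_apply g h]
  simp only [map_sum, map_zsmul, Derivation.leibniz, smul_eq_mul, smul_add,
    Finset.sum_add_distrib]
  simp only [DH_apply, Finset.mul_sum, Finset.smul_sum, mul_smul_comm]

theorem DH_DH_apply (f g h : DivPow F p n) : DH F p n (DH F p n f g) h =
    (∑ j, ∑ i, sgn j • sgn i • (pderiv F p n i f *
      pderiv F p n j (pderiv F p n i.swap g) * pderiv F p n j.swap h)) +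
    ∑ j, ∑ i, sgn j • sgn i • (pderiv F p n i.swap g *
      pderiv F p n j (pderiv F p n i f) * pderiv F p n j.swap h) := by
  rw [DH_apply (DH F p n f g) h]
  simp only [DH_apply f g, map_sum, map_zsmul, Derivation.leibniz, smul_eq_mul, smul_add,
    Finset.sum_add_distrib, Finset.sum_mul, Finset.smul_sum, add_mul, smul_mul_assoc]

/-- `[D_H(f), D_H(g)] = D_H(D_H(f)(g))`. -/
theorem DH_lie (f g : DivPow F p n) : ⁅DH F p n f, DH F p n g⁆ = DH F p n (DH F p n f g) := by
  ext h
  rw [Derivation.commutator_apply, sub_eq_iff_eq_add, DH_apply_DH, DH_apply_DH, DH_DH_apply]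
  have e1 : ∑ j : Fin r ⊕ Fin r, ∑ i : Fin r ⊕ Fin r, sgn j • sgn i • (pderiv F p n j g *
        (pderiv F p n i f * pderiv F p n i.swap (pderiv F p n j.swap h))) =
      ∑ j : Fin r ⊕ Fin r, ∑ i : Fin r ⊕ Fin r, sgn j • sgn i • (pderiv F p n j f *
        (pderiv F p n i g * pderiv F p n i.swap (pderiv F p n j.swap h))) := by
    rw [Finset.sum_comm]
    refine Finset.sum_congr rfl fun i _ => Finset.sum_congr rfl fun j _ => ?_
    rw [pderiv_comm j.swap, smul_comm, mul_left_comm]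
  have e2 : ∑ j : Fin r ⊕ Fin r, ∑ i : Fin r ⊕ Fin r, sgn j • sgn i • (pderiv F p n j.swap h *
        (pderiv F p n i g * pderiv F p n i.swap (pderiv F p n j f))) =
      - ∑ j : Fin r ⊕ Fin r, ∑ i : Fin r ⊕ Fin r, sgn j • sgn i • (pderiv F p n i.swap g *
        pderiv F p n j (pderiv F p n i f) * pderiv F p n j.swap h) := by
    rw [← Finset.sum_neg_distrib]
    refine Finset.sum_congr rfl fun j _ => ?_
    rw [← Finset.sum_neg_distrib, ← (Equiv.sumComm (Fin r) (Fin r)).sum_comp]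
    refine Finset.sum_congr rfl fun i _ => ?_
    simp only [Equiv.sumComm_apply, sgn_swap, Sum.swap_swap]
    rw [pderiv_comm i j, neg_smul, smul_neg]
    congr 3
    ring
  have e4 : ∑ j : Fin r ⊕ Fin r, ∑ i : Fin r ⊕ Fin r, sgn j • sgn i • (pderiv F p n j.swap h *
        (pderiv F p n i f * pderiv F p n i.swap (pderiv F p n j g))) =
      ∑ j : Fin r ⊕ Fin r, ∑ i : Fin r ⊕ Fin r, sgn j • sgn i • (pderiv F p n i f *
        pderiv F p n j (pderiv F p n i.swap g) * pderiv F p n j.swap h) := by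
    refine Finset.sum_congr rfl fun j _ => Finset.sum_congr rfl fun i _ => ?_
    rw [pderiv_comm j]
    congr 2
    ring
  rw [e1, e2, e4]
  abel

theorem DH_apply_tau (f g : DivPow F p n) (c : ∀ i, Fin (p ^ n i))
    (hc : (fun i => (c i : ℕ)) = tau p n) : DH F p n f g c = 0 := by
  have h0 : ∀ i (k : DivPow F p n), pderiv F p n i k c = 0 := by
    intro i k
    change pderivLin F p n i k c = 0
    have := congrFun hc i
    simp only [tau] at this
    rw [pderivLin_apply, dif_neg]
    omega
  have e : DH F p n f g = ∑ i, sgn i • pderiv F p n i (f * pderiv F p n i.swap g) := by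
    rw [DH_apply]
    simp only [Derivation.leibniz, smul_add, smul_eq_mul, Finset.sum_add_distrib]
    have : ∑ i, sgn i • (f * pderiv F p n i (pderiv F p n i.swap g)) = 0 := by
      rw [Fintype.sum_sum_type, ← Finset.sum_add_distrib]
      refine Finset.sum_eq_zero fun i _ => ?_
      simp only [sgn, Sum.elim_inl, Sum.elim_inr, Sum.swap_inl, Sum.swap_inr, one_smul, neg_smul]
      rw [pderiv_comm, add_neg_cancel]
    rw [this, zero_add]
    exact Finset.sum_congr rfl fun i _ => by rw [mul_comm]
  rw [e]
  have hs : ∀ s : Finset (Fin r ⊕ Fin r), ∀ k : Fin r ⊕ Fin r → DivPow F p n,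
      (∀ i, k i c = 0) → (∑ i ∈ s, k i) c = 0 := by
    intro s k hk
    have := map_sum (LinearMap.proj (R := F) (φ := fun _ : (∀ i, Fin (p ^ n i)) => F) c) k s
    refine Eq.trans this (Finset.sum_eq_zero fun i _ => hk i)
  refine hs _ _ fun i => ?_
  rcases i with i | i
  · simp only [sgn, Sum.elim_inl, one_smul, h0]
  · simp only [sgn, Sum.elim_inr, neg_smul, one_smul]
    exact neg_eq_zero.2 (h0 _ _)

variable (F p n) in
/-- The spanning set `{D_H(x^(a)) | 0 < a < τ(n)}`, for the componentwise order. -/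
def gens : Set (Derivation F (DivPow F p n) (DivPow F p n)) :=
  {D | ∃ a : Fin r ⊕ Fin r → ℕ, 0 < a ∧ a < tau p n ∧ D = DH F p n (mon F p n a)}

theorem DH_mem_span (f : DivPow F p n)
    (hf : ∀ c : (∀ i, Fin (p ^ n i)), (fun i => (c i : ℕ)) = tau p n → f c = 0) :
    DH F p n f ∈ Submodule.span F (gens F p n) := by
  have hsum : f = ∑ c : (∀ i, Fin (p ^ n i)), f c • monBasis F p n c :=
    ((monBasis F p n).sum_repr f).symm
  rw [hsum, map_sum]
  refine Submodule.sum_mem _ fun c _ => ?_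
  rw [map_smul, monBasis_apply]
  by_cases h1 : (fun i => (c i : ℕ)) = tau p n
  · rw [hf c h1, zero_smul]
    exact Submodule.zero_mem _
  by_cases h0 : (fun i => (c i : ℕ)) = 0
  · have : DH F p n (mon F p n 0) = 0 := by
      ext g
      rw [DH_apply]
      exact Finset.sum_eq_zero fun i _ => by
        have : pderiv F p n i (1 : DivPow F p n) = 0 := Derivation.map_one_eq_zero _
        rw [show mon F p n 0 = 1 from rfl, this, zero_mul, smul_zero]
    rw [h0, this, smul_zero]
    exact Submodule.zero_mem _
  · refine Submodule.smul_mem _ _ (Submodule.subset_span ⟨_, ?_, ?_, rfl⟩)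
    · exact lt_of_le_of_ne (fun i => Nat.zero_le _) (Ne.symm h0)
    · refine lt_of_le_of_ne (fun i => ?_) h1
      have := (c i).isLt
      simp only [tau]
      omega

theorem lie_mem_span {D E : Derivation F (DivPow F p n) (DivPow F p n)}
    (hD : D ∈ Submodule.span F (gens F p n)) (hE : E ∈ Submodule.span F (gens F p n)) :
    ⁅D, E⁆ ∈ Submodule.span F (gens F p n) := by
  induction hD using Submodule.span_induction with
  | zero => rw [zero_lie]; exact Submodule.zero_mem _
  | add x y _ _ hx hy => rw [add_lie]; exact Submodule.add_mem _ hx hy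
  | smul t x _ hx => rw [smul_lie]; exact Submodule.smul_mem _ _ hx
  | mem D hD =>
    induction hE using Submodule.span_induction with
    | zero => rw [lie_zero]; exact Submodule.zero_mem _
    | add x y _ _ hx hy => rw [lie_add]; exact Submodule.add_mem _ hx hy
    | smul t x _ hx => rw [lie_smul]; exact Submodule.smul_mem _ _ hx
    | mem E hE =>
      obtain ⟨a, _, _, rfl⟩ := hD
      obtain ⟨b, _, _, rfl⟩ := hE
      rw [DH_lie]
      exact DH_mem_span _ fun c hc => DH_apply_tau _ _ c hc

variable (F p n) in
/-- The Hamiltonian algebra `H(2r; n)^(2) = span {D_H(x^(a)) | 0 < a < τ(n)}`, a Lie algebra under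
the commutator of derivations of `O(2r; n)`. -/
def H2 : LieSubalgebra F (Derivation F (DivPow F p n) (DivPow F p n)) where
  toSubmodule := Submodule.span F (gens F p n)
  lie_mem' hD hE := lie_mem_span hD hE

end Hamiltonian

/-! ### Outer derivations and the model Lie algebras -/

/-- The Lie algebra of outer derivations `Out(L) = Der(L) / Inn(L)`; the ideal `Inn(L)` is the
range of `ad : L → Der(L)`. -/
abbrev OuterDer (F L : Type*) [CommRing F] [LieRing L] [LieAlgebra F L] : Type _ :=
  LieDerivation F L L ⧸ (LieDerivation.ad F L).idealRange

/-- The module `V` as an abelian Lie algebra. -/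
def AbelianLie (V : Type*) : Type _ := V

namespace AbelianLie

variable {F V : Type*} [CommRing F] [AddCommGroup V] [Module F V]

instance : AddCommGroup (AbelianLie V) := inferInstanceAs (AddCommGroup V)

instance : Module F (AbelianLie V) := inferInstanceAs (Module F V)

instance : LieRing (AbelianLie V) where
  bracket _ _ := 0
  add_lie _ _ _ := (add_zero 0).symm
  lie_add _ _ _ := (add_zero 0).symm
  lie_self _ := rfl
  leibniz_lie _ _ _ := (add_zero 0).symm

instance : LieAlgebra F (AbelianLie V) where
  lie_smul t _ _ := (smul_zero t).symm

theorem lie_eq_zero (x y : AbelianLie V) : ⁅x, y⁆ = 0 := rfl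

/-- Every linear endomorphism of an abelian Lie algebra is a derivation. -/
def toDer (φ : V →ₗ[F] V) : LieDerivation F (AbelianLie V) (AbelianLie V) where
  toLinearMap := (φ : AbelianLie V →ₗ[F] AbelianLie V)
  leibniz' x y := by
    simp only [lie_eq_zero, sub_self]
    exact φ.map_zero

/-- The derivation `diag(d_1, …, d_k)` of the abelian Lie algebra `F^k`. -/
def diagDer {k : ℕ} (d : Fin k → F) :
    LieDerivation F (AbelianLie (Fin k → F)) (AbelianLie (Fin k → F)) :=
  toDer (LinearMap.pi fun i => d i • LinearMap.proj i)

end AbelianLie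

/-- The action of the one-dimensional Lie algebra `F` on `K` in which `t` acts by `t • D`. -/
def lineAction {F K : Type*} [CommRing F] [LieRing K] [LieAlgebra F K] (D : LieDerivation F K K) :
    AbelianLie F →ₗ⁅F⁆ LieDerivation F K K where
  toFun t := (show F from t) • D
  map_add' s t := add_smul (show F from s) (show F from t) D
  map_smul' s t := mul_smul s (show F from t) D
  map_lie' {s t} := by
    have key : ∀ a b : F, ⁅a • D, b • D⁆ = 0 := fun a b => by
      ext x
      simp only [LieDerivation.lie_apply, LieDerivation.smul_apply, LieDerivation.zero_apply,
        map_smul, smul_comm a b, sub_self]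
    exact (zero_smul F D).trans (key s t).symm

/-- The semidirect sum `K ⋊ F` in which `F` acts on `K` by the derivation `D`. -/
abbrev LineExt {F K : Type*} [CommRing F] [LieRing K] [LieAlgebra F K] (D : LieDerivation F K K) :
    Type _ :=
  LieAlgebra.SemiDirectSum K (AbelianLie F) (lineAction D)

/-- The Heisenberg Lie algebra `h_3(F)`: the vector `x` stands for `x_0 e_1 + x_1 e_2 + x_2 e_3`,
with `[e_1, e_2] = e_3` and `e_3` central. -/
def Heis (F : Type*) : Type _ := Fin 3 → F

namespace Heis

variable {F : Type*} [CommRing F]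

instance : AddCommGroup (Heis F) := inferInstanceAs (AddCommGroup (Fin 3 → F))

instance : Module F (Heis F) := inferInstanceAs (Module F (Fin 3 → F))

instance : Bracket (Heis F) (Heis F) where
  bracket x y := (![0, 0, x 0 * y 1 - x 1 * y 0] : Fin 3 → F)

theorem ext' {x y : Heis F} (h0 : x 0 = y 0) (h1 : x 1 = y 1) (h2 : x 2 = y 2) : x = y := by
  funext i
  fin_cases i
  exacts [h0, h1, h2]

theorem add_apply (x y : Heis F) (i : Fin 3) : (x + y) i = x i + y i := rfl

theorem sub_apply (x y : Heis F) (i : Fin 3) : (x - y) i = x i - y i := rfl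

theorem smul_apply (t : F) (x : Heis F) (i : Fin 3) : (t • x) i = t * x i := rfl

theorem zero_apply (i : Fin 3) : (0 : Heis F) i = 0 := rfl

theorem lie_apply_zero (x y : Heis F) : ⁅x, y⁆ (0 : Fin 3) = 0 := rfl

theorem lie_apply_one (x y : Heis F) : ⁅x, y⁆ (1 : Fin 3) = 0 := rfl

theorem lie_apply_two (x y : Heis F) : ⁅x, y⁆ (2 : Fin 3) = x 0 * y 1 - x 1 * y 0 := rfl

instance : LieRing (Heis F) where
  add_lie x y z := by
    apply ext' <;> simp only [lie_apply_zero, lie_apply_one, lie_apply_two, add_apply] <;> ring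
  lie_add x y z := by
    apply ext' <;> simp only [lie_apply_zero, lie_apply_one, lie_apply_two, add_apply] <;> ring
  lie_self x := by
    apply ext' <;> simp only [lie_apply_zero, lie_apply_one, lie_apply_two, zero_apply] <;> ring
  leibniz_lie x y z := by
    apply ext' <;> simp only [lie_apply_zero, lie_apply_one, lie_apply_two, add_apply] <;> ring

instance : LieAlgebra F (Heis F) where
  lie_smul t x y := by
    apply ext' <;> simp only [lie_apply_zero, lie_apply_one, lie_apply_two, smul_apply] <;> ring

/-- The linear map `diag(1, 1, -1)` of `h_3(F)`. -/
def diagLin : Heis F →ₗ[F] Heis F where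
  toFun x := (![x 0, x 1, -x 2] : Fin 3 → F)
  map_add' _ _ := ext' rfl rfl (neg_add _ _)
  map_smul' _ _ := ext' rfl rfl (mul_neg _ _).symm

theorem diagLin_apply_zero (x : Heis F) : diagLin x (0 : Fin 3) = x 0 := rfl

theorem diagLin_apply_one (x : Heis F) : diagLin x (1 : Fin 3) = x 1 := rfl

theorem diagLin_apply_two (x : Heis F) : diagLin x (2 : Fin 3) = -x 2 := rfl

/-- In characteristic `3`, `diag(1, 1, -1)` is a derivation of `h_3(F)`. -/
def diagDer [CharP F 3] : LieDerivation F (Heis F) (Heis F) where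
  toLinearMap := diagLin
  leibniz' x y := by
    have h3 : (3 : F) = 0 := by exact_mod_cast CharP.cast_eq_zero F 3
    apply ext' <;> simp only [sub_apply, lie_apply_zero, lie_apply_one, lie_apply_two,
      diagLin_apply_zero, diagLin_apply_one, diagLin_apply_two]
    · ring
    · ring
    · linear_combination (x 1 * y 0 - x 0 * y 1) * h3

end Heis

/-!
The derivations of `𝔤 = H(2r; n)^(2)` are computed from the normalizer of `𝔤` in the derivations
of the divided power algebra.  This normalizer contains, besides `𝔤`, the Euler derivation
`E = ∑ x_i ∂_i`, the Hamiltonian derivation `X = D_H(x^(τ))` of the top monomial, the derivations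
`A_i = x_i^(τ_i) ∂_{i'}` (formally `± D_H(x_i^(3 ^ n_i))`, a potential out of range), and the
derivations `P_{i,k} = ∂_i ^ (3 ^ k)`, `0 < k < n_i`.  The claim is that their classes form a
basis of `Out(𝔤)`; then `Out(𝔤)` has dimension `1 + 1 + 2r + (|n| - 2r)`, and its brackets can be
read off from those in the normalizer.

*Spanning* (`exists_eq_act`).  Write elements of `𝔤` by their potentials, so that `∑ j, f_j dx_j`,
with `f_j` up to sign the potential of `D(x_{j'})`, is a one-form attached to a derivation `D`.
Since the variables commute modulo constants, this form is closed, except that constants are lost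
and its linear part need not be symmetric; brackets with the quadratic potentials show that the
defect is a scalar, which a multiple of `E` removes (`exists_sub_symm`, `oneForm_closed`).  By the
Poincaré lemma (`DivPow.exists_potential`) the form is then exact up to the pure terms
`x_j^(τ_j) dx_j`, and these come from the `A_j`.  So `D` may be assumed to kill the variables
(`exists_sub_var`), after a further linear potential also the torus elements `x_k x_{k'}`
(`exists_killsTorus`), and after a combination of the `P_{i,k}` to have no `x_i`-term in the value
at `x_i^(3 ^ k + 1)` (`exists_normalized`).  Such a `D` vanishes, by induction on the degree of
monomials.  A value `D(x^(a))` with `D = 0` in smaller degrees is linear and has the weight of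
`x^(a)` modulo `3` (`KillsTorus.eq_zero`), and most monomials are brackets of monomials of smaller
degree: with `x_j^(k + 1)` for `r = 1`, and with `x_j^(2) x_{j'}` or `x_i x_j` for `r > 1`
(`KillsTorus.pure`, `eq_zero_of_rank_one`, `KillsTorus.eq_zero_of_rank_gt`).

*Independence* (`eq_zero_of_act_outer_eq`).  The coefficients of `X`, `A_i`, `E` and `P_{i,k}` in a
combination can be detected on the variables and on the `x_i^(3 ^ k + 1)`, where inner derivations
do not contribute.

*Brackets* (`lie_outerClass_outer`).  Modulo `𝔤` one has `[E, X] = (r + 1) X`, `[E, A_i] = A_i`,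
and `[A_i, A_{i'}] = ∓ D_H(x_i^(τ_i) x_{i'}^(τ_{i'}))`, which is `∓ X` for `r = 1` and inner for
`r > 1`; all other brackets vanish.  So the `A_i` and `X` span a Heisenberg algebra for `r = 1` and
an abelian algebra for `r > 1`, on which `E` acts by `1` on the `A_i` and by `r + 1` on `X`, and
the `P_{i,k}` are central.
-/

/-! ### Coefficients and monomials of divided power algebras -/

namespace DivPow

section Coeff

variable {F : Type*} [Field F] {p : ℕ} {ι : Type*} [Fintype ι] [DecidableEq ι] {n : ι → ℕ}

variable (F p n) in
/-- The coefficient of `x^(a)`, for every multi-index `a : ι → ℕ`; it is zero when some `a_i` is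
at least `p ^ n_i`, which lets `∂_i` shift coefficients without side conditions. -/
def coeff (a : ι → ℕ) : DivPow F p n →ₗ[F] F where
  toFun f := if h : ∀ i, a i < p ^ n i then f fun i => ⟨a i, h i⟩ else 0
  map_add' f g := by
    split_ifs
    · rfl
    · simp
  map_smul' t f := by
    split_ifs
    · rfl
    · simp

theorem coeff_def (a : ι → ℕ) (f : DivPow F p n) :
    coeff F p n a f = if h : ∀ i, a i < p ^ n i then f fun i => ⟨a i, h i⟩ else 0 := rfl

theorem coeff_eq_zero {a : ι → ℕ} {i : ι} (h : p ^ n i ≤ a i) (f : DivPow F p n) :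
    coeff F p n a f = 0 := by
  rw [coeff_def, dif_neg]
  intro h'
  have := h' i
  omega

theorem ext_coeff {f g : DivPow F p n}
    (h : ∀ a, (∀ i, a i < p ^ n i) → coeff F p n a f = coeff F p n a g) : f = g := by
  funext c
  have := h (fun i => c i) fun i => (c i).isLt
  rwa [coeff_def, coeff_def, dif_pos fun i => (c i).isLt, dif_pos fun i => (c i).isLt] at this

theorem coeff_mon (a : ι → ℕ) {b : ι → ℕ} (hb : ∀ i, b i < p ^ n i) :
    coeff F p n a (mon F p n b) = if a = b then 1 else 0 := by
  rw [coeff_def]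
  split_ifs with h1 h2 h2
  · simp only [mon, h2, if_true]
  · simp only [mon, h2, if_false]
  · exact absurd (h2 ▸ hb) h1
  · rfl

theorem coeff_mon_self {b : ι → ℕ} (hb : ∀ i, b i < p ^ n i) :
    coeff F p n b (mon F p n b) = 1 := by
  rw [coeff_mon _ hb, if_pos rfl]

theorem coeff_mon_of_ne {a b : ι → ℕ} (hab : a ≠ b) : coeff F p n a (mon F p n b) = 0 := by
  by_cases hb : ∀ i, b i < p ^ n i
  · rw [coeff_mon _ hb, if_neg hab]
  · push Not at hb
    obtain ⟨i, hi⟩ := hb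
    rw [mon_eq_zero hi, map_zero]

theorem span_mon : Submodule.span F {f | ∃ a : ι → ℕ, (∀ i, a i < p ^ n i) ∧ f = mon F p n a} =
    (⊤ : Submodule F (DivPow F p n)) := by
  rw [← (monBasis F p n).span_eq]
  congr 1
  ext f
  constructor
  · rintro ⟨a, ha, rfl⟩
    exact ⟨fun i => ⟨a i, ha i⟩, monBasis_apply _⟩
  · rintro ⟨a, rfl⟩
    exact ⟨_, fun i => (a i).isLt, monBasis_apply _⟩

variable [Fact p.Prime]

theorem mon_single_mul_mon (j : ι) (k : ℕ) (b : ι → ℕ) :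
    mon F p n (Pi.single j k) * mon F p n b =
      ((k + b j).choose k : F) • mon F p n (b + Pi.single j k) := by
  by_cases hb : ∀ i, b i < p ^ n i
  · rw [mon_mul_mon' _ _ hb, add_comm b, ← Finset.mul_prod_erase _ _ (Finset.mem_univ j),
      Finset.prod_eq_one, mul_one, Pi.single_eq_same]
    intro i hi
    rw [Pi.single_eq_of_ne (Finset.ne_of_mem_erase hi), Nat.choose_zero_right]
  · push Not at hb
    obtain ⟨i, hi⟩ := hb
    have h : mon F p n (b + Pi.single j k) = 0 := by
      refine mon_eq_zero (i := i) ?_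
      rw [Pi.add_apply]
      omega
    rw [mon_eq_zero hi, h, mul_zero, smul_zero]

theorem coeff_mon_single_mul (j : ι) (k : ℕ) (b : ι → ℕ) (f : DivPow F p n) :
    coeff F p n (b + Pi.single j k) (mon F p n (Pi.single j k) * f) =
      if b j + k < p ^ n j then ((k + b j).choose k : F) * coeff F p n b f else 0 := by
  have hf : f ∈ (⊤ : Submodule F (DivPow F p n)) := trivial
  rw [← span_mon] at hf
  induction hf using Submodule.span_induction with
  | zero => simp
  | add f g _ _ hf hg => rw [mul_add, map_add, hf, hg, map_add]; split_ifs <;> ring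
  | smul t f _ hf =>
    rw [mul_smul_comm, map_smul, hf, map_smul, smul_eq_mul, smul_eq_mul]
    split_ifs <;> ring
  | mem f hf =>
    obtain ⟨a, ha, rfl⟩ := hf
    rw [mon_single_mul_mon, map_smul, smul_eq_mul]
    by_cases hab : b = a
    · subst hab
      split_ifs with h
      · rw [coeff_mon_self ha, coeff_mon_self]
        intro i
        rw [Pi.add_apply]
        by_cases hij : i = j
        · subst hij
          rwa [Pi.single_eq_same]
        · rw [Pi.single_eq_of_ne hij, add_zero]
          exact ha i
      · rw [coeff_eq_zero (i := j), mul_zero]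
        rw [Pi.add_apply, Pi.single_eq_same]
        omega
    · rw [coeff_mon_of_ne hab, coeff_mon_of_ne fun h => hab (add_right_cancel h)]
      simp

theorem coeff_mon_single_mul_of_lt {j : ι} {k : ℕ} {a : ι → ℕ} (h : a j < k)
    (f : DivPow F p n) :
    coeff F p n a (mon F p n (Pi.single j k) * f) = 0 := by
  have hf : f ∈ (⊤ : Submodule F (DivPow F p n)) := trivial
  rw [← span_mon] at hf
  induction hf using Submodule.span_induction with
  | zero => simp
  | add f g _ _ hf hg => rw [mul_add, map_add, hf, hg, add_zero]
  | smul t f _ hf => rw [mul_smul_comm, map_smul, hf, smul_zero]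
  | mem f hf =>
    obtain ⟨b, _, rfl⟩ := hf
    rw [mon_single_mul_mon, map_smul, coeff_mon_of_ne, smul_zero]
    rintro rfl
    rw [Pi.add_apply, Pi.single_eq_same] at h
    omega

variable [CharP F p]

theorem coeff_pderiv (i : ι) (a : ι → ℕ) (f : DivPow F p n) :
    coeff F p n a (pderiv F p n i f) = coeff F p n (a + Pi.single i 1) f := by
  change coeff F p n a (pderivLin F p n i f) = _
  have e : (a + Pi.single i 1 : ι → ℕ) = Function.update a i (a i + 1) := by
    funext j
    by_cases hj : j = i
    · subst hj
      simp
    · simp [hj]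
  have hp : ∀ k, 0 < p ^ n k := fun i => pow_pos (Fact.out : p.Prime).pos _
  by_cases h : ∀ k, a k < p ^ n k
  · by_cases h' : a i + 1 < p ^ n i
    · have h2 : ∀ k, (a + Pi.single i 1 : ι → ℕ) k < p ^ n k := by
        intro k
        rw [e]
        by_cases hk : k = i
        · subst hk
          simpa using h'
        · simpa [hk] using h k
      rw [coeff_def, dif_pos h, coeff_def, dif_pos h2, pderivLin_apply, dif_pos h']
      congr 1
      funext k
      apply Fin.ext
      simp only [e]
      by_cases hk : k = i
      · subst hk
        simp
      · simp [hk]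
    · rw [coeff_def, dif_pos h, pderivLin_apply, dif_neg h', coeff_eq_zero (i := i)]
      simp only [Pi.add_apply, Pi.single_eq_same]
      omega
  · push Not at h
    obtain ⟨k, hk⟩ := h
    rw [coeff_eq_zero hk, coeff_eq_zero (i := k)]
    rw [Pi.add_apply]
    omega

theorem coeff_iterate_pderiv (i : ι) (k : ℕ) (a : ι → ℕ) (f : DivPow F p n) :
    coeff F p n a ((pderiv F p n i)^[k] f) = coeff F p n (a + Pi.single i k) f := by
  induction k generalizing a with
  | zero => simp
  | succ k ih =>
    rw [Function.iterate_succ_apply', coeff_pderiv, ih, add_assoc, ← Pi.single_add, add_comm 1 k]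

/-- `x_i ∂_i` multiplies the coefficient of `x^(a)` by `a_i`. -/
theorem coeff_mul_pderiv (i : ι) (a : ι → ℕ) (f : DivPow F p n) :
    coeff F p n a (mon F p n (Pi.single i 1) * pderiv F p n i f) = (a i : F) * coeff F p n a f := by
  by_cases h : a i = 0
  · rw [coeff_mon_single_mul_of_lt (by omega), h, Nat.cast_zero, zero_mul]
  · have e : a = (a - Pi.single i 1) + Pi.single i 1 := by
      funext j
      by_cases hj : j = i
      · subst hj
        simp only [Pi.add_apply, Pi.sub_apply, Pi.single_eq_same]
        omega
      · simp [hj]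
    conv_lhs => rw [e]
    rw [coeff_mon_single_mul, coeff_pderiv, ← e]
    have e1 : (a - Pi.single i 1 : ι → ℕ) i = a i - 1 := by simp
    rw [e1, Nat.choose_one_right, show 1 + (a i - 1) = a i by omega]
    split_ifs with h2
    · rfl
    · rw [coeff_eq_zero (i := i) (by omega), mul_zero]

theorem pderiv_mon_add (i : ι) {a : ι → ℕ} (h : a i + 1 < p ^ n i) :
    pderiv F p n i (mon F p n (a + Pi.single i 1)) = mon F p n a := by
  refine ext_coeff fun c hc => ?_
  rw [coeff_pderiv]
  by_cases hca : c = a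
  · subst hca
    rw [coeff_mon_self hc, coeff_mon_self]
    intro k
    by_cases hk : k = i
    · subst hk
      simpa using h
    · simpa [hk] using hc k
  · rw [coeff_mon_of_ne hca, coeff_mon_of_ne fun e => hca (add_right_cancel e)]

theorem pderiv_mon_eq_zero (i : ι) {a : ι → ℕ} (h : a i = 0) :
    pderiv F p n i (mon F p n a) = 0 := by
  refine ext_coeff fun c hc => ?_
  rw [coeff_pderiv, map_zero, coeff_mon_of_ne]
  rintro rfl
  simp at h

/-- The Poincaré lemma: a family of coefficients that is closed as a one-form is the family of
partial derivatives of some element, as far as these are in range. -/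
theorem exists_potential {f : ι → (ι → ℕ) → F}
    (hf : ∀ (i j : ι) (c : ι → ℕ), f j (c + Pi.single i 1) = f i (c + Pi.single j 1)) :
    ∃ h : DivPow F p n, ∀ j c, (∀ i, (c + Pi.single j 1 : ι → ℕ) i < p ^ n i) →
      coeff F p n (c + Pi.single j 1) h = f j c := by
  classical
  -- integrate in any direction that occurs in the monomial; closedness makes the choice immaterial
  let g : (ι → ℕ) → F := fun a => if ha : ∃ j, a j ≠ 0 then f ha.choose (a - Pi.single ha.choose 1)
    else 0
  let h : DivPow F p n := fun a => g fun i => a i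
  refine ⟨h, fun j c hc => ?_⟩
  rw [coeff_def, dif_pos hc]
  change g (c + Pi.single j 1) = f j c
  have ha : ∃ i, (c + Pi.single j 1 : ι → ℕ) i ≠ 0 := ⟨j, by simp⟩
  simp only [g]
  rw [dif_pos ha]
  have hk := ha.choose_spec
  generalize ha.choose = k at hk ⊢
  by_cases hkj : k = j
  · rw [hkj, add_tsub_cancel_right]
  · have hck : c k ≠ 0 := by simpa [hkj] using hk
    have e : c = (c - Pi.single k 1) + Pi.single k 1 := by
      funext i
      by_cases hi : i = k
      · subst hi
        simp only [Pi.add_apply, Pi.sub_apply, Pi.single_eq_same]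
        omega
      · simp [hi]
    rw [congrArg (f j) e, hf k j, e, add_right_comm, add_tsub_cancel_right, ← e]

end Coeff

end DivPow

/-! ### The Poisson bracket and the Hamiltonian algebra -/

namespace Hamiltonian

open DivPow

section Poisson

variable {F : Type*} [Field F] {p : ℕ} [Fact p.Prime] [CharP F p] {r : ℕ}
  {n : Fin r ⊕ Fin r → ℕ}

theorem swap_ne (i : Fin r ⊕ Fin r) : i.swap ≠ i := by
  cases i <;> simp

theorem sgn_mul_self (i : Fin r ⊕ Fin r) : (sgn i : F) * sgn i = 1 := by
  cases i <;> simp [sgn]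

theorem sgn_ne_zero (i : Fin r ⊕ Fin r) : (sgn i : F) ≠ 0 := fun h => by
  have := sgn_mul_self (F := F) i
  rw [h, mul_zero] at this
  exact zero_ne_one this

theorem sgn_swap_cast (i : Fin r ⊕ Fin r) : (sgn i.swap : F) = -sgn i := by
  rw [sgn_swap, Int.cast_neg]

theorem one_lt_pow_of_pos {i : Fin r ⊕ Fin r} (h : 1 ≤ n i) : 1 < p ^ n i :=
  Nat.one_lt_pow (by omega) (Fact.out : p.Prime).one_lt

theorem mon_single_zero (i : Fin r ⊕ Fin r) : mon F p n (Pi.single i 0) = 1 := by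
  rw [Pi.single_zero]
  rfl

/-- `D_H` depends on its potential through a derivation in each argument. -/
theorem DH_mul_apply (f g h : DivPow F p n) :
    DH F p n (f * g) h = f * DH F p n g h + g * DH F p n f h := by
  simp only [DH_apply, Derivation.leibniz, smul_eq_mul, Finset.mul_sum, ← Finset.sum_add_distrib,
    ← mul_smul_comm, add_mul, smul_add]
  refine Finset.sum_congr rfl fun i _ => ?_
  simp only [mul_smul_comm, mul_assoc]

theorem DH_apply_antisymm (f g : DivPow F p n) : DH F p n f g = -DH F p n g f := by
  rw [DH_apply, DH_apply, ← (Equiv.sumComm (Fin r) (Fin r)).sum_comp, ← Finset.sum_neg_distrib]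
  refine Finset.sum_congr rfl fun i _ => ?_
  simp only [Equiv.sumComm_apply, sgn_swap, Sum.swap_swap]
  rw [neg_smul, mul_comm]

theorem DH_mon_single (j : Fin r ⊕ Fin r) {k : ℕ} (hk : k + 1 < p ^ n j) :
    DH F p n (mon F p n (Pi.single j (k + 1))) =
      (sgn j : F) • (mon F p n (Pi.single j k) • pderiv F p n j.swap) := by
  ext g : 1
  rw [DH_apply, Finset.sum_eq_single j]
  · rw [Pi.single_add, pderiv_mon_add j (by simpa using hk), Derivation.smul_apply,
      Derivation.smul_apply, smul_eq_mul, Int.cast_smul_eq_zsmul]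
  · intro i _ hi
    rw [pderiv_mon_eq_zero i (by rw [Pi.single_eq_of_ne hi]), zero_mul, smul_zero]
  · simp

theorem DH_mon_single_apply (j : Fin r ⊕ Fin r) {k : ℕ} (hk : k + 1 < p ^ n j)
    (g : DivPow F p n) :
    DH F p n (mon F p n (Pi.single j (k + 1))) g =
      (sgn j : F) • (mon F p n (Pi.single j k) * pderiv F p n j.swap g) := by
  rw [DH_mon_single j hk]
  rfl

theorem DH_var {j : Fin r ⊕ Fin r} (hj : 1 ≤ n j) :
    DH F p n (mon F p n (Pi.single j 1)) = (sgn j : F) • pderiv F p n j.swap := by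
  rw [← zero_add 1, DH_mon_single j (k := 0) (by simpa using one_lt_pow_of_pos hj),
    mon_single_zero, one_smul]

theorem DH_var_apply {j : Fin r ⊕ Fin r} (hj : 1 ≤ n j) (g : DivPow F p n) :
    DH F p n (mon F p n (Pi.single j 1)) g = (sgn j : F) • pderiv F p n j.swap g := by
  rw [DH_var hj]
  rfl

theorem coeff_DH_var {j : Fin r ⊕ Fin r} (hj : 1 ≤ n j) (c : Fin r ⊕ Fin r → ℕ)
    (g : DivPow F p n) :
    coeff F p n c (DH F p n (mon F p n (Pi.single j 1)) g) =
      (sgn j : F) * coeff F p n (c + Pi.single j.swap 1) g := by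
  rw [DH_var_apply hj, map_smul, coeff_pderiv, smul_eq_mul]

theorem coeff_tau_DH (f g : DivPow F p n) : coeff F p n (tau p n) (DH F p n f g) = 0 := by
  rw [coeff_def]
  split_ifs
  · exact DH_apply_tau _ _ _ rfl
  · rfl

theorem tau_lt (i : Fin r ⊕ Fin r) : tau p n i < p ^ n i := by
  have : 0 < p ^ n i := pow_pos (Fact.out : p.Prime).pos _
  simp only [tau]
  omega

/-- A potential is determined by its Hamiltonian derivation up to constants. -/
theorem DH_eq_zero_iff (hn : ∀ i, 1 ≤ n i) (f : DivPow F p n) :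
    DH F p n f = 0 ↔ ∀ c, c ≠ 0 → coeff F p n c f = 0 := by
  constructor
  · intro h c hc
    obtain ⟨j, hj⟩ : ∃ j, c j ≠ 0 := Function.ne_iff.1 hc
    have e : c = (c - Pi.single j 1) + Pi.single j 1 := by
      funext i
      by_cases hi : i = j
      · subst hi
        simp only [Pi.add_apply, Pi.sub_apply, Pi.single_eq_same]
        omega
      · simp [hi]
    have h1 := coeff_DH_var (F := F) (p := p) (hn j.swap) (c - Pi.single j 1) f
    rw [DH_apply_antisymm, h, Sum.swap_swap, ← e] at h1
    simp only [Derivation.coe_zero, Pi.zero_apply, neg_zero, map_zero] at h1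
    exact (mul_eq_zero.1 h1.symm).resolve_left (sgn_ne_zero _)
  · intro h
    have h0 : ∀ i, pderiv F p n i f = 0 := fun i => ext_coeff fun c _ => by
      rw [coeff_pderiv, h, map_zero]
      intro h'
      have := congrFun h' i
      simp at this
    ext g
    rw [DH_apply]
    simp [h0]

variable (F p n) in
/-- The projection of the divided power algebra that forgets the coefficient of the top monomial
`x^(τ)`. -/
def strip : DivPow F p n →ₗ[F] DivPow F p n :=
  LinearMap.id - (coeff F p n (tau p n)).smulRight (mon F p n (tau p n))

theorem coeff_strip (c : Fin r ⊕ Fin r → ℕ) (f : DivPow F p n) :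
    coeff F p n c (strip F p n f) = if c = tau p n then 0 else coeff F p n c f := by
  simp only [strip, LinearMap.sub_apply, LinearMap.id_apply, LinearMap.smulRight_apply, map_sub,
    map_smul, smul_eq_mul]
  split_ifs with h
  · rw [h, coeff_mon_self tau_lt, mul_one, sub_self]
  · rw [coeff_mon_of_ne h, mul_zero, sub_zero]

theorem strip_eq_self {f : DivPow F p n} (h : coeff F p n (tau p n) f = 0) :
    strip F p n f = f := by
  simp [strip, h]

theorem DH_mem_H2 {f : DivPow F p n} (h : coeff F p n (tau p n) f = 0) :
    DH F p n f ∈ H2 F p n := by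
  refine DH_mem_span f fun c hc => ?_
  rw [coeff_def, dif_pos tau_lt] at h
  rw [← h]
  congr 1
  funext i
  exact Fin.ext (congrFun hc i)

variable (F p n) in
/-- The linear map `f ↦ D_H(f)` onto `H(2r; n)^(2)`, made total by first discarding the
coefficient of `x^(τ)` in `f`. -/
def ham : DivPow F p n →ₗ[F] H2 F p n where
  toFun f := ⟨DH F p n (strip F p n f), DH_mem_H2 (by rw [coeff_strip, if_pos rfl])⟩
  map_add' f g := Subtype.ext (by simp)
  map_smul' t f := Subtype.ext (by simp)

theorem coe_ham (f : DivPow F p n) : (ham F p n f : Derivation F _ _) = DH F p n (strip F p n f) :=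
  rfl

theorem coe_ham_of_coeff {f : DivPow F p n} (h : coeff F p n (tau p n) f = 0) :
    (ham F p n f : Derivation F _ _) = DH F p n f := by
  rw [coe_ham, strip_eq_self h]

theorem lie_ham {f g : DivPow F p n} (hf : coeff F p n (tau p n) f = 0)
    (hg : coeff F p n (tau p n) g = 0) :
    ⁅ham F p n f, ham F p n g⁆ = ham F p n (DH F p n f g) := by
  apply Subtype.ext
  rw [LieSubalgebra.coe_bracket, coe_ham_of_coeff hf, coe_ham_of_coeff hg,
    coe_ham_of_coeff (coeff_tau_DH f g), DH_lie]

theorem ham_mon_tau : ham F p n (mon F p n (tau p n)) = 0 := by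
  apply Subtype.ext
  rw [coe_ham]
  have : strip F p n (mon F p n (tau p n)) = 0 := by
    simp [strip, coeff_mon_self tau_lt]
  rw [this, map_zero]
  rfl

theorem ham_mon_zero : ham F p n (mon F p n 0) = 0 := by
  by_cases h : (0 : Fin r ⊕ Fin r → ℕ) = tau p n
  · rw [h, ham_mon_tau]
  · apply Subtype.ext
    rw [coe_ham_of_coeff (coeff_mon_of_ne (Ne.symm h))]
    ext g
    have h1 : ∀ i, pderiv F p n i (mon F p n 0) = 0 := fun i => pderiv_mon_eq_zero i rfl
    rw [DH_apply]
    simp [h1]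

theorem span_ham : Submodule.span F {u | ∃ a, ∃ _ : ∀ i, a i < p ^ n i, ∃ _ : a ≠ 0,
    ∃ _ : a ≠ tau p n, u = ham F p n (mon F p n a)} = (⊤ : Submodule F (H2 F p n)) := by
  apply Submodule.map_injective_of_injective (f := (H2 F p n).toSubmodule.subtype)
    Subtype.val_injective
  rw [Submodule.map_span, Submodule.map_top, Submodule.range_subtype]
  change _ = Submodule.span F (gens F p n)
  congr 1
  ext D
  constructor
  · rintro ⟨u, ⟨a, ha, h0, h1, rfl⟩, rfl⟩
    refine ⟨a, lt_of_le_of_ne (fun i => Nat.zero_le _) (Ne.symm h0),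
      lt_of_le_of_ne (fun i => ?_) h1, coe_ham_of_coeff (coeff_mon_of_ne (Ne.symm h1))⟩
    have := ha i
    simp only [tau]
    omega
  · rintro ⟨a, h0, h1, rfl⟩
    exact ⟨_, ⟨a, fun i => (h1.le i).trans_lt (tau_lt i), h0.ne', h1.ne, rfl⟩,
      coe_ham_of_coeff (coeff_mon_of_ne h1.ne')⟩

theorem ham_surjective : Function.Surjective (ham F p n) := by
  rw [← LinearMap.range_eq_top, ← top_le_iff, ← span_ham, Submodule.span_le]
  rintro _ ⟨a, _, _, _, rfl⟩
  exact ⟨_, rfl⟩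

variable (F p n) in
/-- A linear choice of potentials without `x^(τ)`-term for the elements of `H(2r; n)^(2)`. -/
noncomputable def pot : H2 F p n →ₗ[F] DivPow F p n :=
  strip F p n ∘ₗ
    ((ham F p n).exists_rightInverse_of_surjective (LinearMap.range_eq_top.2 ham_surjective)).choose

theorem coeff_tau_pot (u : H2 F p n) : coeff F p n (tau p n) (pot F p n u) = 0 := by
  rw [pot, LinearMap.comp_apply, coeff_strip, if_pos rfl]

theorem ham_strip (f : DivPow F p n) : ham F p n (strip F p n f) = ham F p n f := by
  apply Subtype.ext
  rw [coe_ham, coe_ham, strip_eq_self]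
  rw [coeff_strip, if_pos rfl]

theorem ham_pot (u : H2 F p n) : ham F p n (pot F p n u) = u := by
  rw [pot, LinearMap.comp_apply, ham_strip]
  exact LinearMap.congr_fun ((ham F p n).exists_rightInverse_of_surjective
    (LinearMap.range_eq_top.2 ham_surjective)).choose_spec u

variable (F p n) in
/-- The coefficient of `x^(c)` in the potential of an element of `H(2r; n)^(2)`; it does not
depend on the choice of the potential when `c ≠ 0`. -/
noncomputable def hcoeff (c : Fin r ⊕ Fin r → ℕ) : H2 F p n →ₗ[F] F :=
  coeff F p n c ∘ₗ pot F p n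

theorem ham_eq_zero_iff (hn : ∀ i, 1 ≤ n i) {f : DivPow F p n} :
    ham F p n f = 0 ↔ ∀ c, c ≠ 0 → c ≠ tau p n → coeff F p n c f = 0 := by
  rw [← Subtype.coe_injective.eq_iff, coe_ham]
  change DH F p n (strip F p n f) = 0 ↔ _
  rw [DH_eq_zero_iff hn]
  refine forall_congr' fun c => forall_congr' fun _ => ?_
  rw [coeff_strip]
  split_ifs with h <;> simp [h]

theorem hcoeff_ham (hn : ∀ i, 1 ≤ n i) {c : Fin r ⊕ Fin r → ℕ} (hc : c ≠ 0)
    {f : DivPow F p n} (hf : coeff F p n (tau p n) f = 0) :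
    hcoeff F p n c (ham F p n f) = coeff F p n c f := by
  by_cases h : c = tau p n
  · rw [h, hf]
    exact coeff_tau_pot _
  · have h1 : ham F p n (pot F p n (ham F p n f) - f) = 0 := by
      rw [map_sub, ham_pot, sub_self]
    have := (ham_eq_zero_iff hn).1 h1 c hc h
    rw [map_sub, sub_eq_zero] at this
    exact this

theorem eq_zero_of_hcoeff (hn : ∀ i, 1 ≤ n i) {u : H2 F p n}
    (h : ∀ c, c ≠ 0 → hcoeff F p n c u = 0) : u = 0 := by
  rw [← ham_pot u, ham_eq_zero_iff hn]
  exact fun c hc _ => h c hc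

theorem hcoeff_lie_ham (hn : ∀ i, 1 ≤ n i) {c : Fin r ⊕ Fin r → ℕ} (hc : c ≠ 0)
    {f : DivPow F p n} (hf : coeff F p n (tau p n) f = 0) (u : H2 F p n) :
    hcoeff F p n c ⁅ham F p n f, u⁆ = coeff F p n c (DH F p n f (pot F p n u)) := by
  conv_lhs => rw [← ham_pot u]
  rw [lie_ham hf (coeff_tau_pot u), hcoeff_ham hn hc (coeff_tau_DH _ _)]

end Poisson

end Hamiltonian

/-! ### Frobenius powers of derivations -/

section Frobenius

variable {F A : Type*} [CommRing F] [CommRing A] [Algebra F A]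

open Finset in
theorem Derivation.iterate_mul (D : Derivation F A A) (k : ℕ) (a b : A) :
    D^[k] (a * b) = ∑ ij ∈ antidiagonal k, k.choose ij.1 • (D^[ij.1] a * D^[ij.2] b) := by
  induction k with
  | zero => simp
  | succ k ih =>
    rw [sum_antidiagonal_choose_succ_nsmul (M := A) (fun i j => D^[i] a * D^[j] b) k]
    simp only [Function.iterate_succ_apply', ih, map_sum, map_nsmul, Derivation.leibniz,
      smul_eq_mul, smul_add, sum_add_distrib]
    congr 1
    refine sum_congr rfl fun ⟨i, j⟩ hij => ?_
    rw [k.choose_symm_of_eq_add (mem_antidiagonal.1 hij).symm, mul_comm]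

/-- In characteristic `p` the `p ^ k`-th iterate of a derivation is a derivation. -/
def Derivation.frob (p : ℕ) [Fact p.Prime] [CharP A p] (D : Derivation F A A) (k : ℕ) :
    Derivation F A A :=
  Derivation.mk' ((D : A →ₗ[F] A) ^ p ^ k) <| by
    intro a b
    simp only [Module.End.pow_apply]
    have h0 : 0 < p ^ k := pow_pos (Fact.out : p.Prime).pos k
    change D^[p ^ k] (a * b) = a • D^[p ^ k] b + b • D^[p ^ k] a
    have hsub : ({(0, p ^ k), (p ^ k, 0)} : Finset (ℕ × ℕ)) ⊆
        Finset.HasAntidiagonal.antidiagonal (p ^ k) := by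
      intro x hx
      simp only [Finset.mem_insert, Finset.mem_singleton] at hx
      rcases hx with rfl | rfl <;> simp
    rw [D.iterate_mul, ← Finset.sum_subset hsub, Finset.sum_pair]
    · simp [mul_comm b]
    · simp [h0.ne]
    · rintro ⟨i, j⟩ hij hij'
      simp only [Finset.HasAntidiagonal.mem_antidiagonal, Finset.mem_insert,
        Finset.mem_singleton, Prod.mk.injEq, not_or, not_and] at hij hij'
      obtain ⟨h2, h3⟩ := hij'
      have hd : p ∣ (p ^ k).choose i := by
        refine (Fact.out : p.Prime).dvd_choose_pow ?_ ?_
        · rintro rfl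
          exact h2 rfl (by omega)
        · rintro rfl
          exact h3 rfl (by omega)
      rw [nsmul_eq_mul, (CharP.cast_eq_zero_iff A p _).2 hd, zero_mul]

theorem Derivation.frob_apply (p : ℕ) [Fact p.Prime] [CharP A p] (D : Derivation F A A) (k : ℕ)
    (a : A) : D.frob p k a = D^[p ^ k] a := Module.End.pow_apply _ _ _

end Frobenius

/-! ### The action of a normalizer -/

section NormalizerAd

variable {F L : Type*} [CommRing F] [LieRing L] [LieAlgebra F L]

/-- The normalizer of a Lie subalgebra acts on it by derivations. -/
def LieSubalgebra.normalizerAd (H : LieSubalgebra F L) :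
    H.normalizer →ₗ⁅F⁆ LieDerivation F H H where
  toFun δ :=
    { toFun := fun u => ⟨⁅(δ : L), (u : L)⁆, LieSubalgebra.ideal_in_normalizer δ.2 u.2⟩
      map_add' := fun u v => Subtype.ext (lie_add _ _ _)
      map_smul' := fun t u => Subtype.ext (lie_smul _ _ _)
      leibniz' := fun u v => Subtype.ext <| by
        change ⁅(δ : L), ⁅(u : L), (v : L)⁆⁆ = ⁅(u : L), ⁅(δ : L), (v : L)⁆⁆ -
          ⁅(v : L), ⁅(δ : L), (u : L)⁆⁆
        rw [leibniz_lie, ← lie_skew (v : L)]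
        abel }
  map_add' δ ε := by
    ext u : 1
    exact Subtype.ext (add_lie _ _ _)
  map_smul' t δ := by
    ext u : 1
    exact Subtype.ext (smul_lie _ _ _)
  map_lie' {δ ε} := by
    ext u : 1
    rw [LieDerivation.lie_apply]
    exact Subtype.ext (lie_lie _ _ _)

theorem LieSubalgebra.normalizerAd_eq_ad (H : LieSubalgebra F L) {δ : H.normalizer}
    (h : (δ : L) ∈ H) : H.normalizerAd δ = LieDerivation.ad F H ⟨δ, h⟩ := by
  ext u : 1
  apply Subtype.ext
  simp [LieSubalgebra.normalizerAd]

end NormalizerAd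

/-! ### The outer derivations -/

namespace Hamiltonian

open DivPow

section Outer

variable {F : Type*} [Field F] {p : ℕ} [Fact p.Prime] [CharP F p] {r : ℕ}
  {n : Fin r ⊕ Fin r → ℕ}

instance : CharP (DivPow F p n) p :=
  haveI : Nontrivial (DivPow F p n) := ⟨1, 0, fun h => by
    have := congrArg (coeff F p n 0) h
    rw [show (1 : DivPow F p n) = mon F p n 0 from rfl, map_zero, coeff_mon_self] at this
    · exact one_ne_zero this
    · exact fun i => pow_pos (Fact.out : p.Prime).pos _⟩
  charP_of_injective_algebraMap (FaithfulSMul.algebraMap_injective F (DivPow F p n)) p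

theorem lie_DH (δ : Derivation F (DivPow F p n) (DivPow F p n)) (f : DivPow F p n) :
    ⁅δ, DH F p n f⁆ = DH F p n (δ f) + ∑ j, (sgn j : F) • (⁅δ, pderiv F p n j⁆ f •
      pderiv F p n j.swap + pderiv F p n j f • ⁅δ, pderiv F p n j.swap⁆) := by
  ext g : 1
  rw [Derivation.commutator_apply, DH_apply, DH_apply, Derivation.add_apply, DH_apply, map_sum,
    ← Derivation.coeFnAddMonoidHom_apply (∑ j, _), map_sum, Finset.sum_apply,
    ← Finset.sum_add_distrib, ← Finset.sum_sub_distrib]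
  refine Finset.sum_congr rfl fun j _ => ?_
  simp only [Derivation.coeFnAddMonoidHom_apply, Derivation.smul_apply, Derivation.add_apply,
    Derivation.commutator_apply, map_zsmul, Derivation.leibniz, smul_eq_mul]
  rw [Int.cast_smul_eq_zsmul, ← smul_sub, ← smul_add]
  congr 1
  ring

theorem mem_normalizer_of_lie_DH {δ : Derivation F (DivPow F p n) (DivPow F p n)} {t : F}
    (h : ∀ f, ⁅δ, DH F p n f⁆ = DH F p n (δ f + t • f))
    (h' : ∀ f, coeff F p n (tau p n) f = 0 → coeff F p n (tau p n) (δ f) = 0) :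
    δ ∈ (H2 F p n).normalizer := by
  rw [LieSubalgebra.mem_normalizer_iff]
  intro D hD
  obtain ⟨f, hf⟩ := ham_surjective (⟨D, hD⟩ : H2 F p n)
  have hD' : D = DH F p n (strip F p n f) := (congrArg Subtype.val hf).symm
  have h0 : coeff F p n (tau p n) (strip F p n f) = 0 := by rw [coeff_strip, if_pos rfl]
  rw [hD', h]
  apply DH_mem_H2
  rw [map_add, map_smul, h' _ h0, h0, smul_zero, add_zero]

theorem lie_pderiv (i j : Fin r ⊕ Fin r) : ⁅pderiv F p n i, pderiv F p n j⁆ = 0 := by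
  ext f : 1
  rw [Derivation.commutator_apply, pderiv_comm, sub_self]
  rfl

theorem lie_smul_derivation (D E : Derivation F (DivPow F p n) (DivPow F p n))
    (f : DivPow F p n) : ⁅D, f • E⁆ = D f • E + f • ⁅D, E⁆ := by
  ext g : 1
  simp only [Derivation.commutator_apply, Derivation.smul_apply, Derivation.add_apply,
    Derivation.leibniz, smul_eq_mul]
  ring

theorem smul_lie_derivation (D E : Derivation F (DivPow F p n) (DivPow F p n))
    (f : DivPow F p n) : ⁅f • D, E⁆ = f • ⁅D, E⁆ - E f • D := by
  ext g : 1
  simp only [Derivation.commutator_apply, Derivation.smul_apply, Derivation.sub_apply,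
    Derivation.leibniz, smul_eq_mul]
  ring

variable (F p n) in
/-- The Euler derivation `∑ i, x_i ∂_i`. -/
def euler : Derivation F (DivPow F p n) (DivPow F p n) :=
  ∑ i, mon F p n (Pi.single i 1) • pderiv F p n i

theorem coeff_euler (a : Fin r ⊕ Fin r → ℕ) (f : DivPow F p n) :
    coeff F p n a (euler F p n f) = ((∑ i, a i : ℕ) : F) * coeff F p n a f := by
  rw [euler, ← Derivation.coeFnAddMonoidHom_apply, map_sum, Finset.sum_apply, map_sum,
    Nat.cast_sum, Finset.sum_mul]
  exact Finset.sum_congr rfl fun i _ => coeff_mul_pderiv i a f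

theorem euler_mon (a : Fin r ⊕ Fin r → ℕ) :
    euler F p n (mon F p n a) = ((∑ i, a i : ℕ) : F) • mon F p n a := by
  refine ext_coeff fun c hc => ?_
  rw [coeff_euler, map_smul, smul_eq_mul]
  by_cases h : c = a
  · rw [h]
  · rw [coeff_mon_of_ne h, mul_zero, mul_zero]

theorem lie_euler_pderiv (j : Fin r ⊕ Fin r) : ⁅euler F p n, pderiv F p n j⁆ = -pderiv F p n j := by
  ext f : 1
  refine ext_coeff fun c hc => ?_
  rw [Derivation.commutator_apply, map_sub, coeff_euler, coeff_pderiv, coeff_pderiv, coeff_euler,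
    Derivation.neg_apply, map_neg, coeff_pderiv]
  simp only [Pi.add_apply, Finset.sum_add_distrib, Finset.sum_pi_single', Finset.mem_univ, if_true]
  push_cast
  ring

theorem lie_euler_DH (f : DivPow F p n) :
    ⁅euler F p n, DH F p n f⁆ = DH F p n (euler F p n f + (-2 : F) • f) := by
  rw [lie_DH, map_add]
  congr 1
  ext g : 1
  rw [← Derivation.coeFnAddMonoidHom_apply, map_sum, Finset.sum_apply, map_smul,
    Derivation.smul_apply, DH_apply, Finset.smul_sum]
  refine Finset.sum_congr rfl fun j _ => ?_
  simp only [lie_euler_pderiv, Derivation.coeFnAddMonoidHom_apply, Derivation.smul_apply,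
    Derivation.add_apply, Derivation.neg_apply, smul_eq_mul]
  rw [Int.cast_smul_eq_zsmul, smul_comm]
  congr 1
  rw [neg_smul, ofNat_smul_eq_nsmul]
  ring

theorem euler_mem : euler F p n ∈ (H2 F p n).normalizer :=
  mem_normalizer_of_lie_DH lie_euler_DH fun f hf => by rw [coeff_euler, hf, mul_zero]

theorem DH_mem_normalizer (h : DivPow F p n) : DH F p n h ∈ (H2 F p n).normalizer :=
  mem_normalizer_of_lie_DH (t := 0) (fun f => by rw [DH_lie, zero_smul, add_zero])
    fun f _ => coeff_tau_DH _ _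

variable (F p n) in
/-- The derivation `x_i^(τ_i) ∂_{i'}`, up to sign the Hamiltonian derivation of the missing
potential `x_i^(p ^ n_i)`. -/
def sing (i : Fin r ⊕ Fin r) : Derivation F (DivPow F p n) (DivPow F p n) :=
  mon F p n (Pi.single i (tau p n i)) • pderiv F p n i.swap

theorem sing_apply (i : Fin r ⊕ Fin r) (f : DivPow F p n) :
    sing F p n i f = mon F p n (Pi.single i (tau p n i)) * pderiv F p n i.swap f := rfl

theorem lie_sing_DH (i : Fin r ⊕ Fin r) (f : DivPow F p n) :
    ⁅sing F p n i, DH F p n f⁆ = DH F p n (sing F p n i f + (0 : F) • f) := by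
  rw [lie_DH, zero_smul, add_zero, add_eq_left]
  have h : ∀ j, ⁅sing F p n i, pderiv F p n j⁆ =
      -(pderiv F p n j (mon F p n (Pi.single i (tau p n i))) • pderiv F p n i.swap) := by
    intro j
    rw [sing, smul_lie_derivation, lie_pderiv, smul_zero, zero_sub]
  have h0 : ∀ j, j ≠ i → pderiv F p n j (mon F p n (Pi.single i (tau p n i))) = 0 := fun j hj =>
    pderiv_mon_eq_zero j (by rw [Pi.single_eq_of_ne hj])
  simp only [h]
  rw [← Finset.add_sum_erase _ _ (Finset.mem_univ i),
    ← Finset.add_sum_erase _ _ (Finset.mem_erase.2 ⟨swap_ne i, Finset.mem_univ _⟩),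
    Finset.sum_eq_zero, add_zero]
  · rw [Sum.swap_swap, h0 _ (swap_ne i), sgn_swap_cast]
    ext g : 1
    simp only [Derivation.smul_apply, Derivation.add_apply, Derivation.neg_apply, smul_eq_mul,
      Derivation.zero_apply, zero_smul, neg_zero, smul_zero, add_zero, smul_neg, neg_smul]
    rw [← smul_neg, ← smul_neg, ← smul_add]
    convert smul_zero (sgn i : F)
    ring
  · intro j hj
    have hj1 : j ≠ i.swap := (Finset.mem_erase.1 hj).1
    have hj2 : j ≠ i := (Finset.mem_erase.1 (Finset.mem_erase.1 hj).2).1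
    have hj3 : j.swap ≠ i := fun h' => hj1 (by rw [← h', Sum.swap_swap])
    rw [h0 j hj2, h0 _ hj3]
    simp

theorem coeff_tau_sing (i : Fin r ⊕ Fin r) (f : DivPow F p n) :
    coeff F p n (tau p n) (sing F p n i f) = 0 := by
  rw [sing_apply]
  have e : tau p n = (tau p n - Pi.single i (tau p n i)) + Pi.single i (tau p n i) := by
    funext j
    by_cases hj : j = i
    · subst hj
      simp
    · simp [hj]
  rw [congrArg (coeff F p n) e, coeff_mon_single_mul, coeff_pderiv, coeff_eq_zero (i := i.swap)]
  · simp
  · simp only [Pi.add_apply, Pi.sub_apply, Pi.single_eq_same, Pi.single_eq_of_ne (swap_ne i), tau]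
    omega

theorem sing_mem (i : Fin r ⊕ Fin r) : sing F p n i ∈ (H2 F p n).normalizer :=
  mem_normalizer_of_lie_DH (lie_sing_DH i) fun f _ => coeff_tau_sing i f

theorem lie_frob_pderiv (i : Fin r ⊕ Fin r) (k : ℕ) (j : Fin r ⊕ Fin r) :
    ⁅(pderiv F p n i).frob p k, pderiv F p n j⁆ = 0 := by
  ext f : 1
  refine ext_coeff fun c _ => ?_
  rw [Derivation.commutator_apply, Derivation.frob_apply, Derivation.frob_apply, map_sub,
    coeff_iterate_pderiv, coeff_pderiv, coeff_pderiv, coeff_iterate_pderiv, add_right_comm, sub_self]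
  exact (map_zero _).symm

theorem lie_frob_DH (i : Fin r ⊕ Fin r) (k : ℕ) (f : DivPow F p n) :
    ⁅(pderiv F p n i).frob p k, DH F p n f⁆ =
      DH F p n ((pderiv F p n i).frob p k f + (0 : F) • f) := by
  rw [lie_DH, zero_smul, add_zero, add_eq_left]
  exact Finset.sum_eq_zero fun j _ => by simp [lie_frob_pderiv]

theorem coeff_tau_frob (i : Fin r ⊕ Fin r) (k : ℕ) (f : DivPow F p n) :
    coeff F p n (tau p n) ((pderiv F p n i).frob p k f) = 0 := by
  rw [Derivation.frob_apply, coeff_iterate_pderiv, coeff_eq_zero (i := i)]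
  have : 0 < p ^ k := pow_pos (Fact.out : p.Prime).pos k
  simp only [Pi.add_apply, tau, Pi.single_eq_same]
  omega

theorem frob_mem (i : Fin r ⊕ Fin r) (k : ℕ) :
    (pderiv F p n i).frob p k ∈ (H2 F p n).normalizer :=
  mem_normalizer_of_lie_DH (lie_frob_DH i k) fun f _ => coeff_tau_frob i k f

variable (F p n) in
/-- The action by commutators of the normalizer of `H(2r; n)^(2)` in the derivations of
`O(2r; n)`. -/
def act : (H2 F p n).normalizer →ₗ⁅F⁆ LieDerivation F (H2 F p n) (H2 F p n) :=
  (H2 F p n).normalizerAd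

theorem coe_act (δ : (H2 F p n).normalizer) (u : H2 F p n) :
    (act F p n δ u : Derivation F (DivPow F p n) (DivPow F p n)) =
      ⁅(δ : Derivation F (DivPow F p n) (DivPow F p n)), (u : Derivation F _ _)⁆ := rfl

theorem act_ham_of_lie_DH {δ : (H2 F p n).normalizer} {t : F}
    (h : ∀ f, ⁅(δ : Derivation F (DivPow F p n) (DivPow F p n)), DH F p n f⁆ =
      DH F p n ((δ : Derivation F (DivPow F p n) (DivPow F p n)) f + t • f)) {f : DivPow F p n}
    (hf : coeff F p n (tau p n) f = 0)
    (hf' : coeff F p n (tau p n) ((δ : Derivation F (DivPow F p n) (DivPow F p n)) f) = 0) :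
    act F p n δ (ham F p n f) =
      ham F p n ((δ : Derivation F (DivPow F p n) (DivPow F p n)) f + t • f) := by
  apply Subtype.ext
  rw [coe_act, coe_ham_of_coeff hf, h, coe_ham_of_coeff]
  rw [map_add, map_smul, hf, hf', smul_zero, add_zero]

end Outer

end Hamiltonian

/-! ### Brackets of monomials -/

namespace Hamiltonian

open DivPow

section Brackets

variable {F : Type*} [Field F] [CharP F 3] {r : ℕ} {n : Fin r ⊕ Fin r → ℕ}

variable (F n) in
/-- The element `D_H(x^(a))` of `H(2r; n)^(2)` in characteristic `3`; it is zero for `a = 0`, for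
`a = τ` and for `a` out of range. -/
def hmon (a : Fin r ⊕ Fin r → ℕ) : H2 F 3 n := ham F 3 n (mon F 3 n a)

theorem three_eq_zero : (3 : F) = 0 := by exact_mod_cast CharP.cast_eq_zero F 3

theorem natCast_eq_iff {a b : ℕ} : (a : F) = b ↔ a % 3 = b % 3 := CharP.natCast_eq_natCast F 3

theorem three_le_pow {i : Fin r ⊕ Fin r} (h : 1 ≤ n i) : 3 ≤ 3 ^ n i :=
  Nat.le_self_pow (by omega) 3

theorem sum_single (i : Fin r ⊕ Fin r) (k : ℕ) :
    ∑ j, (Pi.single i k : Fin r ⊕ Fin r → ℕ) j = k := by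
  simp

theorem sum_add (a b : Fin r ⊕ Fin r → ℕ) : ∑ j, (a + b) j = ∑ j, a j + ∑ j, b j :=
  Finset.sum_add_distrib

theorem add_le_sum (a : Fin r ⊕ Fin r → ℕ) {i j : Fin r ⊕ Fin r} (h : i ≠ j) :
    a i + a j ≤ ∑ k, a k := by
  rw [← Finset.sum_pair h]
  exact Finset.sum_le_sum_of_subset (Finset.subset_univ _)

theorem ne_zero_of_sum {a : Fin r ⊕ Fin r → ℕ} (h : ∑ i, a i ≠ 0) : a ≠ 0 := by
  rintro rfl
  simp at h

theorem single_ne_zero (i : Fin r ⊕ Fin r) : (Pi.single i 1 : Fin r ⊕ Fin r → ℕ) ≠ 0 := by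
  simp

theorem exists_eq_add_single {c : Fin r ⊕ Fin r → ℕ} {j : Fin r ⊕ Fin r} (h : c j ≠ 0) :
    ∃ d : Fin r ⊕ Fin r → ℕ, c = d + Pi.single j 1 := by
  refine ⟨c - Pi.single j 1, ?_⟩
  funext i
  by_cases hi : i = j
  · subst hi
    simp only [Pi.add_apply, Pi.sub_apply, Pi.single_eq_same]
    omega
  · simp [hi]

theorem ne_tau_of_sum_le (hr : 0 < r) (hn : ∀ i, 1 ≤ n i) {a : Fin r ⊕ Fin r → ℕ}
    (h : ∑ i, a i ≤ 3) : a ≠ tau 3 n := by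
  rintro rfl
  have h1 := add_le_sum (tau 3 n) (swap_ne (Sum.inl ⟨0, hr⟩ : Fin r ⊕ Fin r))
  have h2 := three_le_pow (hn (Sum.inl ⟨0, hr⟩ : Fin r ⊕ Fin r))
  have h3 := three_le_pow (hn (Sum.inl ⟨0, hr⟩ : Fin r ⊕ Fin r).swap)
  simp only [tau] at h1 h
  omega

theorem coeff_tau_mon {a : Fin r ⊕ Fin r → ℕ} (h : a ≠ tau 3 n) :
    coeff F 3 n (tau 3 n) (mon F 3 n a) = 0 := coeff_mon_of_ne h.symm

theorem lie_hmon {a b : Fin r ⊕ Fin r → ℕ} (ha : a ≠ tau 3 n) (hb : b ≠ tau 3 n) :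
    ⁅hmon F n a, hmon F n b⁆ = ham F 3 n (DH F 3 n (mon F 3 n a) (mon F 3 n b)) :=
  lie_ham (coeff_tau_mon ha) (coeff_tau_mon hb)

theorem mul_pderiv_mon (i : Fin r ⊕ Fin r) (a : Fin r ⊕ Fin r → ℕ) :
    mon F 3 n (Pi.single i 1) * pderiv F 3 n i (mon F 3 n a) = (a i : F) • mon F 3 n a := by
  refine ext_coeff fun c _ => ?_
  rw [coeff_mul_pderiv, map_smul, smul_eq_mul]
  by_cases h : c = a
  · rw [h]
  · rw [coeff_mon_of_ne h, mul_zero, mul_zero]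

theorem mon_add_single (a : Fin r ⊕ Fin r → ℕ) {j : Fin r ⊕ Fin r} (k : ℕ) (h : a j = 0) :
    mon F 3 n (a + Pi.single j k) = mon F 3 n (Pi.single j k) * mon F 3 n a := by
  rw [mon_single_mul_mon, h, add_zero, Nat.choose_self, Nat.cast_one, one_smul]

/-- The action of the torus element `x_k x_{k'}`. -/
theorem coeff_DH_torus (hn : ∀ i, 1 ≤ n i) (k : Fin r ⊕ Fin r) (c : Fin r ⊕ Fin r → ℕ)
    (f : DivPow F 3 n) :
    coeff F 3 n c (DH F 3 n (mon F 3 n (Pi.single k 1 + Pi.single k.swap 1)) f) =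
      sgn k * ((c k.swap : F) - c k) * coeff F 3 n c f := by
  rw [mon_add_single _ _ (Pi.single_eq_of_ne (swap_ne k) _), DH_mul_apply, DH_var_apply (hn _),
    DH_var_apply (hn _), Sum.swap_swap, map_add, mul_smul_comm, mul_smul_comm, map_smul, map_smul,
    coeff_mul_pderiv, coeff_mul_pderiv, sgn_swap_cast, smul_eq_mul, smul_eq_mul]
  ring

theorem DH_torus_mon (hn : ∀ i, 1 ≤ n i) (k : Fin r ⊕ Fin r) (a : Fin r ⊕ Fin r → ℕ) :
    DH F 3 n (mon F 3 n (Pi.single k 1 + Pi.single k.swap 1)) (mon F 3 n a) =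
      (sgn k * ((a k.swap : F) - a k)) • mon F 3 n a := by
  refine ext_coeff fun c _ => ?_
  rw [coeff_DH_torus hn, map_smul, smul_eq_mul]
  by_cases h : c = a
  · rw [h]
  · rw [coeff_mon_of_ne h, mul_zero, mul_zero]

theorem DH_mon_single_mon {j : Fin r ⊕ Fin r} {k : ℕ} (hk : k + 1 < 3 ^ n j)
    {a : Fin r ⊕ Fin r → ℕ} (hka : k ≤ a j) (ha : a j.swap + 1 < 3 ^ n j.swap) :
    DH F 3 n (mon F 3 n (Pi.single j (k + 1)))
      (mon F 3 n (a - Pi.single j k + Pi.single j.swap 1)) =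
      (sgn j * ((a j).choose k : F)) • mon F 3 n a := by
  have e : (a - Pi.single j k + Pi.single j k : Fin r ⊕ Fin r → ℕ) = a := by
    funext i
    by_cases hi : i = j
    · subst hi
      simp [Nat.sub_add_cancel hka]
    · simp [hi]
  rw [DH_mon_single_apply j hk, pderiv_mon_add, mon_single_mul_mon, e, smul_smul]
  · simp only [Pi.sub_apply, Pi.single_eq_same]
    rw [Nat.add_sub_cancel' hka]
  · simpa [swap_ne] using ha

/-- The bracket with `x_j^(2) x_{j'}`, written for a prescribed result. -/
theorem DH_cubic_mon (hn : ∀ i, 1 ≤ n i) {j : Fin r ⊕ Fin r} {a : Fin r ⊕ Fin r → ℕ}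
    (ha : ∀ i, a i < 3 ^ n i) (hj : 1 ≤ a j) :
    DH F 3 n (mon F 3 n (Pi.single j.swap 1 + Pi.single j 2)) (mon F 3 n (a - Pi.single j 1)) =
      (sgn j * ((a j : F) * (a j + a j.swap - 1))) • mon F 3 n a := by
  have e : ∀ k ≤ a j, (a - Pi.single j k + Pi.single j k : Fin r ⊕ Fin r → ℕ) = a := by
    intro k hk
    funext i
    by_cases hi : i = j
    · subst hi
      simp [Nat.sub_add_cancel hk]
    · simp [hi]
  have e1 : mon F 3 n (Pi.single j 2) * pderiv F 3 n j (mon F 3 n (a - Pi.single j 1)) =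
      ((a j).choose 2 : F) • mon F 3 n a := by
    rcases hj.eq_or_lt with h | h
    · rw [pderiv_mon_eq_zero j (by simp [← h]), ← h, mul_zero]
      simp
    · have e2 : (a - Pi.single j 1 : Fin r ⊕ Fin r → ℕ) = (a - Pi.single j 2) + Pi.single j 1 := by
        funext i
        by_cases hi : i = j
        · subst hi
          simp only [Pi.sub_apply, Pi.add_apply, Pi.single_eq_same]
          omega
        · simp [hi]
      rw [e2, pderiv_mon_add, mon_single_mul_mon, e 2 h]
      · simp only [Pi.sub_apply, Pi.single_eq_same]
        rw [Nat.add_sub_cancel' h]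
      · have := ha j
        simp only [Pi.sub_apply, Pi.single_eq_same]
        omega
  have h2 : DH F 3 n (mon F 3 n (Pi.single j 2)) (mon F 3 n (a - Pi.single j 1)) =
      (sgn j : F) • (mon F 3 n (Pi.single j 1) *
        pderiv F 3 n j.swap (mon F 3 n (a - Pi.single j 1))) :=
    DH_mon_single_apply j (k := 1) (by have := three_le_pow (hn j); omega) _
  rw [mon_add_single _ _ (Pi.single_eq_of_ne (swap_ne j).symm _), DH_mul_apply, h2,
    DH_var_apply (hn _), Sum.swap_swap, mul_smul_comm, e1, mul_smul_comm, mul_left_comm,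
    mul_pderiv_mon, mul_smul_comm, mon_single_mul_mon, e 1 hj, sgn_swap_cast, smul_smul, smul_smul,
    smul_smul, ← add_smul]
  congr 1
  obtain ⟨x, hx⟩ : ∃ x, a j = x + 1 := ⟨a j - 1, by omega⟩
  have h3 : ((x + 1).choose 2 : F) * 2 = (x + 1) * x := by
    have h4 : (x + 1).choose 2 * 2 = (x + 1) * x := by
      rw [Nat.choose_two_right, Nat.add_sub_cancel, Nat.div_mul_cancel]
      exact (Nat.even_mul_pred_self (x + 1)).two_dvd
    exact_mod_cast congrArg (Nat.cast (R := F)) h4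
  simp only [Pi.sub_apply, Pi.single_eq_same, Pi.single_eq_of_ne (swap_ne j), hx,
    Nat.add_sub_cancel, Nat.sub_zero, Nat.choose_one_right]
  push_cast
  linear_combination (sgn j : F) * h3 - (sgn j : F) * ((x + 1).choose 2 : F) * three_eq_zero (F := F)

/-- The bracket with `x_i x_j`, where `i` and `j` belong to different pairs. -/
theorem DH_mul_mon (hn : ∀ i, 1 ≤ n i) {i j : Fin r ⊕ Fin r} (h1 : i ≠ j) (h2 : i ≠ j.swap)
    {d : Fin r ⊕ Fin r → ℕ} (hi : d i.swap + 1 < 3 ^ n i.swap)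
    (hj : d j.swap + 1 < 3 ^ n j.swap) :
    DH F 3 n (mon F 3 n (Pi.single i 1 + Pi.single j 1))
        (mon F 3 n (d + Pi.single i.swap 1 + Pi.single j.swap 1)) =
      (sgn j * (d i + 1 : F)) • mon F 3 n (d + Pi.single i.swap 1 + Pi.single i 1) +
        (sgn i * (d j + 1 : F)) • mon F 3 n (d + Pi.single j.swap 1 + Pi.single j 1) := by
  have h3 : i.swap ≠ j.swap := fun h => h1 (Sum.swap_leftInverse.injective h)
  have h4 : j ≠ i.swap := fun h => h2 (by rw [h, Sum.swap_swap])
  rw [mon_add_single _ _ (Pi.single_eq_of_ne h1.symm _), DH_mul_apply, DH_var_apply (hn _),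
    DH_var_apply (hn _), pderiv_mon_add _ (by simpa [h3.symm] using hj), add_right_comm,
    pderiv_mon_add _ (by simpa [h3] using hi), mul_smul_comm, mul_smul_comm, mon_single_mul_mon,
    mon_single_mul_mon, smul_smul, smul_smul, add_comm]
  simp only [Nat.choose_one_right, Pi.add_apply, Pi.single_eq_of_ne (swap_ne i).symm,
    Pi.single_eq_of_ne (swap_ne j).symm, add_zero]
  push_cast
  rw [add_comm (1 : F), add_comm (1 : F)]

theorem coeff_var_mul (hn : ∀ i, 1 ≤ n i) (i : Fin r ⊕ Fin r) (f : DivPow F 3 n) :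
    coeff F 3 n (Pi.single i 1) (mon F 3 n (Pi.single i 1) * f) = coeff F 3 n 0 f := by
  have h := coeff_mon_single_mul (F := F) (p := 3) (n := n) i 1 0 f
  rw [zero_add, if_pos (by simpa using one_lt_pow_of_pos (hn i))] at h
  simpa using h

theorem hcoeff_hmon (hn : ∀ i, 1 ≤ n i) {a c : Fin r ⊕ Fin r → ℕ} (hc : c ≠ 0)
    (ha : a ≠ tau 3 n) : hcoeff F 3 n c (hmon F n a) = coeff F 3 n c (mon F 3 n a) :=
  hcoeff_ham hn hc (coeff_tau_mon ha)

theorem hcoeff_hmon_self (hn : ∀ i, 1 ≤ n i) {a : Fin r ⊕ Fin r → ℕ} (ha0 : a ≠ 0)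
    (ha : a ≠ tau 3 n) (h : ∀ i, a i < 3 ^ n i) : hcoeff F 3 n a (hmon F n a) = 1 := by
  rw [hcoeff_hmon hn ha0 ha, coeff_mon_self h]

theorem hcoeff_hmon_of_ne (hn : ∀ i, 1 ≤ n i) {a c : Fin r ⊕ Fin r → ℕ} (hc : c ≠ 0)
    (h : c ≠ a) : hcoeff F 3 n c (hmon F n a) = 0 := by
  by_cases ha : a = tau 3 n
  · rw [ha, hmon, ham_mon_tau, map_zero]
  · rw [hcoeff_hmon hn hc ha, coeff_mon_of_ne h]

theorem single_lt (hn : ∀ i, 1 ≤ n i) (j i : Fin r ⊕ Fin r) :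
    (Pi.single j 1 : Fin r ⊕ Fin r → ℕ) i < 3 ^ n i := by
  have := three_le_pow (hn i)
  by_cases h : i = j
  · subst h
    simp only [Pi.single_eq_same]
    omega
  · simp only [Pi.single_eq_of_ne h]
    omega

theorem single_ne_tau (hr : 0 < r) (hn : ∀ i, 1 ≤ n i) (j : Fin r ⊕ Fin r) :
    (Pi.single j 1 : Fin r ⊕ Fin r → ℕ) ≠ tau 3 n :=
  ne_tau_of_sum_le hr hn (by rw [sum_single]; omega)

/-- Bracketing with the variable `x_j` shifts coefficients. -/
theorem hcoeff_lie_var (hr : 0 < r) (hn : ∀ i, 1 ≤ n i) (j : Fin r ⊕ Fin r)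
    {c : Fin r ⊕ Fin r → ℕ} (hc : c ≠ 0) (u : H2 F 3 n) :
    hcoeff F 3 n c ⁅hmon F n (Pi.single j 1), u⁆ =
      sgn j * hcoeff F 3 n (c + Pi.single j.swap 1) u := by
  rw [hmon, hcoeff_lie_ham hn hc (coeff_tau_mon (single_ne_tau hr hn j)), coeff_DH_var (hn j)]
  rfl

theorem torus_ne_tau (hr : 0 < r) (hn : ∀ i, 1 ≤ n i) (i j : Fin r ⊕ Fin r) :
    (Pi.single i 1 + Pi.single j 1 : Fin r ⊕ Fin r → ℕ) ≠ tau 3 n :=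
  ne_tau_of_sum_le hr hn (by rw [sum_add, sum_single, sum_single]; omega)

theorem hcoeff_lie_torus (hr : 0 < r) (hn : ∀ i, 1 ≤ n i) (k : Fin r ⊕ Fin r)
    {c : Fin r ⊕ Fin r → ℕ} (hc : c ≠ 0) (u : H2 F 3 n) :
    hcoeff F 3 n c ⁅hmon F n (Pi.single k 1 + Pi.single k.swap 1), u⁆ =
      sgn k * ((c k.swap : F) - c k) * hcoeff F 3 n c u := by
  rw [hmon, hcoeff_lie_ham hn hc (coeff_tau_mon (torus_ne_tau hr hn _ _)), coeff_DH_torus hn]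
  rfl

theorem lie_torus_hmon (hr : 0 < r) (hn : ∀ i, 1 ≤ n i) (k : Fin r ⊕ Fin r)
    (a : Fin r ⊕ Fin r → ℕ) :
    ⁅hmon F n (Pi.single k 1 + Pi.single k.swap 1), hmon F n a⁆ =
      (sgn k * ((a k.swap : F) - a k)) • hmon F n a := by
  by_cases ha : a = tau 3 n
  · rw [ha, hmon, hmon, ham_mon_tau, lie_zero, smul_zero]
  · rw [lie_hmon (torus_ne_tau hr hn _ _) ha, DH_torus_mon hn, map_smul]
    rfl

theorem lie_var_hmon (hr : 0 < r) (hn : ∀ i, 1 ≤ n i) (j : Fin r ⊕ Fin r)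
    {a : Fin r ⊕ Fin r → ℕ} (ha : a + Pi.single j.swap 1 ≠ tau 3 n)
    (h : a j.swap + 1 < 3 ^ n j.swap) :
    ⁅hmon F n (Pi.single j 1), hmon F n (a + Pi.single j.swap 1)⁆ = (sgn j : F) • hmon F n a := by
  rw [lie_hmon (single_ne_tau hr hn j) ha, DH_var_apply (hn j), pderiv_mon_add _ h, map_smul]
  rfl

theorem lie_var_hmon_eq_zero (hr : 0 < r) (hn : ∀ i, 1 ≤ n i) (j : Fin r ⊕ Fin r)
    {a : Fin r ⊕ Fin r → ℕ} (h : a j.swap = 0) :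
    ⁅hmon F n (Pi.single j 1), hmon F n a⁆ = 0 := by
  by_cases ha : a = tau 3 n
  · rw [ha, hmon, hmon, ham_mon_tau, lie_zero]
  · rw [lie_hmon (single_ne_tau hr hn j) ha, DH_var_apply (hn j), pderiv_mon_eq_zero _ h, smul_zero,
      map_zero]

end Brackets

end Hamiltonian

/-! ### Outer derivations as elements of the normalizer -/

namespace Hamiltonian

open DivPow

section Candidates

variable {F : Type*} [Field F] [CharP F 3] {r : ℕ} {n : Fin r ⊕ Fin r → ℕ}

variable (F n) in
/-- The Euler derivation as an element of the normalizer. -/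
def nEuler : (H2 F 3 n).normalizer := ⟨euler F 3 n, euler_mem⟩

variable (F n) in
/-- The Hamiltonian derivation with potential `h`, possibly involving `x^(τ)`, as an element of
the normalizer. -/
def nDH : DivPow F 3 n →ₗ[F] (H2 F 3 n).normalizer where
  toFun h := ⟨DH F 3 n h, DH_mem_normalizer h⟩
  map_add' f g := Subtype.ext (map_add _ f g)
  map_smul' t f := Subtype.ext (map_smul _ t f)

variable (F n) in
/-- The derivation `x_i^(τ_i) ∂_{i'}` as an element of the normalizer. -/
def nSing (i : Fin r ⊕ Fin r) : (H2 F 3 n).normalizer := ⟨sing F 3 n i, sing_mem i⟩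

variable (F n) in
/-- The derivation `∂_i ^ (3 ^ k)` as an element of the normalizer. -/
def nFrob (i : Fin r ⊕ Fin r) (k : ℕ) : (H2 F 3 n).normalizer :=
  ⟨(pderiv F 3 n i).frob 3 k, frob_mem i k⟩

/-- The parameters of the outer derivations: coefficients of the Euler derivation, of
`D_H(x^(τ))`, of the `x_i^(τ_i) ∂_{i'}` and of the `∂_i ^ (3 ^ k)`, `0 < k < n_i`. -/
abbrev Param (F : Type*) {r : ℕ} (n : Fin r ⊕ Fin r → ℕ) : Type _ :=
  F × F × (Fin r ⊕ Fin r → F) × ((Σ i, Fin (n i - 1)) → F)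

variable (F n) in
/-- The linear combination of the outer derivations with given parameters. -/
def outer : Param F n →ₗ[F] (H2 F 3 n).normalizer :=
  (LinearMap.toSpanSingleton F _ (nEuler F n)).coprod
    ((LinearMap.toSpanSingleton F _ (nDH F n (mon F 3 n (tau 3 n)))).coprod
      ((Fintype.linearCombination F (nSing F n)).coprod
        (Fintype.linearCombination F fun q : Σ i, Fin (n i - 1) => nFrob F n q.1 (q.2 + 1))))

theorem outer_apply (w : Param F n) : outer F n w =
    w.1 • nEuler F n + (w.2.1 • nDH F n (mon F 3 n (tau 3 n)) +
      (∑ i, w.2.2.1 i • nSing F n i +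
        ∑ q, w.2.2.2 q • nFrob F n q.1 (q.2 + 1))) := by
  simp [outer, Fintype.linearCombination_apply]

variable (F n) in
/-- The linear span of `H(2r; n)^(2)` and the outer derivations. -/
def known : Submodule F (H2 F 3 n).normalizer :=
  LinearMap.range (outer F n) ⊔
    (H2 F 3 n).toSubmodule.comap (H2 F 3 n).normalizer.toSubmodule.subtype

theorem nEuler_mem_known : nEuler F n ∈ known F n :=
  Submodule.mem_sup_left ⟨(1, 0, 0, 0), by simp [outer_apply]⟩

theorem nSing_mem_known (i : Fin r ⊕ Fin r) : nSing F n i ∈ known F n :=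
  Submodule.mem_sup_left ⟨(0, 0, Pi.single i 1, 0), by simp [outer_apply, Pi.single_apply]⟩

theorem nFrob_mem_known (q : Σ i, Fin (n i - 1)) : nFrob F n q.1 (q.2 + 1) ∈ known F n := by
  refine Submodule.mem_sup_left ⟨(0, 0, 0, Pi.single q 1), ?_⟩
  rw [outer_apply]
  simp only [zero_smul, zero_add, Pi.zero_apply, Finset.sum_const_zero]
  rw [Finset.sum_eq_single q]
  · simp
  · intro b _ hb
    rw [Pi.single_eq_of_ne hb, zero_smul]
  · simp

theorem nDH_mem_known (h : DivPow F 3 n) : nDH F n h ∈ known F n := by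
  have e : nDH F n h =
      coeff F 3 n (tau 3 n) h • nDH F n (mon F 3 n (tau 3 n)) + nDH F n (strip F 3 n h) := by
    rw [← map_smul, ← map_add]
    simp [strip]
  rw [e]
  refine Submodule.add_mem _ (Submodule.smul_mem _ _ ?_) (Submodule.mem_sup_right ?_)
  · exact Submodule.mem_sup_left ⟨(0, 1, 0, 0), by simp [outer_apply]⟩
  · exact DH_mem_H2 (by rw [coeff_strip, if_pos rfl])

theorem act_nEuler_hmon (a : Fin r ⊕ Fin r → ℕ) :
    act F 3 n (nEuler F n) (hmon F n a) = ((∑ i, a i : ℕ) - 2 : F) • hmon F n a := by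
  by_cases ha : a = tau 3 n
  · rw [ha, hmon, ham_mon_tau, map_zero, smul_zero]
  · have h : coeff F 3 n (tau 3 n) (mon F 3 n a) = 0 := coeff_tau_mon ha
    have := act_ham_of_lie_DH (δ := nEuler F n) lie_euler_DH h
      (by change coeff F 3 n (tau 3 n) (euler F 3 n _) = 0; rw [coeff_euler, h, mul_zero])
    refine this.trans ?_
    change ham F 3 n (euler F 3 n _ + _) = _
    rw [euler_mon, ← add_smul, map_smul, ← sub_eq_add_neg]
    rfl

theorem act_nDH_hmon (h : DivPow F 3 n) {a : Fin r ⊕ Fin r → ℕ} (ha : a ≠ tau 3 n) :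
    act F 3 n (nDH F n h) (hmon F n a) = ham F 3 n (DH F 3 n h (mon F 3 n a)) := by
  have := act_ham_of_lie_DH (δ := nDH F n h) (t := 0)
    (fun f => by rw [zero_smul, add_zero]; exact DH_lie h f) (coeff_tau_mon ha) (coeff_tau_DH _ _)
  refine this.trans ?_
  rw [zero_smul, add_zero]
  rfl

theorem act_nSing_hmon (i : Fin r ⊕ Fin r) {a : Fin r ⊕ Fin r → ℕ} (ha : a ≠ tau 3 n) :
    act F 3 n (nSing F n i) (hmon F n a) = ham F 3 n (sing F 3 n i (mon F 3 n a)) := by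
  have := act_ham_of_lie_DH (δ := nSing F n i) (lie_sing_DH i) (coeff_tau_mon ha)
    (coeff_tau_sing i _)
  refine this.trans ?_
  rw [zero_smul, add_zero]
  rfl

theorem hcoeff_act_nFrob (hn : ∀ i, 1 ≤ n i) (i : Fin r ⊕ Fin r) (k : ℕ)
    {a c : Fin r ⊕ Fin r → ℕ} (hc : c ≠ 0) (ha : a ≠ tau 3 n) :
    hcoeff F 3 n c (act F 3 n (nFrob F n i k) (hmon F n a)) =
      coeff F 3 n (c + Pi.single i (3 ^ k)) (mon F 3 n a) := by
  have := act_ham_of_lie_DH (δ := nFrob F n i k) (lie_frob_DH i k) (coeff_tau_mon ha)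
    (coeff_tau_frob i k _)
  refine (congrArg _ this).trans ?_
  rw [zero_smul, add_zero]
  change hcoeff F 3 n c (ham F 3 n ((pderiv F 3 n i).frob 3 k _)) = _
  rw [hcoeff_ham hn hc (coeff_tau_frob i k _), Derivation.frob_apply, coeff_iterate_pderiv]

theorem act_nSing_var (hr : 0 < r) (hn : ∀ i, 1 ≤ n i) (i j : Fin r ⊕ Fin r) :
    act F 3 n (nSing F n i) (hmon F n (Pi.single j.swap 1)) =
      if i = j then hmon F n (Pi.single j (tau 3 n j)) else 0 := by
  rw [act_nSing_hmon i (single_ne_tau hr hn _), sing_apply]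
  split_ifs with h
  · subst h
    rw [← zero_add (Pi.single i.swap 1), pderiv_mon_add _ (by simpa using one_lt_pow_of_pos (hn _)),
      show mon F 3 n (0 : Fin r ⊕ Fin r → ℕ) = 1 from rfl, mul_one]
    rfl
  · rw [pderiv_mon_eq_zero, mul_zero, map_zero]
    refine Pi.single_eq_of_ne (fun h' => h ?_) _
    exact Sum.swap_leftInverse.injective h'

end Candidates

end Hamiltonian

/-! ### Normalizing a derivation on the variables and on the torus -/

namespace Hamiltonian

open DivPow

section Variables

variable {F : Type*} [Field F] [CharP F 3] {r : ℕ} {n : Fin r ⊕ Fin r → ℕ}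

/-- Comparing coefficients in `D [x_j, x^(b)]`. -/
theorem hcoeff_apply_lie_var (hr : 0 < r) (hn : ∀ i, 1 ≤ n i)
    (D : LieDerivation F (H2 F 3 n) (H2 F 3 n)) (j : Fin r ⊕ Fin r) (u : H2 F 3 n)
    {c : Fin r ⊕ Fin r → ℕ} (hc : c ≠ 0) :
    hcoeff F 3 n c (D ⁅hmon F n (Pi.single j 1), u⁆) =
      sgn j * hcoeff F 3 n (c + Pi.single j.swap 1) (D u) -
        hcoeff F 3 n c ⁅u, D (hmon F n (Pi.single j 1))⁆ := by
  rw [LieDerivation.apply_lie_eq_add, map_add, hcoeff_lie_var hr hn j hc, ← lie_skew, map_neg,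
    sub_eq_add_neg]

theorem hcoeff_lie_square (hr : 0 < r) (hn : ∀ i, 1 ≤ n i) (k i : Fin r ⊕ Fin r)
    (u : H2 F 3 n) :
    hcoeff F 3 n (Pi.single i 1) ⁅hmon F n (Pi.single k 2), u⁆ =
      if i = k then sgn k * hcoeff F 3 n (Pi.single k.swap 1) u else 0 := by
  have h2 : DH F 3 n (mon F 3 n (Pi.single k 2)) (pot F 3 n u) =
      (sgn k : F) • (mon F 3 n (Pi.single k 1) * pderiv F 3 n k.swap (pot F 3 n u)) :=
    DH_mon_single_apply k (k := 1) (by have := three_le_pow (hn k); omega) _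
  rw [hmon, hcoeff_lie_ham hn (single_ne_zero i)
    (coeff_tau_mon (ne_tau_of_sum_le hr hn (by rw [sum_single]; omega))), h2, map_smul, smul_eq_mul]
  split_ifs with h
  · subst h
    rw [coeff_var_mul hn, coeff_pderiv, zero_add]
    rfl
  · rw [coeff_mon_single_mul_of_lt, mul_zero]
    rw [Pi.single_eq_of_ne (Ne.symm h)]
    exact one_pos

theorem hcoeff_lie_mul (hr : 0 < r) (hn : ∀ i, 1 ≤ n i) {k l : Fin r ⊕ Fin r} (hkl : k ≠ l)
    (u : H2 F 3 n) :
    hcoeff F 3 n (Pi.single k 1) ⁅hmon F n (Pi.single k 1 + Pi.single l 1), u⁆ =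
      sgn l * hcoeff F 3 n (Pi.single l.swap 1) u := by
  rw [hmon, hcoeff_lie_ham hn (single_ne_zero k) (coeff_tau_mon (torus_ne_tau hr hn _ _)),
    mon_add_single _ _ (Pi.single_eq_of_ne hkl.symm _), DH_mul_apply, map_add,
    coeff_mon_single_mul_of_lt (by rw [Pi.single_eq_of_ne hkl.symm]; exact one_pos), zero_add,
    coeff_var_mul hn, coeff_DH_var (hn l), zero_add]
  rfl

/-- The linear part of a derivation on the span of the variables is infinitesimally symplectic
off the diagonal pairs. -/
theorem linearPart_symm (hr : 0 < r) (hn : ∀ i, 1 ≤ n i)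
    (D : LieDerivation F (H2 F 3 n) (H2 F 3 n)) {j k : Fin r ⊕ Fin r} (hjk : j ≠ k) :
    sgn j.swap * hcoeff F 3 n (Pi.single k.swap 1) (D (hmon F n (Pi.single j.swap 1))) =
      (sgn k : F) * hcoeff F 3 n (Pi.single j 1) (D (hmon F n (Pi.single k 1))) := by
  have h1 := hcoeff_apply_lie_var hr hn D j.swap (hmon F n (Pi.single k 2)) (single_ne_zero k)
  have h2 := hcoeff_apply_lie_var hr hn D k.swap (hmon F n (Pi.single k 2)) (single_ne_zero j)
  rw [lie_var_hmon_eq_zero hr hn _ (by rw [Sum.swap_swap, Pi.single_eq_of_ne hjk]), map_zero,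
    map_zero, hcoeff_lie_square hr hn, if_pos rfl, Sum.swap_swap] at h1
  have e : (Pi.single k 2 : Fin r ⊕ Fin r → ℕ) = Pi.single k 1 + Pi.single k.swap.swap 1 := by
    rw [Sum.swap_swap, ← Pi.single_add]
  have e1 : ⁅hmon F n (Pi.single k.swap 1), hmon F n (Pi.single k 2)⁆ =
      (sgn k.swap : F) • hmon F n (Pi.single k 1) := by
    rw [e, lie_var_hmon hr hn]
    · rw [← e]
      exact ne_tau_of_sum_le hr hn (by rw [sum_single]; omega)
    · rw [Sum.swap_swap, Pi.single_eq_same]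
      have := three_le_pow (hn k)
      omega
  rw [e1, hcoeff_lie_square hr hn, if_neg hjk, sub_zero, map_smul, map_smul, smul_eq_mul,
    Sum.swap_swap, mul_right_inj' (sgn_ne_zero _)] at h2
  rw [h2, add_comm (Pi.single j 1)]
  have hj := sgn_mul_self (F := F) j.swap
  have hk := sgn_mul_self (F := F) k
  linear_combination (sgn k * sgn j.swap : F) * h1 - (sgn j.swap *
    hcoeff F 3 n (Pi.single k.swap 1) (D (hmon F n (Pi.single j.swap 1)))) * hk +
    (sgn k * hcoeff F 3 n (Pi.single k 1 + Pi.single j 1) (D (hmon F n (Pi.single k 2)))) * hj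

/-- The diagonal entry of a derivation at `x_k x_l`, in terms of its linear part; the left-hand side
is symmetric in `k` and `l`. -/
theorem linearPart_mul (hr : 0 < r) (hn : ∀ i, 1 ≤ n i)
    (D : LieDerivation F (H2 F 3 n) (H2 F 3 n)) {k l : Fin r ⊕ Fin r} (h : k ≠ l) :
    hcoeff F 3 n (Pi.single k 1 + Pi.single l 1) (D (hmon F n (Pi.single k 1 + Pi.single l 1))) =
      hcoeff F 3 n (Pi.single k 1) (D (hmon F n (Pi.single k 1))) -
      hcoeff F 3 n (Pi.single l.swap 1) (D (hmon F n (Pi.single l.swap 1))) := by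
  have h1 := hcoeff_apply_lie_var hr hn D l.swap (hmon F n (Pi.single k 1 + Pi.single l 1))
    (single_ne_zero k)
  have e1 : ⁅hmon F n (Pi.single l.swap 1), hmon F n (Pi.single k 1 + Pi.single l 1)⁆ =
      (sgn l.swap : F) • hmon F n (Pi.single k 1) := by
    have := lie_var_hmon (F := F) hr hn l.swap (a := Pi.single k 1)
      (by rw [Sum.swap_swap]; exact torus_ne_tau hr hn _ _)
      (by rw [Sum.swap_swap, Pi.single_eq_of_ne h.symm]; exact one_lt_pow_of_pos (hn l))
    rwa [Sum.swap_swap] at this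
  rw [e1, hcoeff_lie_mul hr hn h, map_smul, map_smul, smul_eq_mul, Sum.swap_swap,
    sgn_swap_cast] at h1
  have hl := sgn_mul_self (F := F) l
  have hl0 := sgn_ne_zero (F := F) l
  apply mul_left_cancel₀ hl0
  linear_combination h1

/-- The trace of the linear part of a derivation on a pair `x_k, x_{k'}` does not depend on the
pair; it obstructs the linear part being symplectic. -/
theorem linearPart_trace (hr : 0 < r) (hn : ∀ i, 1 ≤ n i)
    (D : LieDerivation F (H2 F 3 n) (H2 F 3 n)) : ∃ t : F, ∀ k,
      hcoeff F 3 n (Pi.single k 1) (D (hmon F n (Pi.single k 1))) +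
        hcoeff F 3 n (Pi.single k.swap 1) (D (hmon F n (Pi.single k.swap 1))) = t := by
  obtain ⟨l⟩ : Nonempty (Fin r ⊕ Fin r) := ⟨Sum.inl ⟨0, hr⟩⟩
  refine ⟨hcoeff F 3 n (Pi.single l 1) (D (hmon F n (Pi.single l 1))) +
    hcoeff F 3 n (Pi.single l.swap 1) (D (hmon F n (Pi.single l.swap 1))), fun k => ?_⟩
  by_cases h : k = l
  · rw [h]
  have h1 := linearPart_mul hr hn D h
  have h2 := linearPart_mul hr hn D (Ne.symm h)
  rw [add_comm (Pi.single l 1)] at h2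
  linear_combination h2 - h1

/-- The coefficient of `x^(c)` in the `j`-th component of the one-form `∑ j, f_j dx_j` attached
to a derivation `D`, where `f_j` is a potential of `D (x_{j'})` up to sign; if `D` is the inner
derivation with potential `h`, it is `-dh`. -/
noncomputable def oneForm (D : LieDerivation F (H2 F 3 n) (H2 F 3 n)) (j : Fin r ⊕ Fin r)
    (c : Fin r ⊕ Fin r → ℕ) : F :=
  sgn j.swap * hcoeff F 3 n c (D (hmon F n (Pi.single j.swap 1)))

/-- The one-form of a derivation has a symmetric linear part after subtraction of a multiple of the
Euler derivation. -/
theorem exists_sub_symm (hr : 0 < r) (hn : ∀ i, 1 ≤ n i)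
    (D : LieDerivation F (H2 F 3 n) (H2 F 3 n)) : ∃ δ ∈ known F n, ∀ j k,
      oneForm (D - act F 3 n δ) j (Pi.single k 1) = oneForm (D - act F 3 n δ) k (Pi.single j 1) := by
  obtain ⟨t, ht⟩ := linearPart_trace hr hn D
  -- `E` acts by `1 - 2 = -1` on the variables, and `t + 2 t = 0`
  refine ⟨t • nEuler F n, Submodule.smul_mem _ _ nEuler_mem_known, fun j k => ?_⟩
  by_cases h : j = k.swap
  · subst h
    have e : ∀ i, hcoeff F 3 n (Pi.single i 1)
        ((D - act F 3 n (t • nEuler F n)) (hmon F n (Pi.single i 1))) =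
        hcoeff F 3 n (Pi.single i 1) (D (hmon F n (Pi.single i 1))) + t := by
      intro i
      rw [map_smul, LieDerivation.sub_apply, LieDerivation.smul_apply, act_nEuler_hmon, sum_single,
        map_sub, map_smul, map_smul,
        hcoeff_hmon_self hn (single_ne_zero i) (single_ne_tau hr hn i) (single_lt hn i)]
      simp only [smul_eq_mul]
      push_cast
      ring
    simp only [oneForm, Sum.swap_swap]
    rw [e, e, sgn_swap_cast]
    linear_combination (sgn k : F) * ht k + (sgn k * t : F) * three_eq_zero (F := F)
  · have := linearPart_symm hr hn (D - act F 3 n (t • nEuler F n)) (j := j) (k := k.swap) h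
    rwa [Sum.swap_swap] at this

theorem lie_var_var (hr : 0 < r) (hn : ∀ i, 1 ≤ n i) (i j : Fin r ⊕ Fin r) :
    ⁅hmon F n (Pi.single i 1), hmon F n (Pi.single j 1)⁆ = 0 := by
  by_cases h : i.swap = j
  · subst h
    have := lie_var_hmon (F := F) hr hn i (a := 0)
      (by rw [zero_add]; exact single_ne_tau hr hn _) (by simpa using one_lt_pow_of_pos (hn _))
    rw [zero_add] at this
    rw [this, hmon, ham_mon_zero, smul_zero]
  · exact lie_var_hmon_eq_zero hr hn i (Pi.single_eq_of_ne h _)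

theorem oneForm_closed (hr : 0 < r) (hn : ∀ i, 1 ≤ n i)
    {D : LieDerivation F (H2 F 3 n) (H2 F 3 n)}
    (hD : ∀ j k, oneForm D j (Pi.single k 1) = oneForm D k (Pi.single j 1))
    (i j : Fin r ⊕ Fin r) (c : Fin r ⊕ Fin r → ℕ) :
    oneForm D j (c + Pi.single i 1) = oneForm D i (c + Pi.single j 1) := by
  by_cases hc : c = 0
  · rw [hc, zero_add, zero_add, hD]
  have h := hcoeff_apply_lie_var hr hn D i.swap (hmon F n (Pi.single j.swap 1)) hc
  rw [lie_var_var hr hn, map_zero, map_zero, hcoeff_lie_var hr hn _ hc, Sum.swap_swap,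
    Sum.swap_swap] at h
  have hj := sgn_mul_self (F := F) j.swap
  have hi := sgn_mul_self (F := F) i.swap
  simp only [oneForm]
  linear_combination -(sgn i.swap * sgn j.swap : F) * h -
    (sgn j.swap * hcoeff F 3 n (c + Pi.single i 1) (D (hmon F n (Pi.single j.swap 1)))) * hi +
    (sgn i.swap * hcoeff F 3 n (c + Pi.single j 1) (D (hmon F n (Pi.single i.swap 1)))) * hj

end Variables

end Hamiltonian

namespace Hamiltonian

open DivPow

section Torus

variable {F : Type*} [Field F] [CharP F 3] {r : ℕ} {n : Fin r ⊕ Fin r → ℕ}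

theorem hcoeff_act_nDH_var (hr : 0 < r) (hn : ∀ i, 1 ≤ n i) (h : DivPow F 3 n)
    (j : Fin r ⊕ Fin r) {c : Fin r ⊕ Fin r → ℕ} (hc : c ≠ 0) :
    hcoeff F 3 n c (act F 3 n (nDH F n h) (hmon F n (Pi.single j 1))) =
      -(sgn j * coeff F 3 n (c + Pi.single j.swap 1) h) := by
  rw [act_nDH_hmon _ (single_ne_tau hr hn _), hcoeff_ham hn hc (coeff_tau_DH _ _),
    DH_apply_antisymm, map_neg, coeff_DH_var (hn j)]

theorem hcoeff_eq_zero_of_le {c : Fin r ⊕ Fin r → ℕ} {i : Fin r ⊕ Fin r} (h : 3 ^ n i ≤ c i)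
    (u : H2 F 3 n) : hcoeff F 3 n c u = 0 := coeff_eq_zero h _

/-- Every derivation becomes zero on the variables after subtraction of a known one. -/
theorem exists_sub_var (hr : 0 < r) (hn : ∀ i, 1 ≤ n i)
    (D : LieDerivation F (H2 F 3 n) (H2 F 3 n)) : ∃ δ ∈ known F n, ∀ j,
      (D - act F 3 n δ) (hmon F n (Pi.single j 1)) = 0 := by
  obtain ⟨δ, hδ, hD⟩ := exists_sub_symm hr hn D
  generalize hD' : D - act F 3 n δ = D' at hD
  have hcl := oneForm_closed hr hn hD
  obtain ⟨h, hh⟩ := exists_potential (F := F) (p := 3) (n := n) hcl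
  let s : (H2 F 3 n).normalizer :=
    ∑ j, (sgn j.swap * oneForm D' j (Pi.single j (tau 3 n j))) • nSing F n j
  refine ⟨δ + (s - nDH F n h), Submodule.add_mem _ hδ (Submodule.sub_mem _
    (Submodule.sum_mem _ fun j _ => Submodule.smul_mem _ _ (nSing_mem_known j))
    (nDH_mem_known h)), fun j => ?_⟩
  obtain ⟨j, rfl⟩ : ∃ i : Fin r ⊕ Fin r, j = i.swap := ⟨j.swap, (Sum.swap_swap j).symm⟩
  have es : act F 3 n s (hmon F n (Pi.single j.swap 1)) =
      (sgn j.swap * oneForm D' j (Pi.single j (tau 3 n j))) •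
        hmon F n (Pi.single j (tau 3 n j)) := by
    simp only [s, map_sum, map_smul]
    rw [← LieDerivation.coeFnAddMonoidHom_apply, map_sum, Finset.sum_apply,
      Finset.sum_eq_single j]
    · rw [LieDerivation.coeFnAddMonoidHom_apply, LieDerivation.smul_apply, act_nSing_var hr hn,
        if_pos rfl]
    · intro i _ hij
      rw [LieDerivation.coeFnAddMonoidHom_apply, LieDerivation.smul_apply, act_nSing_var hr hn,
        if_neg hij, smul_zero]
    · simp
  have hsj := sgn_mul_self (F := F) j.swap
  apply eq_zero_of_hcoeff hn
  intro c hc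
  have e1 : hcoeff F 3 n c (D' (hmon F n (Pi.single j.swap 1))) = sgn j.swap * oneForm D' j c := by
    simp only [oneForm]
    linear_combination -hcoeff F 3 n c (D' (hmon F n (Pi.single j.swap 1))) * hsj
  rw [map_add, map_sub, ← sub_sub, hD', LieDerivation.sub_apply, LieDerivation.sub_apply, es,
    map_sub, map_sub, hcoeff_act_nDH_var hr hn h _ hc, map_smul, smul_eq_mul, Sum.swap_swap, e1]
  by_cases hcj : c = Pi.single j (tau 3 n j)
  · have hlt : ∀ i, c i < 3 ^ n i := by
      intro i
      by_cases hi : i = j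
      · rw [hcj, hi, Pi.single_eq_same]
        exact tau_lt j
      · rw [hcj, Pi.single_eq_of_ne hi]
        exact pow_pos (by norm_num) _
    have hne : c ≠ tau 3 n := by
      intro h'
      have h1 := congrFun hcj j.swap
      rw [Pi.single_eq_of_ne (swap_ne j), h'] at h1
      have := three_le_pow (hn j.swap)
      simp only [tau] at h1
      omega
    rw [← hcj, hcoeff_hmon_self hn hc hne hlt, coeff_eq_zero (i := j)]
    · ring
    · rw [hcj, Pi.add_apply, Pi.single_eq_same, Pi.single_eq_same]
      simp only [tau]
      omega
  · rw [hcoeff_hmon_of_ne hn hc hcj]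
    by_cases hlt : ∀ i, (c + Pi.single j 1 : Fin r ⊕ Fin r → ℕ) i < 3 ^ n i
    · rw [hh j c hlt]
      ring
    · -- where `c + ε_j` is out of range, closedness leaves only the term with `c = τ_j ε_j`
      have h0 : coeff F 3 n (c + Pi.single j 1) h = 0 := by rw [coeff_def, dif_neg hlt]
      push Not at hlt
      obtain ⟨i, hi⟩ := hlt
      have h1 : oneForm D' j c = 0 := by
        by_cases hci : 3 ^ n i ≤ c i
        · rw [oneForm, hcoeff_eq_zero_of_le hci, mul_zero]
        · have hij : i = j := by
            by_contra hij
            rw [Pi.add_apply, Pi.single_eq_of_ne hij, add_zero] at hi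
            omega
          subst hij
          rw [Pi.add_apply, Pi.single_eq_same] at hi
          obtain ⟨k, hk⟩ : ∃ k, k ≠ i ∧ c k ≠ 0 := by
            by_contra hno
            push Not at hno
            refine hcj (funext fun k => ?_)
            by_cases hk : k = i
            · rw [hk, Pi.single_eq_same]
              simp only [tau]
              omega
            · rw [hno k hk, Pi.single_eq_of_ne hk]
          obtain ⟨d, rfl⟩ := exists_eq_add_single hk.2
          rw [hcl, oneForm, hcoeff_eq_zero_of_le (i := i), mul_zero]
          rw [Pi.add_apply, Pi.single_eq_of_ne hk.1.symm] at hi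
          rw [Pi.add_apply, Pi.single_eq_same]
          omega
      rw [h0, h1]
      ring

/-- If a derivation kills all `x_j` and all `[x_j, u]`, its value on `u` has a linear potential. -/
theorem hcoeff_eq_zero_of_lie_var (hr : 0 < r) (hn : ∀ i, 1 ≤ n i)
    {D : LieDerivation F (H2 F 3 n) (H2 F 3 n)} (hD : ∀ j, D (hmon F n (Pi.single j 1)) = 0)
    {u : H2 F 3 n} (hu : ∀ j, D ⁅hmon F n (Pi.single j 1), u⁆ = 0)
    {c : Fin r ⊕ Fin r → ℕ} (hc : 2 ≤ ∑ i, c i) : hcoeff F 3 n c (D u) = 0 := by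
  obtain ⟨j, hj⟩ : ∃ j, c j ≠ 0 := Function.ne_iff.1 (ne_zero_of_sum (by omega))
  obtain ⟨d, rfl⟩ := exists_eq_add_single hj
  rw [sum_add, sum_single] at hc
  have h := hcoeff_apply_lie_var hr hn D j.swap u (c := d) (ne_zero_of_sum (by omega))
  rw [hu, hD, lie_zero, map_zero, sub_zero, Sum.swap_swap] at h
  exact (mul_eq_zero.1 h.symm).resolve_left (sgn_ne_zero _)

/-- The property of a derivation to vanish on the variables `x_j` and on the elements
`x_k x_{k'}`, which span a torus. -/
structure KillsTorus (D : LieDerivation F (H2 F 3 n) (H2 F 3 n)) : Prop where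
  var : ∀ j, D (hmon F n (Pi.single j 1)) = 0
  torus : ∀ k, D (hmon F n (Pi.single k 1 + Pi.single k.swap 1)) = 0

theorem sum_eq_one_iff {c : Fin r ⊕ Fin r → ℕ} : ∑ i, c i = 1 ↔ ∃ i, c = Pi.single i 1 := by
  constructor
  · intro h
    obtain ⟨j, hj⟩ : ∃ j, c j ≠ 0 := Function.ne_iff.1 (ne_zero_of_sum (by omega))
    obtain ⟨d, rfl⟩ := exists_eq_add_single hj
    refine ⟨j, ?_⟩
    rw [sum_add, sum_single, Nat.add_eq_right, Finset.sum_eq_zero_iff] at h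
    rw [show d = 0 from funext fun i => h i (Finset.mem_univ i), zero_add]
  · rintro ⟨i, rfl⟩
    exact sum_single i 1

/-- The values on the torus of a derivation that kills the variables have linear potentials, so a
further inner derivation with linear potential removes them. -/
theorem exists_killsTorus (hr : 0 < r) (hn : ∀ i, 1 ≤ n i)
    (D : LieDerivation F (H2 F 3 n) (H2 F 3 n)) :
    ∃ δ ∈ known F n, KillsTorus (D - act F 3 n δ) := by
  obtain ⟨δ, hδ, hD⟩ := exists_sub_var hr hn D
  generalize hD' : D - act F 3 n δ = D' at hD
  let t : Fin r ⊕ Fin r → H2 F 3 n := fun k => hmon F n (Pi.single k 1 + Pi.single k.swap 1)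
  have hlin : ∀ k c, 2 ≤ ∑ i, c i → hcoeff F 3 n c (D' (t k)) = 0 := by
    intro k c hc
    refine hcoeff_eq_zero_of_lie_var hr hn hD (fun j => ?_) hc
    rw [← lie_skew, LieDerivation.map_neg, lie_torus_hmon hr hn, map_smul, hD,
      smul_zero, neg_zero]
  have hdiag : ∀ k l, l ≠ k → l ≠ k.swap → hcoeff F 3 n (Pi.single l 1) (D' (t k)) = 0 := by
    intro k l h1 h2
    have hne : l.swap ≠ k := fun e => h2 (by rw [← e, Sum.swap_swap])
    have hne' : l.swap ≠ k.swap := fun e => h1 (Sum.swap_leftInverse.injective e)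
    have e : ⁅t l, t k⁆ = 0 := by
      simp only [t]
      rw [lie_torus_hmon hr hn]
      simp [h1, h2, hne, hne']
    have h := congrArg (fun u => hcoeff F 3 n (Pi.single l 1) (D' u)) e
    simp only [LieDerivation.apply_lie_eq_add, map_add, map_zero] at h
    rw [← lie_skew (D' (t l)) (t k), map_neg, hcoeff_lie_torus hr hn l (single_ne_zero l),
      hcoeff_lie_torus hr hn k (single_ne_zero l), Pi.single_eq_of_ne (Ne.symm h1),
      Pi.single_eq_of_ne (Ne.symm h2), Pi.single_eq_same, Pi.single_eq_of_ne (swap_ne l)] at h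
    have := sgn_mul_self (F := F) l
    push_cast at h
    linear_combination -(sgn l : F) * h - hcoeff F 3 n (Pi.single l 1) (D' (t k)) * this
  -- the linear potential whose inner derivation has the same values on the torus
  let u : DivPow F 3 n :=
    ∑ l, (sgn l * hcoeff F 3 n (Pi.single l 1) (D' (t l))) • mon F 3 n (Pi.single l 1)
  have hu : ∀ c, coeff F 3 n c u =
      ∑ l, (sgn l * hcoeff F 3 n (Pi.single l 1) (D' (t l))) *
        coeff F 3 n c (mon F 3 n (Pi.single l 1)) := by
    intro c
    simp only [u, map_sum, map_smul, smul_eq_mul]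
  have hu2 : ∀ c, 2 ≤ ∑ i, c i → coeff F 3 n c u = 0 := by
    intro c hc
    rw [hu]
    refine Finset.sum_eq_zero fun l _ => ?_
    rw [coeff_mon_of_ne, mul_zero]
    rintro rfl
    rw [sum_single] at hc
    omega
  have hu1 : ∀ l, coeff F 3 n (Pi.single l 1) u =
      sgn l * hcoeff F 3 n (Pi.single l 1) (D' (t l)) := by
    intro l
    rw [hu, Finset.sum_eq_single l, coeff_mon_self (single_lt hn l), mul_one]
    · intro k _ hkl
      rw [coeff_mon_of_ne, mul_zero]
      intro e
      have := congrFun e l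
      simp [hkl] at this
    · simp
  refine ⟨δ + nDH F n u, Submodule.add_mem _ hδ (nDH_mem_known u), ⟨fun j => ?_, fun k => ?_⟩⟩
  · rw [map_add, ← sub_sub, hD', LieDerivation.sub_apply, hD, zero_sub, neg_eq_zero]
    apply eq_zero_of_hcoeff hn
    intro c hc
    rw [hcoeff_act_nDH_var hr hn u j hc, hu2, mul_zero, neg_zero]
    rw [sum_add, sum_single]
    have : ∑ i, c i ≠ 0 := fun h0 => hc (funext fun i =>
      Finset.sum_eq_zero_iff.1 h0 i (Finset.mem_univ i))
    omega
  · rw [map_add, ← sub_sub, hD', LieDerivation.sub_apply]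
    apply eq_zero_of_hcoeff hn
    intro c hc
    have h1 : hcoeff F 3 n c (act F 3 n (nDH F n u) (t k)) =
        -(sgn k * ((c k.swap : F) - c k) * coeff F 3 n c u) := by
      rw [act_nDH_hmon _ (torus_ne_tau hr hn _ _), hcoeff_ham hn hc (coeff_tau_DH _ _),
        DH_apply_antisymm, map_neg, coeff_DH_torus hn]
    have h2 : ∑ i, c i ≠ 0 := fun h0 => hc (funext fun i =>
      Finset.sum_eq_zero_iff.1 h0 i (Finset.mem_univ i))
    rw [map_sub, h1]
    by_cases hc2 : 2 ≤ ∑ i, c i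
    · rw [hlin k c hc2, hu2 c hc2]
      ring
    · obtain ⟨l, rfl⟩ := sum_eq_one_iff.1 (show ∑ i, c i = 1 by omega)
      rw [hu1]
      by_cases hlk : l = k
      · subst hlk
        rw [Pi.single_eq_same, Pi.single_eq_of_ne (swap_ne l)]
        have := sgn_mul_self (F := F) l
        push_cast
        linear_combination -hcoeff F 3 n (Pi.single l 1) (D' (t l)) * this
      · by_cases hlk' : l = k.swap
        · have ht : t l = t k := by
            simp only [t, hlk', Sum.swap_swap]
            rw [add_comm]
          rw [ht, hlk', Pi.single_eq_same, Pi.single_eq_of_ne (swap_ne k).symm, sgn_swap_cast]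
          have := sgn_mul_self (F := F) k
          push_cast
          linear_combination -hcoeff F 3 n (Pi.single k.swap 1) (D' (t k)) * this
        · rw [hdiag k l hlk hlk', Pi.single_eq_of_ne (Ne.symm hlk),
            Pi.single_eq_of_ne (Ne.symm hlk')]
          ring

end Torus

end Hamiltonian

/-! ### Derivations that kill the torus -/

namespace Hamiltonian

open DivPow

section Negative

variable {F : Type*} [Field F] [CharP F 3] {r : ℕ} {n : Fin r ⊕ Fin r → ℕ}
  {D : LieDerivation F (H2 F 3 n) (H2 F 3 n)}

theorem exists_ne_pair (hr : 1 < r) (l : Fin r ⊕ Fin r) :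
    ∃ j : Fin r ⊕ Fin r, j ≠ l ∧ j ≠ l.swap := by
  have : Nontrivial (Fin r) := Fin.nontrivial_iff_two_le.2 hr
  rcases l with x | x
  · obtain ⟨q, hq⟩ := exists_ne x
    exact ⟨Sum.inl q, by simpa using hq, by simp⟩
  · obtain ⟨q, hq⟩ := exists_ne x
    exact ⟨Sum.inr q, by simpa using hq, by simp⟩

theorem hmon_zero : hmon F n 0 = 0 := ham_mon_zero

theorem hmon_eq_zero {a : Fin r ⊕ Fin r → ℕ} {i : Fin r ⊕ Fin r} (h : 3 ^ n i ≤ a i) :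
    hmon F n a = 0 := by
  rw [hmon, mon_eq_zero h, map_zero]

theorem pure_ne_tau (hn : ∀ i, 1 ≤ n i) (j : Fin r ⊕ Fin r) (k : ℕ) :
    (Pi.single j k : Fin r ⊕ Fin r → ℕ) ≠ tau 3 n := by
  intro h
  have h1 := congrFun h j.swap
  rw [Pi.single_eq_of_ne (swap_ne j)] at h1
  have := three_le_pow (hn j.swap)
  simp only [tau] at h1
  omega

/-- A derivation that kills the torus preserves weights modulo `3`. -/
theorem KillsTorus.weight (hD : KillsTorus D) (hr : 0 < r) (hn : ∀ i, 1 ≤ n i)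
    {a c : Fin r ⊕ Fin r → ℕ} (hc : c ≠ 0) (h : hcoeff F 3 n c (D (hmon F n a)) ≠ 0)
    (k : Fin r ⊕ Fin r) : (a k.swap + c k) % 3 = (a k + c k.swap) % 3 := by
  have h1 := congrArg (hcoeff F 3 n c) (D.apply_lie_eq_add
    (hmon F n (Pi.single k 1 + Pi.single k.swap 1)) (hmon F n a))
  rw [hD.torus, zero_lie, add_zero, lie_torus_hmon hr hn, map_smul, map_smul, smul_eq_mul,
    hcoeff_lie_torus hr hn k hc, mul_left_inj' h, mul_right_inj' (sgn_ne_zero k)] at h1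
  rw [← natCast_eq_iff (F := F)]
  push_cast
  linear_combination h1

theorem apply_lie_var_eq_zero (hr : 0 < r) (hn : ∀ i, 1 ≤ n i) {a : Fin r ⊕ Fin r → ℕ}
    (hlow : ∀ b : Fin r ⊕ Fin r → ℕ, ∑ i, b i < ∑ i, a i → D (hmon F n b) = 0)
    (j : Fin r ⊕ Fin r) : D ⁅hmon F n (Pi.single j 1), hmon F n a⁆ = 0 := by
  by_cases h0 : a j.swap = 0
  · rw [lie_var_hmon_eq_zero hr hn j h0, map_zero]
  by_cases ht : a = tau 3 n
  · rw [ht, hmon, hmon, ham_mon_tau, lie_zero, map_zero]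
  by_cases hlt : a j.swap < 3 ^ n j.swap
  · obtain ⟨d, rfl⟩ := exists_eq_add_single h0
    rw [lie_var_hmon hr hn j ht (by simpa using hlt), map_smul, hlow, smul_zero]
    rw [sum_add, sum_single]
    omega
  · rw [hmon_eq_zero (not_lt.1 hlt), lie_zero, map_zero]

/-- If a derivation kills the torus and everything of degree smaller than `x^(a)`, its value at
`D_H(x^(a))` is a combination of the variables `x_l` whose weight is that of `x^(a)`; the two
conditions on `l` say this modulo `3`. -/
theorem KillsTorus.eq_zero (hD : KillsTorus D) (hr : 0 < r) (hn : ∀ i, 1 ≤ n i)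
    {a : Fin r ⊕ Fin r → ℕ}
    (hlow : ∀ b : Fin r ⊕ Fin r → ℕ, ∑ i, b i < ∑ i, a i → D (hmon F n b) = 0)
    (h : ∀ l, (a l.swap + 1) % 3 = a l % 3 →
      (∀ k, k ≠ l → k ≠ l.swap → a k.swap % 3 = a k % 3) →
      hcoeff F 3 n (Pi.single l 1) (D (hmon F n a)) = 0) : D (hmon F n a) = 0 := by
  apply eq_zero_of_hcoeff hn
  intro c hc
  by_cases hc2 : 2 ≤ ∑ i, c i
  · exact hcoeff_eq_zero_of_lie_var hr hn hD.var (apply_lie_var_eq_zero hr hn hlow) hc2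
  have h2 : ∑ i, c i ≠ 0 := fun h0 => hc (funext fun i =>
    Finset.sum_eq_zero_iff.1 h0 i (Finset.mem_univ i))
  obtain ⟨l, rfl⟩ := sum_eq_one_iff.1 (show ∑ i, c i = 1 by omega)
  by_contra hne
  have hw := hD.weight hr hn hc hne
  refine hne (h l ?_ fun k h1 h2 => ?_)
  · have := hw l
    rwa [Pi.single_eq_same, Pi.single_eq_of_ne (swap_ne l), add_zero] at this
  · have := hw k
    rwa [Pi.single_eq_of_ne h1, Pi.single_eq_of_ne fun e => h2 (by rw [← e, Sum.swap_swap]),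
      add_zero, add_zero] at this

theorem KillsTorus.eq_zero_of_sum_lt (hD : KillsTorus D) {b : Fin r ⊕ Fin r → ℕ}
    (h : ∑ i, b i < 2) : D (hmon F n b) = 0 := by
  rcases Nat.eq_zero_or_pos (∑ i, b i) with h0 | h0
  · rw [show b = 0 from funext fun i => Finset.sum_eq_zero_iff.1 h0 i (Finset.mem_univ i),
      hmon_zero, map_zero]
  · obtain ⟨i, rfl⟩ := sum_eq_one_iff.1 (show ∑ i, b i = 1 by omega)
    exact hD.var i

theorem KillsTorus.mul_eq_zero (hD : KillsTorus D) (hr : 0 < r) (hn : ∀ i, 1 ≤ n i)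
    {i j : Fin r ⊕ Fin r} (h1 : i ≠ j) (h2 : i ≠ j.swap) :
    D (hmon F n (Pi.single i 1 + Pi.single j 1)) = 0 := by
  have h3 : j.swap ≠ i := h2.symm
  have h4 : i.swap ≠ j := fun h => h2 (by rw [← h, Sum.swap_swap])
  refine hD.eq_zero hr hn (fun b hb => hD.eq_zero_of_sum_lt ?_) fun l hl hk => ?_
  · rwa [sum_add, sum_single, sum_single] at hb
  · exfalso
    by_cases hi : i = l ∨ i = l.swap
    · have hj1 : j ≠ l := by
        rintro rfl
        exact hi.elim h1 h2
      have hj2 : j ≠ l.swap := by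
        rintro rfl
        rw [Sum.swap_swap] at h2
        exact hi.elim h2 h1
      have := hk j hj1 hj2
      simp [h1.symm, h3, swap_ne] at this
    · push Not at hi
      have := hk i hi.1 hi.2
      simp [h1, h4, swap_ne] at this

/-- The classes `x_i^(2) ↦ x_{i'}` are excluded by a second pair of variables, or by `x_i^(3)`. -/
theorem KillsTorus.hcoeff_square (hD : KillsTorus D) (hr : 0 < r) (hn : ∀ i, 1 ≤ n i)
    (hcase : 1 < r ∨ ∀ i, 2 ≤ n i) (i : Fin r ⊕ Fin r) :
    hcoeff F 3 n (Pi.single i.swap 1) (D (hmon F n (Pi.single i 2))) = 0 := by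
  rcases hcase with h | h
  · obtain ⟨j, hj1, hj2⟩ := exists_ne_pair h i
    have e : ⁅hmon F n (Pi.single i 2), hmon F n (Pi.single j 1 + Pi.single i 1)⁆ = 0 := by
      have h2 : DH F 3 n (mon F 3 n (Pi.single i 2)) (mon F 3 n (Pi.single j 1 + Pi.single i 1)) =
          (sgn i : F) • (mon F 3 n (Pi.single i 1) *
            pderiv F 3 n i.swap (mon F 3 n (Pi.single j 1 + Pi.single i 1))) :=
        DH_mon_single_apply i (k := 1) (by have := three_le_pow (hn i); omega) _
      rw [lie_hmon (pure_ne_tau hn i 2) (torus_ne_tau hr hn _ _), h2, pderiv_mon_eq_zero, mul_zero,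
        smul_zero, map_zero]
      simp [hj2.symm, swap_ne]
    have h1 := congrArg (fun u => hcoeff F 3 n (Pi.single j 1) (D u)) e
    simp only [LieDerivation.apply_lie_eq_add, map_add, map_zero] at h1
    rw [hD.mul_eq_zero hr hn hj1 hj2, lie_zero, map_zero, zero_add, ← lie_skew, map_neg,
      hcoeff_lie_mul hr hn hj1, neg_eq_zero] at h1
    exact (_root_.mul_eq_zero.1 h1).resolve_left (sgn_ne_zero _)
  · have h9 : 9 ≤ 3 ^ n i := Nat.pow_le_pow_right (n := 3) (by omega) (h i)
    have h1 := hcoeff_apply_lie_var hr hn D i (hmon F n (Pi.single i 3)) (single_ne_zero i)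
    rw [lie_var_hmon_eq_zero hr hn i (Pi.single_eq_of_ne (swap_ne i) _), map_zero, map_zero,
      hD.var, lie_zero, map_zero, sub_zero] at h1
    have h2 := hcoeff_apply_lie_var hr hn D i.swap (hmon F n (Pi.single i 3))
      (single_ne_zero i.swap)
    have e : (Pi.single i 3 : Fin r ⊕ Fin r → ℕ) = Pi.single i 2 + Pi.single i.swap.swap 1 := by
      rw [Sum.swap_swap, ← Pi.single_add]
    have e1 : ⁅hmon F n (Pi.single i.swap 1), hmon F n (Pi.single i 3)⁆ =
        (sgn i.swap : F) • hmon F n (Pi.single i 2) := by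
      rw [e, lie_var_hmon hr hn]
      · rw [← e]
        exact pure_ne_tau hn i 3
      · rw [Sum.swap_swap, Pi.single_eq_same]
        omega
    rw [e1, map_smul, map_smul, hD.var, lie_zero, map_zero, sub_zero, Sum.swap_swap,
      add_comm (Pi.single i.swap 1), smul_eq_mul, mul_right_inj' (sgn_ne_zero _)] at h2
    rw [h2]
    exact (_root_.mul_eq_zero.1 h1.symm).resolve_left (sgn_ne_zero _)

theorem KillsTorus.eq_zero_of_sum_le_two (hD : KillsTorus D) (hr : 0 < r) (hn : ∀ i, 1 ≤ n i)
    (hcase : 1 < r ∨ ∀ i, 2 ≤ n i) {a : Fin r ⊕ Fin r → ℕ} (ha : ∑ i, a i ≤ 2) :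
    D (hmon F n a) = 0 := by
  rcases ha.lt_or_eq with ha | ha
  · exact hD.eq_zero_of_sum_lt ha
  refine hD.eq_zero hr hn (fun b hb => hD.eq_zero_of_sum_lt (by omega)) fun l hl hk => ?_
  have h1 := add_le_sum a (swap_ne l)
  by_cases h2 : a l.swap = 0
  · exfalso
    have h3 : a l = 1 := by omega
    obtain ⟨d, rfl⟩ := exists_eq_add_single (show a l ≠ 0 by omega)
    rw [sum_add, sum_single] at ha
    obtain ⟨j, rfl⟩ := sum_eq_one_iff.1 (show ∑ i, d i = 1 by omega)
    have hj1 : j ≠ l := by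
      rintro rfl
      simp at h3
    have hj2 : j ≠ l.swap := by
      rintro rfl
      simp at h2
    have := hk j hj1 hj2
    have h4 : j.swap ≠ l := fun e => hj2 (by rw [← e, Sum.swap_swap])
    simp [hj1, h4, swap_ne] at this
  · have h3 : a l.swap = 2 := by omega
    obtain ⟨d, rfl⟩ := exists_eq_add_single h2
    rw [sum_add, sum_single] at ha
    obtain ⟨j, rfl⟩ := sum_eq_one_iff.1 (show ∑ i, d i = 1 by omega)
    have hj : l.swap = j := by
      by_contra hj
      simp [hj] at h3
    subst hj
    have := hD.hcoeff_square hr hn hcase l.swap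
    rwa [Sum.swap_swap, ← one_add_one_eq_two, Pi.single_add] at this

/-- For `r > 1` the value at `x_j^(2) x_{j'}`, which has the weight of `x_j`, vanishes. -/
theorem KillsTorus.cubic (hD : KillsTorus D) (h1r : 1 < r) (hn : ∀ i, 1 ≤ n i)
    (j : Fin r ⊕ Fin r) : D (hmon F n (Pi.single j.swap 1 + Pi.single j 2)) = 0 := by
  have hr : 0 < r := by omega
  have hquad := fun a => hD.eq_zero_of_sum_le_two (a := a) hr hn (Or.inl h1r)
  have hcub : ∀ i : Fin r ⊕ Fin r,
      (Pi.single i.swap 1 + Pi.single i 2 : Fin r ⊕ Fin r → ℕ) ≠ tau 3 n := fun i =>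
    ne_tau_of_sum_le hr hn (by rw [sum_add, sum_single, sum_single])
  refine hD.eq_zero hr hn (fun b hb => hquad b ?_) fun l hl _ => ?_
  · rw [sum_add, sum_single, sum_single] at hb
    omega
  have hlj : l = j := by
    by_contra hlj
    by_cases hlj' : l = j.swap
    · subst hlj'
      simp [swap_ne, (swap_ne j).symm] at hl
    · have : l.swap ≠ j := fun e => hlj' (by rw [← e, Sum.swap_swap])
      have h' : l.swap ≠ j.swap := fun h => hlj (Sum.swap_leftInverse.injective h)
      simp [hlj, hlj', this, h'] at hl
  subst hlj
  obtain ⟨i, hi1, hi2⟩ := exists_ne_pair h1r l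
  have hle : ∀ k, 3 ≤ 3 ^ n k := fun k => three_le_pow (hn k)
  -- the bracket of `x_k^(2) x_{k'}` with `x_i x_{k'}`; its result `x_i x_k x_{k'}` is symmetric
  -- in `k` and `k'`
  have hA : ∀ k : Fin r ⊕ Fin r, i ≠ k → i ≠ k.swap →
      hcoeff F 3 n (Pi.single k 1) (D (hmon F n (Pi.single k.swap 1 + Pi.single k 2))) =
        hcoeff F 3 n (Pi.single i 1)
          (D (hmon F n (Pi.single i 1 + (Pi.single k 1 + Pi.single k.swap 1)))) := by
    intro k h1 h2
    have h3 : k.swap ≠ k := swap_ne k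
    have hb := DH_cubic_mon (F := F) (n := n) hn (j := k)
      (a := Pi.single i 1 + (Pi.single k 1 + Pi.single k.swap 1))
      (by
        intro q
        have := hle q
        simp only [Pi.add_apply, Pi.single_apply]
        split_ifs with e1 e2 e3 e3 <;> first | omega | (subst e1; simp_all))
      (by simp only [Pi.add_apply, Pi.single_eq_same]; omega)
    have e : (Pi.single i 1 + (Pi.single k 1 + Pi.single k.swap 1) - Pi.single k 1 :
        Fin r ⊕ Fin r → ℕ) = Pi.single i 1 + Pi.single k.swap 1 := by
      rw [add_left_comm, add_tsub_cancel_left]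
    rw [e] at hb
    have h4 := congrArg (fun u => hcoeff F 3 n (Pi.single i 1) (D u))
      (lie_hmon (F := F) (hcub k) (torus_ne_tau hr hn i k.swap))
    simp only [LieDerivation.apply_lie_eq_add, map_add, hb, map_smul] at h4
    rw [hquad (Pi.single i 1 + Pi.single k.swap 1) (by rw [sum_add, sum_single, sum_single]),
      lie_zero, map_zero, zero_add, ← lie_skew, map_neg, hcoeff_lie_mul hr hn h2,
      Sum.swap_swap, sgn_swap_cast] at h4
    simp only [Pi.add_apply, Pi.single_eq_same, Pi.single_eq_of_ne h1.symm,
      Pi.single_eq_of_ne h3, Pi.single_eq_of_ne h3.symm, Pi.single_eq_of_ne h2.symm,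
      smul_eq_mul] at h4
    apply mul_left_cancel₀ (sgn_ne_zero (F := F) k)
    push_cast at h4
    unfold hmon at h4 ⊢
    linear_combination h4
  have hA1 := hA l hi1 hi2
  have hA2 := hA l.swap hi2 (by rwa [Sum.swap_swap])
  rw [Sum.swap_swap, add_comm (Pi.single l.swap 1) (Pi.single l 1), ← hA1] at hA2
  -- the bracket of `x_l^(2) x_{l'}` with `x_{l'}^(2)`
  have hb := DH_cubic_mon (F := F) (n := n) hn (j := l)
    (a := Pi.single l 1 + Pi.single l.swap 2)
    (by
      intro q
      have := hle q
      simp only [Pi.add_apply, Pi.single_apply]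
      split_ifs with e1 e2 <;> first | omega | (subst e1; exact absurd e2.symm (swap_ne _)))
    (by simp)
  rw [add_tsub_cancel_left] at hb
  have h4 := congrArg (fun u => hcoeff F 3 n (Pi.single l.swap 1) (D u))
    (lie_hmon (F := F) (hcub l) (pure_ne_tau hn l.swap 2))
  simp only [LieDerivation.apply_lie_eq_add, map_add, hb, map_smul] at h4
  rw [hquad (Pi.single l.swap 2) (by rw [sum_single]), lie_zero, map_zero, zero_add, ← lie_skew,
    map_neg, hcoeff_lie_square hr hn, if_pos rfl, Sum.swap_swap, sgn_swap_cast] at h4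
  simp only [Pi.add_apply, Pi.single_eq_same, Pi.single_eq_of_ne (swap_ne l),
    Pi.single_eq_of_ne (swap_ne l).symm, smul_eq_mul] at h4
  apply mul_left_cancel₀ (sgn_ne_zero (F := F) l)
  push_cast at h4
  unfold hmon at h4 hA2 ⊢
  rw [hA2] at h4
  linear_combination -h4

end Negative

end Hamiltonian

/-! ### Induction on the degree -/

namespace Hamiltonian

open DivPow

section Induction

variable {F : Type*} [Field F] [CharP F 3] {r : ℕ} {n : Fin r ⊕ Fin r → ℕ}
  {D : LieDerivation F (H2 F 3 n) (H2 F 3 n)}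

theorem act_nFrob_of_sum_le (hn : ∀ i, 1 ≤ n i) (i : Fin r ⊕ Fin r) {k : ℕ} (hk : 1 ≤ k)
    {a : Fin r ⊕ Fin r → ℕ} (ha : ∑ i, a i ≤ 3) : act F 3 n (nFrob F n i k) (hmon F n a) = 0 := by
  by_cases ht : a = tau 3 n
  · rw [ht, hmon, ham_mon_tau, map_zero]
  apply eq_zero_of_hcoeff hn
  intro c hc
  have h3 : 3 ≤ 3 ^ k := Nat.le_self_pow (by omega) 3
  have h2 : ∑ i, c i ≠ 0 := fun h0 => hc (funext fun i =>
    Finset.sum_eq_zero_iff.1 h0 i (Finset.mem_univ i))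
  rw [hcoeff_act_nFrob hn i k hc ht, coeff_mon_of_ne]
  rintro rfl
  rw [sum_add, sum_single] at ha
  omega

theorem hcoeff_act_nFrob_pure (hn : ∀ i, 1 ≤ n i) (q q' : Σ i, Fin (n i - 1)) :
    hcoeff F 3 n (Pi.single q.1 1)
      (act F 3 n (nFrob F n q'.1 (q'.2 + 1)) (hmon F n (Pi.single q.1 (3 ^ (q.2 + 1 : ℕ) + 1)))) =
      if q = q' then 1 else 0 := by
  rw [hcoeff_act_nFrob hn _ _ (single_ne_zero _) (pure_ne_tau hn _ _)]
  split_ifs with h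
  · subst h
    rw [← Pi.single_add, add_comm, coeff_mon_self]
    intro i
    by_cases hi : i = q.1
    · subst hi
      rw [Pi.single_eq_same]
      have h1 : 3 ^ (q.2 + 1 : ℕ) * 3 ≤ 3 ^ n q.1 := by
        rw [← pow_succ]
        exact Nat.pow_le_pow_right (by omega) (by have := q.2.2; omega)
      have : 0 < 3 ^ (q.2 + 1 : ℕ) := by positivity
      omega
    · rw [Pi.single_eq_of_ne hi]
      positivity
  · rw [coeff_mon_of_ne]
    intro e
    obtain ⟨i, k⟩ := q
    obtain ⟨i', k'⟩ := q'
    have h1 := congrFun e i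
    simp only [Pi.add_apply, Pi.single_eq_same] at h1
    by_cases hi : i = i'
    · subst hi
      rw [Pi.single_eq_same] at h1
      have h2 : 3 ^ (k' + 1 : ℕ) = 3 ^ (k + 1 : ℕ) := by omega
      have h3 := Nat.pow_right_injective (le_refl 2 |>.trans (by omega : 2 ≤ 3)) h2
      exact h (by rw [show k = k' from Fin.ext (by omega)])
    · rw [Pi.single_eq_of_ne hi] at h1
      have : 0 < 3 ^ (k + 1 : ℕ) := by positivity
      omega

/-- After subtraction of a known derivation, a derivation kills the torus and its value at each
`x_i^(3 ^ k + 1)` has no `x_i`-term. -/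
theorem exists_normalized (hr : 0 < r) (hn : ∀ i, 1 ≤ n i)
    (D : LieDerivation F (H2 F 3 n) (H2 F 3 n)) :
    ∃ δ ∈ known F n, KillsTorus (D - act F 3 n δ) ∧ ∀ q : Σ i, Fin (n i - 1),
      hcoeff F 3 n (Pi.single q.1 1) ((D - act F 3 n δ)
        (hmon F n (Pi.single q.1 (3 ^ (q.2 + 1 : ℕ) + 1)))) = 0 := by
  obtain ⟨δ, hδ, hD⟩ := exists_killsTorus hr hn D
  generalize hD' : D - act F 3 n δ = D' at hD
  let s : (H2 F 3 n).normalizer := ∑ q : Σ i, Fin (n i - 1),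
    hcoeff F 3 n (Pi.single q.1 1) (D' (hmon F n (Pi.single q.1 (3 ^ (q.2 + 1 : ℕ) + 1)))) •
      nFrob F n q.1 (q.2 + 1)
  have hs : ∀ u, act F 3 n s u = ∑ q : Σ i, Fin (n i - 1),
      hcoeff F 3 n (Pi.single q.1 1) (D' (hmon F n (Pi.single q.1 (3 ^ (q.2 + 1 : ℕ) + 1)))) •
        act F 3 n (nFrob F n q.1 (q.2 + 1)) u := by
    intro u
    simp only [s, map_sum, map_smul]
    rw [← LieDerivation.coeFnAddMonoidHom_apply, map_sum, Finset.sum_apply]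
    rfl
  have hs0 : ∀ a : Fin r ⊕ Fin r → ℕ, ∑ i, a i ≤ 3 → act F 3 n s (hmon F n a) = 0 := by
    intro a ha
    rw [hs]
    refine Finset.sum_eq_zero fun q _ => ?_
    rw [act_nFrob_of_sum_le hn _ (by omega) ha, smul_zero]
  refine ⟨δ + s, Submodule.add_mem _ hδ (Submodule.sum_mem _ fun q _ =>
    Submodule.smul_mem _ _ (nFrob_mem_known q)), ⟨fun j => ?_, fun k => ?_⟩, fun q => ?_⟩
  · rw [map_add, ← sub_sub, hD', LieDerivation.sub_apply, hD.var, hs0, sub_zero]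
    rw [sum_single]
    omega
  · rw [map_add, ← sub_sub, hD', LieDerivation.sub_apply, hD.torus, hs0, sub_zero]
    rw [sum_add, sum_single, sum_single]
    omega
  · rw [map_add, ← sub_sub, hD', LieDerivation.sub_apply, hs, map_sub, map_sum,
      Finset.sum_eq_single q]
    · rw [map_smul, hcoeff_act_nFrob_pure hn, if_pos rfl, smul_eq_mul, mul_one, sub_self]
    · intro q' _ hq
      rw [map_smul, hcoeff_act_nFrob_pure hn, if_neg hq.symm, smul_zero]
    · simp

theorem apply_ham_DH_eq_zero {a b : Fin r ⊕ Fin r → ℕ} (ha : a ≠ tau 3 n) (hb : b ≠ tau 3 n)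
    (hDa : D (hmon F n a) = 0) (hDb : D (hmon F n b) = 0) :
    D (ham F 3 n (DH F 3 n (mon F 3 n a) (mon F 3 n b))) = 0 := by
  rw [← lie_hmon ha hb, LieDerivation.apply_lie_eq_add, hDa, hDb, lie_zero, zero_lie, add_zero]

theorem natCast_ne_zero {a : ℕ} (h : a % 3 ≠ 0) : (a : F) ≠ 0 := by
  rw [← Nat.cast_zero, Ne, natCast_eq_iff]
  simpa using h

theorem sum_sub_single {a : Fin r ⊕ Fin r → ℕ} {j : Fin r ⊕ Fin r} {k : ℕ} (h : k ≤ a j) :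
    ∑ i, (a - Pi.single j k : Fin r ⊕ Fin r → ℕ) i + k = ∑ i, a i := by
  have e : (a - Pi.single j k + Pi.single j k : Fin r ⊕ Fin r → ℕ) = a := by
    funext i
    by_cases hi : i = j
    · subst hi
      simp [Nat.sub_add_cancel h]
    · simp [hi]
  conv_rhs => rw [← e]
  rw [sum_add, sum_single]

/-- Reduction of `x^(a)` to smaller degrees: it is a multiple of the bracket of `x_j^(k + 1)` with
`x^(a - k ε_j + ε_{j'})`. -/
theorem eq_zero_of_pure (hn : ∀ i, 1 ≤ n i) {a : Fin r ⊕ Fin r → ℕ}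
    (hlow : ∀ b : Fin r ⊕ Fin r → ℕ, ∑ i, b i < ∑ i, a i → D (hmon F n b) = 0)
    {j : Fin r ⊕ Fin r} {k : ℕ} (hD : D (hmon F n (Pi.single j (k + 1))) = 0) (hk : 2 ≤ k)
    (hka : k ≤ a j) (haj : a j < 3 ^ n j) (haj' : a j.swap + 1 < 3 ^ n j.swap)
    (hk' : k + 1 < 3 ^ n j) (hc : (a j).choose k % 3 ≠ 0) : D (hmon F n a) = 0 := by
  have hw : (a - Pi.single j k + Pi.single j.swap 1 : Fin r ⊕ Fin r → ℕ) ≠ tau 3 n := by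
    intro h
    have h1 := congrFun h j
    simp only [Pi.add_apply, Pi.sub_apply, Pi.single_eq_same, Pi.single_eq_of_ne (swap_ne j).symm,
      tau] at h1
    omega
  have h := apply_ham_DH_eq_zero (pure_ne_tau hn j (k + 1)) hw hD (hlow _ ?_)
  · rw [DH_mon_single_mon hk' hka haj', map_smul, map_smul] at h
    exact (smul_eq_zero.1 h).resolve_left (mul_ne_zero (sgn_ne_zero j) (natCast_ne_zero hc))
  · have := sum_sub_single hka
    rw [sum_add, sum_single]
    omega

/-- Reduction of `x^(a)` to a smaller degree: it is a multiple of the bracket of `x_j^(2) x_{j'}`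
with `x^(a - ε_j)`, by the factor `a_j (a_j + a_{j'} - 1)`. -/
theorem eq_zero_of_cubic (hr : 0 < r) (hn : ∀ i, 1 ≤ n i) {a : Fin r ⊕ Fin r → ℕ}
    (hlow : ∀ b : Fin r ⊕ Fin r → ℕ, ∑ i, b i < ∑ i, a i → D (hmon F n b) = 0)
    (ha : ∀ i, a i < 3 ^ n i) {j : Fin r ⊕ Fin r}
    (hD : D (hmon F n (Pi.single j.swap 1 + Pi.single j 2)) = 0) (hj : a j % 3 ≠ 0)
    (hj' : (a j + a j.swap) % 3 ≠ 1) : D (hmon F n a) = 0 := by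
  have h1 : 1 ≤ a j := by omega
  have hw : (a - Pi.single j 1 : Fin r ⊕ Fin r → ℕ) ≠ tau 3 n := by
    intro h
    have h1 := congrFun h j
    have := ha j
    simp only [Pi.sub_apply, Pi.single_eq_same, tau] at h1
    omega
  have h := apply_ham_DH_eq_zero
    (ne_tau_of_sum_le hr hn (by rw [sum_add, sum_single, sum_single])) hw hD (hlow _ ?_)
  · rw [DH_cubic_mon hn ha h1, map_smul, map_smul] at h
    refine (smul_eq_zero.1 h).resolve_left (mul_ne_zero (sgn_ne_zero j)
      (mul_ne_zero (natCast_ne_zero hj) fun h' => ?_))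
    have : ((a j + a j.swap : ℕ) : F) = (1 : ℕ) := by
      push_cast
      linear_combination h'
    exact hj' (natCast_eq_iff.1 this)
  · have := sum_sub_single h1
    omega

/-- By Lucas' theorem a binomial coefficient `K choose p ^ m` is the digit of `K` at `p ^ m`. -/
theorem choose_pow_mod {p : ℕ} [Fact p.Prime] (K m : ℕ) :
    K.choose (p ^ m) ≡ K / p ^ m [MOD p] := by
  have hp : 0 < p := (Fact.out : p.Prime).pos
  induction m generalizing K with
  | zero => simpa using Nat.ModEq.refl _
  | succ m ih =>
    have h := Choose.choose_modEq_choose_mod_mul_choose_div_nat (n := K) (k := p ^ (m + 1)) (p := p)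
    rw [pow_succ, Nat.mul_mod_left, Nat.choose_zero_right, one_mul, Nat.mul_div_cancel _ hp] at h
    rw [pow_succ]
    refine h.trans ((ih _).trans ?_)
    rw [Nat.div_div_eq_div_mul, mul_comm p]

/-- The pure powers: `x_i^(K)` is a bracket of elements of smaller degree unless `K` is `3 ^ m`,
which the weights exclude, or `3 ^ m + 1`, where the normalization applies. -/
theorem KillsTorus.pure (hD : KillsTorus D) (hr : 0 < r) (hn : ∀ i, 1 ≤ n i)
    (hF : ∀ q : Σ i, Fin (n i - 1),
      hcoeff F 3 n (Pi.single q.1 1) (D (hmon F n (Pi.single q.1 (3 ^ (q.2 + 1 : ℕ) + 1)))) = 0)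
    (i : Fin r ⊕ Fin r) {K : ℕ} (hK : 3 ≤ K)
    (hlow : ∀ b : Fin r ⊕ Fin r → ℕ, ∑ i, b i < K → D (hmon F n b) = 0) :
    D (hmon F n (Pi.single i K)) = 0 := by
  by_cases hlt : K < 3 ^ n i
  swap
  · rw [hmon_eq_zero (i := i) (by rw [Pi.single_eq_same]; omega), map_zero]
  have hlow' : ∀ b : Fin r ⊕ Fin r → ℕ, ∑ l, b l < ∑ l, (Pi.single i K : Fin r ⊕ Fin r → ℕ) l →
      D (hmon F n b) = 0 := by
    rwa [sum_single]
  have hm0 : Nat.log 3 K ≠ 0 := (Nat.log_pos (by omega) hK).ne'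
  have hm1 : 3 ^ Nat.log 3 K ≤ K := Nat.pow_log_le_self 3 (by omega)
  have hm2 : K < 3 ^ Nat.log 3 K * 3 := by
    rw [← pow_succ]
    exact Nat.lt_pow_succ_log_self (by omega) K
  -- with `3 ^ m` the leading power of `3` in `K`, the coefficient `K choose (K - 3 ^ m)` of the
  -- bracket with `x_i^(K - 3 ^ m + 1)` is the leading digit of `K`
  generalize Nat.log 3 K = m at hm0 hm1 hm2
  have hm3 : 3 ^ m % 3 = 0 := Nat.mod_eq_zero_of_dvd (dvd_pow_self 3 hm0)
  by_cases hk : 2 ≤ K - 3 ^ m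
  · refine eq_zero_of_pure hn hlow' (j := i) (k := K - 3 ^ m) (hlow _ ?_) hk ?_ ?_ ?_ ?_ ?_
    · rw [sum_single]
      omega
    · rw [Pi.single_eq_same]
      omega
    · rwa [Pi.single_eq_same]
    · rw [Pi.single_eq_of_ne (swap_ne i), zero_add]
      exact one_lt_pow_of_pos (hn _)
    · omega
    · rw [Pi.single_eq_same, Nat.choose_symm hm1]
      have h1 : K.choose (3 ^ m) % 3 = (K / 3 ^ m) % 3 := choose_pow_mod K m
      have h2 : 1 ≤ K / 3 ^ m := (Nat.one_le_div_iff (by positivity)).2 hm1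
      have h3 : K / 3 ^ m < 3 := Nat.div_lt_of_lt_mul hm2
      omega
  · refine hD.eq_zero hr hn hlow' fun l hl _ => ?_
    by_cases hli : l = i
    · subst hli
      rw [Pi.single_eq_same, Pi.single_eq_of_ne (swap_ne l)] at hl
      have hKm : K = 3 ^ m + 1 := by omega
      have hmn : m < n l := by
        rw [← Nat.pow_lt_pow_iff_right (a := 3) (by omega)]
        omega
      have := hF ⟨l, m - 1, by omega⟩
      simp only at this
      rwa [Nat.sub_add_cancel (by omega), ← hKm] at this
    · exfalso
      rw [Pi.single_eq_of_ne hli] at hl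
      by_cases hli' : l.swap = i
      · rw [← hli', Pi.single_eq_same] at hl
        omega
      · rw [Pi.single_eq_of_ne hli'] at hl
        omega

theorem eq_single_of_forall {a : Fin r ⊕ Fin r → ℕ} {j : Fin r ⊕ Fin r}
    (h : ∀ i, i ≠ j → a i = 0) : a = Pi.single j (a j) := by
  funext i
  by_cases hi : i = j
  · rw [hi, Pi.single_eq_same]
  · rw [h i hi, Pi.single_eq_of_ne hi]

theorem three_dvd_pow (hn : ∀ i, 1 ≤ n i) (i : Fin r ⊕ Fin r) : 3 ^ n i % 3 = 0 :=
  Nat.mod_eq_zero_of_dvd (dvd_pow_self 3 (by have := hn i; omega))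

/-- The inductive step for `r = 1`: every monomial in both variables other than `x^(τ)` is a bracket
with a pure power. -/
theorem eq_zero_of_rank_one (hn : ∀ i, 2 ≤ n i) (hr : ∀ i j : Fin r ⊕ Fin r, i = j ∨ i = j.swap)
    {a : Fin r ⊕ Fin r → ℕ} (ha : ∀ i, a i < 3 ^ n i) (hτ : a ≠ tau 3 n) (h3 : 3 ≤ ∑ i, a i)
    (hlow : ∀ b : Fin r ⊕ Fin r → ℕ, ∑ i, b i < ∑ i, a i → D (hmon F n b) = 0)
    (hpure : ∀ i K, K ≤ ∑ i, a i → D (hmon F n (Pi.single i K)) = 0) : D (hmon F n a) = 0 := by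
  have hn1 : ∀ i, 1 ≤ n i := fun i => by have := hn i; omega
  by_cases hp : ∃ j : Fin r ⊕ Fin r, a j.swap = 0
  · obtain ⟨j, hj⟩ := hp
    rw [eq_single_of_forall (a := a) (j := j) fun i hi => by rwa [(hr i j).resolve_left hi]]
    refine hpure j _ ?_
    exact Finset.single_le_sum (f := a) (fun i _ => Nat.zero_le _) (Finset.mem_univ j)
  push Not at hp
  have hsum : ∀ i : Fin r ⊕ Fin r, a i + a i.swap ≤ ∑ k, a k := fun i => by
    have := add_le_sum a (swap_ne i)
    omega
  have hpos : ∀ i, a i ≠ 0 := fun i => by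
    have := hp i.swap
    rwa [Sum.swap_swap] at this
  obtain ⟨j, hj1, hj2⟩ : ∃ j : Fin r ⊕ Fin r, 2 ≤ a j ∧ a j.swap + 1 < 3 ^ n j.swap := by
    by_contra hno
    push Not at hno
    apply hτ
    have h9 : ∀ i, 9 ≤ 3 ^ n i := fun i => Nat.pow_le_pow_right (n := 3) (by omega) (hn i)
    have h2 : ∀ i : Fin r ⊕ Fin r, 2 ≤ a i → a i.swap = tau 3 n i.swap := fun i hi => by
      have h4 := hno i hi
      have h5 := ha i.swap
      simp only [tau]
      omega
    have key : ∀ i, 2 ≤ a i → a = tau 3 n := by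
      intro i hi
      have h4 := h2 i hi
      have h5 := h2 i.swap (by rw [h4]; have := h9 i.swap; simp only [tau]; omega)
      rw [Sum.swap_swap] at h5
      funext k
      rcases hr k i with rfl | rfl
      · exact h5
      · exact h4
    obtain ⟨i, hi⟩ : ∃ i, 2 ≤ a i := by
      by_contra hno2
      push Not at hno2
      obtain ⟨i, _⟩ : ∃ i, a i ≠ 0 := Function.ne_iff.1 (ne_zero_of_sum (by omega))
      have h4 : ∑ k, a k = ∑ k ∈ {i, i.swap}, a k := by
        symm
        apply Finset.sum_subset (Finset.subset_univ _)
        intro k _ hk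
        rw [Finset.mem_insert, Finset.mem_singleton] at hk
        exact absurd (hr k i) hk
      rw [Finset.sum_pair (swap_ne i).symm] at h4
      have := hno2 i
      have := hno2 i.swap
      omega
    exact key i hi
  have haj := ha j
  have h9 : 9 ≤ 3 ^ n j := Nat.pow_le_pow_right (n := 3) (by omega) (hn j)
  have h4 := hsum j
  have h5 := hpos j.swap
  by_cases hlt : a j + 1 < 3 ^ n j
  · exact eq_zero_of_pure hn1 hlow (hpure j _ (by omega)) hj1 le_rfl haj hj2 hlt (by simp)
  · -- `x_j^(a_j + 1)` is out of range, so the next smaller power is used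
    refine eq_zero_of_pure hn1 hlow (j := j) (k := a j - 1) (hpure j _ (by omega)) (by omega)
      (by omega) haj hj2 (by omega) ?_
    have := three_dvd_pow hn1 j
    obtain ⟨x, hx⟩ : ∃ x, a j = x + 1 := ⟨a j - 1, by omega⟩
    rw [hx, Nat.add_sub_cancel, Nat.choose_succ_self_right]
    omega

/-- The inductive step for `r > 1`: unless a bracket with some `x_j^(2) x_{j'}` applies, either a
bracket with some `x_i x_l` or one with a pure power does. -/
theorem KillsTorus.eq_zero_of_rank_gt (hD : KillsTorus D) (hr : 1 < r) (hn : ∀ i, 1 ≤ n i)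
    {a : Fin r ⊕ Fin r → ℕ} (ha : ∀ i, a i < 3 ^ n i) (h3 : 3 ≤ ∑ i, a i)
    (hlow : ∀ b : Fin r ⊕ Fin r → ℕ, ∑ i, b i < ∑ i, a i → D (hmon F n b) = 0)
    (hpure : ∀ i K, K ≤ ∑ i, a i → D (hmon F n (Pi.single i K)) = 0) : D (hmon F n a) = 0 := by
  have hr0 : 0 < r := by omega
  refine hD.eq_zero hr0 hn hlow fun l hl hk => ?_
  suffices h : D (hmon F n a) = 0 by rw [h, map_zero]
  by_cases hcub : ∃ j : Fin r ⊕ Fin r, a j % 3 ≠ 0 ∧ (a j + a j.swap) % 3 ≠ 1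
  · obtain ⟨j, hj1, hj2⟩ := hcub
    exact eq_zero_of_cubic hr0 hn hlow ha (hD.cubic hr hn j) hj1 hj2
  push Not at hcub
  -- now `a` is `(1, 0)` at the pair of `l` and `(0, 0)` or `(2, 2)` at the other pairs, modulo `3`
  have h1 : a l % 3 = 1 ∧ a l.swap % 3 = 0 := by
    have h4 := hcub l
    have h5 := hcub l.swap
    rw [Sum.swap_swap] at h5
    omega
  have h2 : ∀ k, k ≠ l → k ≠ l.swap → a k % 3 = 0 ∨ a k % 3 = 2 := by
    intro k hk1 hk2
    have h4 := hcub k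
    have h5 := hk k hk1 hk2
    omega
  have hdvd := three_dvd_pow hn
  -- a pair `(2, 2)` allows the bracket with `x_i x_l`; without one, some exponent is a positive
  -- multiple of `3` or exceeds one by `1`, and the bracket with a pure power applies
  by_cases htwo : ∃ i, i ≠ l ∧ i ≠ l.swap ∧ a i % 3 = 2
  · obtain ⟨i, hi1, hi2, hi3⟩ := htwo
    have hi4 := hk i hi1 hi2
    have hi1' : i.swap ≠ l.swap := fun e => hi1 (Sum.swap_leftInverse.injective e)
    have hi2' : i.swap ≠ l := fun e => hi2 (by rw [← e, Sum.swap_swap])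
    obtain ⟨b, rfl⟩ := exists_eq_add_single (show a i ≠ 0 by omega)
    obtain ⟨d, rfl⟩ := exists_eq_add_single (show b i.swap ≠ 0 by
      have e : (b + Pi.single i 1 : Fin r ⊕ Fin r → ℕ) i.swap = b i.swap := by
        simp [swap_ne i]
      rw [e] at hi4
      omega)
    have hs : ∀ k, k ≠ i → k ≠ i.swap →
        (d + Pi.single i.swap 1 + Pi.single i 1 : Fin r ⊕ Fin r → ℕ) k = d k := fun k h4 h5 => by
      simp [h4, h5]
    have ei : (d + Pi.single i.swap 1 + Pi.single i 1 : Fin r ⊕ Fin r → ℕ) i = d i + 1 := by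
      simp [(swap_ne i).symm]
    have ei' : (d + Pi.single i.swap 1 + Pi.single i 1 : Fin r ⊕ Fin r → ℕ) i.swap =
        d i.swap + 1 := by
      simp [swap_ne i]
    have el := hs l hi1.symm hi2'.symm
    have el' := hs l.swap hi2.symm hi1'.symm
    rw [ei] at hi3 hi4
    rw [ei'] at hi4
    rw [el, el'] at h1
    have ha' : ∀ k, d k < 3 ^ n k := fun k => (Nat.le_add_right _ _).trans_lt
      ((Nat.le_add_right _ _).trans_lt (ha k))
    have hai := ha i
    have hai' := ha i.swap
    rw [ei] at hai
    rw [ei'] at hai'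
    have hal := ha' l
    have hal' := ha' l.swap
    have hdl := hdvd l
    have hdl' := hdvd l.swap
    have hsum : ∑ k, (d + Pi.single i.swap 1 + Pi.single i 1 : Fin r ⊕ Fin r → ℕ) k =
        ∑ k, d k + 1 + 1 := by
      rw [sum_add, sum_add, sum_single, sum_single]
    rw [hsum] at hlow
    have hw1 : D (hmon F n (d + Pi.single i.swap 1 + Pi.single l.swap 1)) = 0 := by
      refine eq_zero_of_cubic hr0 hn (j := i) ?_ (fun k => ?_) (hD.cubic hr hn i) ?_ ?_
      · rwa [sum_add, sum_add, sum_single, sum_single]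
      · have := ha' k
        simp only [Pi.add_apply, Pi.single_apply]
        split_ifs with e1 e2 e2 <;> first | omega | (subst e1; omega) | (subst e2; omega)
      · simp only [Pi.add_apply, Pi.single_eq_of_ne (swap_ne i).symm, Pi.single_eq_of_ne hi2]
        omega
      · simp only [Pi.add_apply, Pi.single_eq_of_ne (swap_ne i).symm, Pi.single_eq_of_ne hi2,
          Pi.single_eq_same, Pi.single_eq_of_ne hi1']
        omega
    have hw2 : D (hmon F n (d + Pi.single l.swap 1 + Pi.single l 1)) = 0 := by
      refine eq_zero_of_cubic hr0 hn (j := l) ?_ (fun k => ?_) (hD.cubic hr hn l) ?_ ?_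
      · rwa [sum_add, sum_add, sum_single, sum_single]
      · have := ha' k
        simp only [Pi.add_apply, Pi.single_apply]
        split_ifs with e1 e2 e2
        · exact absurd (e1.symm.trans e2) (swap_ne l)
        · subst e1; omega
        · subst e2; omega
        · omega
      · simp only [Pi.add_apply, Pi.single_eq_of_ne (swap_ne l).symm, Pi.single_eq_same]
        omega
      · simp only [Pi.add_apply, Pi.single_eq_of_ne (swap_ne l).symm, Pi.single_eq_same,
          Pi.single_eq_of_ne (swap_ne l)]
        omega
    have hwt : (d + Pi.single i.swap 1 + Pi.single l.swap 1 : Fin r ⊕ Fin r → ℕ) ≠ tau 3 n := by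
      intro e
      have := congrFun e i
      simp only [Pi.add_apply, Pi.single_eq_of_ne (swap_ne i).symm, Pi.single_eq_of_ne hi2,
        tau] at this
      omega
    have h := apply_ham_DH_eq_zero (torus_ne_tau hr0 hn i l) hwt (hD.mul_eq_zero hr0 hn hi1 hi2) hw1
    rw [DH_mul_mon hn hi1 hi2 (by omega) (by omega), map_add, map_smul, map_smul, map_add, map_smul,
      map_smul] at h
    unfold hmon at hw2
    rw [hw2, smul_zero, add_zero] at h
    refine (smul_eq_zero.1 h).resolve_left (mul_ne_zero (sgn_ne_zero _) ?_)
    have : ((d i + 1 : ℕ) : F) ≠ 0 := natCast_ne_zero (by omega)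
    exact_mod_cast this
  · push Not at htwo
    have hmod : ∀ k, a k % 3 ≠ 2 := by
      intro k
      by_cases hk1 : k = l
      · rw [hk1]; omega
      · by_cases hk2 : k = l.swap
        · rw [hk2]; omega
        · exact htwo k hk1 hk2
    obtain ⟨j, hj⟩ : ∃ j, 3 ≤ a j := by
      by_contra hno
      push Not at hno
      have e := eq_single_of_forall (a := a) (j := l) fun k hkl => by
        have h4 := hno k
        by_cases hkl' : k = l.swap
        · rw [hkl'] at h4 ⊢
          omega
        · have h5 := h2 k hkl hkl'
          have h6 := hmod k
          omega
      rw [e, sum_single] at h3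
      have := hno l
      omega
    have hj1 := ha j
    have hj2 := ha j.swap
    have hj3 := hmod j
    have hj4 := hmod j.swap
    have hj5 := hdvd j
    have hj6 := hdvd j.swap
    by_cases hp : ∀ i, i ≠ j → a i = 0
    · rw [eq_single_of_forall hp]
      exact hpure j _ (Finset.single_le_sum (f := a) (fun i _ => Nat.zero_le _) (Finset.mem_univ j))
    · push Not at hp
      obtain ⟨i, hij, hi⟩ := hp
      have := add_le_sum a hij
      exact eq_zero_of_pure hn hlow (hpure j (a j + 1) (by omega)) (by omega) le_rfl hj1
        (by omega) (by omega) (by simp)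

theorem KillsTorus.eq_zero_of_normalized (hD : KillsTorus D) (hr : 0 < r) (hn : ∀ i, 1 ≤ n i)
    (hcase : 1 < r ∨ ∀ i, 2 ≤ n i)
    (hF : ∀ q : Σ i, Fin (n i - 1),
      hcoeff F 3 n (Pi.single q.1 1) (D (hmon F n (Pi.single q.1 (3 ^ (q.2 + 1 : ℕ) + 1)))) = 0) :
    D = 0 := by
  have key : ∀ N, ∀ a : Fin r ⊕ Fin r → ℕ, ∑ i, a i = N → D (hmon F n a) = 0 := by
    intro N
    induction N using Nat.strong_induction_on with
    | _ N ih =>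
      intro a haN
      have hlow : ∀ b : Fin r ⊕ Fin r → ℕ, ∑ i, b i < N → D (hmon F n b) = 0 :=
        fun b hb => ih _ hb b rfl
      by_cases h2 : N ≤ 2
      · exact hD.eq_zero_of_sum_le_two hr hn hcase (haN.trans_le h2)
      by_cases ht : a = tau 3 n
      · rw [ht, hmon, ham_mon_tau, map_zero]
      by_cases ha : ∀ i, a i < 3 ^ n i
      swap
      · push Not at ha
        obtain ⟨i, hi⟩ := ha
        rw [hmon_eq_zero hi, map_zero]
      have hpure : ∀ i K, K ≤ N → D (hmon F n (Pi.single i K)) = 0 := by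
        intro i K hK
        by_cases hK2 : K ≤ 2
        · exact hD.eq_zero_of_sum_le_two hr hn hcase (by rwa [sum_single])
        · exact hD.pure hr hn hF i (by omega) fun b hb => hlow b (hb.trans_le hK)
      subst haN
      by_cases h1r : 1 < r
      · exact hD.eq_zero_of_rank_gt h1r hn ha (by omega) hlow hpure
      · obtain rfl : r = 1 := by omega
        refine eq_zero_of_rank_one (hcase.resolve_left h1r) ?_ ha ht (by omega) hlow hpure
        rintro (i | i) (j | j) <;> simp [Subsingleton.elim i j]
  ext u : 1
  have hu : u ∈ (⊤ : Submodule F (H2 F 3 n)) := trivial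
  rw [← span_ham] at hu
  induction hu using Submodule.span_induction with
  | zero => rw [map_zero, map_zero]
  | add u v _ _ hu hv => rw [map_add, map_add, hu, hv]
  | smul t u _ hu => rw [map_smul, map_smul, hu]
  | mem u hu =>
    obtain ⟨a, _, _, _, rfl⟩ := hu
    exact key _ a rfl

/-- Every derivation of `H(2r; n)^(2)` is a combination of the known ones. -/
theorem exists_eq_act (hr : 0 < r) (hn : ∀ i, 1 ≤ n i) (hcase : 1 < r ∨ ∀ i, 2 ≤ n i)
    (D : LieDerivation F (H2 F 3 n) (H2 F 3 n)) : ∃ δ ∈ known F n, D = act F 3 n δ := by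
  obtain ⟨δ, hδ, hD, hF⟩ := exists_normalized hr hn D
  exact ⟨δ, hδ, sub_eq_zero.1 (hD.eq_zero_of_normalized hr hn hcase hF)⟩

end Induction

end Hamiltonian

/-! ### The outer derivation algebra: a basis -/

namespace Hamiltonian

open DivPow

section Independence

variable {F : Type*} [Field F] [CharP F 3] {r : ℕ} {n : Fin r ⊕ Fin r → ℕ}

theorem act_sum_smul_apply {κ : Type*} [Fintype κ] (t : κ → F) (δ : κ → (H2 F 3 n).normalizer)
    (u : H2 F 3 n) : act F 3 n (∑ q, t q • δ q) u = ∑ q, t q • act F 3 n (δ q) u := by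
  simp only [map_sum, map_smul]
  rw [← LieDerivation.coeFnAddMonoidHom_apply, map_sum, Finset.sum_apply]
  rfl

theorem act_outer_apply (w : Param F n) (u : H2 F 3 n) : act F 3 n (outer F n w) u =
    w.1 • act F 3 n (nEuler F n) u + (w.2.1 • act F 3 n (nDH F n (mon F 3 n (tau 3 n))) u +
      (∑ i, w.2.2.1 i • act F 3 n (nSing F n i) u +
        ∑ q, w.2.2.2 q • act F 3 n (nFrob F n q.1 (q.2 + 1)) u)) := by
  rw [outer_apply]
  simp only [map_add, map_smul, LieDerivation.add_apply, LieDerivation.smul_apply]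
  rw [act_sum_smul_apply, act_sum_smul_apply]

variable (F n) in
/-- The class of an element of the normalizer in the outer derivation algebra. -/
def outerClass : (H2 F 3 n).normalizer →ₗ⁅F⁆ OuterDer F (H2 F 3 n) where
  toLinearMap := ((LieDerivation.ad F (H2 F 3 n)).idealRange.toSubmodule.mkQ) ∘ₗ
    (act F 3 n : (H2 F 3 n).normalizer →ₗ[F] _)
  map_lie' {δ ε} := by
    change LieSubmodule.Quotient.mk (act F 3 n ⁅δ, ε⁆) = _
    rw [LieHom.map_lie]
    rfl

theorem outerClass_eq_zero_iff {δ : (H2 F 3 n).normalizer} : outerClass F n δ = 0 ↔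
    ∃ u, LieDerivation.ad F (H2 F 3 n) u = act F 3 n δ :=
  (Submodule.Quotient.mk_eq_zero _).trans LieDerivation.mem_ad_idealRange_iff

theorem outerClass_eq_zero {δ : (H2 F 3 n).normalizer}
    (h : (δ : Derivation F (DivPow F 3 n) (DivPow F 3 n)) ∈ H2 F 3 n) : outerClass F n δ = 0 :=
  outerClass_eq_zero_iff.2 ⟨_, ((H2 F 3 n).normalizerAd_eq_ad h).symm⟩

/-- The outer derivations with given parameters fill the outer derivation algebra. -/
theorem outerClass_outer_surjective (hr : 0 < r) (hn : ∀ i, 1 ≤ n i)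
    (hcase : 1 < r ∨ ∀ i, 2 ≤ n i) : Function.Surjective fun w => outerClass F n (outer F n w) := by
  intro x
  obtain ⟨D, rfl⟩ := LieSubmodule.Quotient.surjective_mk' _ x
  obtain ⟨δ, hδ, rfl⟩ := exists_eq_act hr hn hcase D
  obtain ⟨_, ⟨w, rfl⟩, ε, hε, rfl⟩ := Submodule.mem_sup.1 hδ
  refine ⟨w, ?_⟩
  change _ = outerClass F n (outer F n w + ε)
  rw [map_add, outerClass_eq_zero hε, add_zero]

/-- The action on a variable of a combination of outer derivations minus an inner one. -/
theorem hcoeff_act_outer_var (hr : 0 < r) (hn : ∀ i, 1 ≤ n i) (w : Param F n)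
    (f : DivPow F 3 n) (j : Fin r ⊕ Fin r) {c : Fin r ⊕ Fin r → ℕ} (hc : c ≠ 0) :
    hcoeff F 3 n c (act F 3 n (outer F n w - nDH F n f) (hmon F n (Pi.single j.swap 1))) =
      -(w.1 * hcoeff F 3 n c (hmon F n (Pi.single j.swap 1))) +
        sgn j * coeff F 3 n (c + Pi.single j 1) (w.2.1 • mon F 3 n (tau 3 n) - f) +
        w.2.2.1 j * hcoeff F 3 n c (hmon F n (Pi.single j (tau 3 n j))) := by
  have h1 : ∑ i, w.2.2.1 i • act F 3 n (nSing F n i) (hmon F n (Pi.single j.swap 1)) =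
      w.2.2.1 j • hmon F n (Pi.single j (tau 3 n j)) := by
    simp only [act_nSing_var hr hn, smul_ite, smul_zero]
    simp
  have h2 : ∑ q : Σ i, Fin (n i - 1), w.2.2.2 q •
      act F 3 n (nFrob F n q.1 (q.2 + 1)) (hmon F n (Pi.single j.swap 1)) = 0 := by
    refine Finset.sum_eq_zero fun q _ => ?_
    rw [act_nFrob_of_sum_le hn _ (by omega) (by rw [sum_single]; omega), smul_zero]
  rw [map_sub, LieDerivation.sub_apply, act_outer_apply, h1, h2, act_nEuler_hmon, sum_single]
  simp only [map_sub, map_add, map_smul, smul_eq_mul, hcoeff_act_nDH_var hr hn _ _ hc,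
    Sum.swap_swap, sgn_swap_cast, map_zero]
  push_cast
  ring

/-- No nonzero combination of the outer derivations is inner. -/
theorem eq_zero_of_act_outer_eq (hr : 0 < r) (hn : ∀ i, 1 ≤ n i) {w : Param F n}
    {f : DivPow F 3 n} (hf : coeff F 3 n (tau 3 n) f = 0)
    (h : act F 3 n (outer F n w - nDH F n f) = 0) : w = 0 := by
  have hvar : ∀ (j : Fin r ⊕ Fin r) (c : Fin r ⊕ Fin r → ℕ), c ≠ 0 →
      -(w.1 * hcoeff F 3 n c (hmon F n (Pi.single j.swap 1))) +
        sgn j * coeff F 3 n (c + Pi.single j 1) (w.2.1 • mon F 3 n (tau 3 n) - f) +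
        w.2.2.1 j * hcoeff F 3 n c (hmon F n (Pi.single j (tau 3 n j))) = 0 := by
    intro j c hc
    rw [← hcoeff_act_outer_var hr hn w f j hc, h, LieDerivation.zero_apply, map_zero]
  have h3 : ∀ i, 3 ≤ 3 ^ n i := fun i => three_le_pow (hn i)
  have hτ : ∀ i, tau 3 n i + 1 = 3 ^ n i := fun i => by
    have := h3 i
    simp only [tau]
    omega
  -- the coefficient of `D_H(x^(τ))`
  have hX : w.2.1 = 0 := by
    let j : Fin r ⊕ Fin r := Sum.inl ⟨0, hr⟩
    obtain ⟨c, hc⟩ := exists_eq_add_single (c := tau 3 n) (j := j)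
      (by have := h3 j; have := hτ j; omega)
    have hcj' : c j.swap = tau 3 n j.swap := by
      rw [hc, Pi.add_apply, Pi.single_eq_of_ne (swap_ne j), add_zero]
    have h4 := hτ j.swap
    have h5 := h3 j.swap
    have hc0 : c ≠ 0 := fun h0 => by rw [h0, Pi.zero_apply] at hcj'; omega
    have h6 := hvar j c hc0
    rw [hcoeff_hmon_of_ne hn hc0, hcoeff_hmon_of_ne hn hc0, ← hc, map_sub, map_smul, hf,
      coeff_mon_self tau_lt] at h6
    · simpa [sgn_ne_zero] using h6
    · rintro rfl
      rw [Pi.single_eq_of_ne (swap_ne j)] at hcj'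
      omega
    · rintro rfl
      rw [Pi.single_eq_same] at hcj'
      omega
  -- the coefficients of the `x_j^(τ_j) ∂_{j'}`, since `x_j^(τ_j)` is not a `∂_j`-derivative
  have hA : w.2.2.1 = 0 := by
    funext j
    have h4 := hτ j
    have h5 := h3 j
    have hc0 : (Pi.single j (tau 3 n j) : Fin r ⊕ Fin r → ℕ) ≠ 0 := fun h0 => by
      have := congrFun h0 j
      rw [Pi.single_eq_same, Pi.zero_apply] at this
      omega
    have h6 := hvar j (Pi.single j (tau 3 n j)) hc0
    rw [hcoeff_hmon_of_ne hn hc0, hcoeff_hmon_self hn hc0 (pure_ne_tau hn _ _),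
      coeff_eq_zero (i := j)] at h6
    · simpa using h6
    · simp only [Pi.add_apply, Pi.single_eq_same]
      omega
    · intro i
      by_cases hi : i = j
      · rw [hi, Pi.single_eq_same]
        exact tau_lt j
      · rw [Pi.single_eq_of_ne hi]
        have := h3 i
        omega
    · intro e
      have := congrFun e j
      rw [Pi.single_eq_same, Pi.single_eq_of_ne (swap_ne j).symm] at this
      omega
  -- the coefficient of the Euler derivation, whose linear part is not symplectic
  have hE : w.1 = 0 := by
    have key : ∀ j : Fin r ⊕ Fin r, -w.1 + sgn j * coeff F 3 n
        (Pi.single j.swap 1 + Pi.single j 1) (w.2.1 • mon F 3 n (tau 3 n) - f) = 0 := by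
      intro j
      have h6 := hvar j _ (single_ne_zero j.swap)
      rwa [hA, Pi.zero_apply, zero_mul, add_zero,
        hcoeff_hmon_self hn (single_ne_zero _) (single_ne_tau hr hn _) (single_lt hn _),
        mul_one] at h6
    have h6 := key (Sum.inl ⟨0, hr⟩)
    have h7 := key (Sum.inl ⟨0, hr⟩ : Fin r ⊕ Fin r).swap
    rw [Sum.swap_swap, add_comm (Pi.single _ _), sgn_swap_cast] at h7
    linear_combination h6 + h7 + w.1 * three_eq_zero (F := F)
  -- the coefficients of the `∂_i ^ (3 ^ k)`, detected at `x_i^(3 ^ k + 1)`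
  have hP : w.2.2.2 = 0 := by
    funext q
    have h4 : 1 < 3 ^ (q.2 + 1 : ℕ) := Nat.one_lt_pow (by omega) (by omega)
    have h5 : 3 ^ (q.2 + 1 : ℕ) + 1 < 3 ^ n q.1 := by
      have h1 : 3 ^ (q.2 + 1 : ℕ) * 3 ≤ 3 ^ n q.1 := by
        rw [← pow_succ]
        exact Nat.pow_le_pow_right (by omega) (by have := q.2.2; omega)
      omega
    have h6 := congrArg (fun D => hcoeff F 3 n (Pi.single q.1 1)
      (D (hmon F n (Pi.single q.1 (3 ^ (q.2 + 1 : ℕ) + 1))))) h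
    simp only [map_sub, LieDerivation.sub_apply, act_outer_apply, hX, hA, hE, zero_smul,
      Pi.zero_apply, Finset.sum_const_zero, zero_add, map_sum, map_smul, hcoeff_act_nFrob_pure hn,
      LieDerivation.zero_apply, map_zero, act_nDH_hmon _ (pure_ne_tau hn _ _)] at h6
    rw [hcoeff_ham hn (single_ne_zero _) (coeff_tau_DH _ _), DH_apply_antisymm,
      DH_mon_single_apply _ h5, map_neg, map_smul,
      coeff_mon_single_mul_of_lt (by simp [h4])] at h6
    simpa using h6
  ext : 1
  · exact hE
  · ext : 1
    · exact hX
    · ext : 1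
      · exact hA
      · exact hP

theorem outerClass_outer_injective (hr : 0 < r) (hn : ∀ i, 1 ≤ n i) :
    Function.Injective (((outerClass F n : _ →ₗ[F] OuterDer F (H2 F 3 n))) ∘ₗ outer F n) := by
  rw [← LinearMap.ker_eq_bot, LinearMap.ker_eq_bot']
  intro w hw
  obtain ⟨u, hu⟩ := outerClass_eq_zero_iff.1 hw
  refine eq_zero_of_act_outer_eq hr hn (coeff_tau_pot u) ?_
  have h : (nDH F n (pot F 3 n u) : Derivation F (DivPow F 3 n) (DivPow F 3 n)) = u := by
    conv_rhs => rw [← ham_pot u, coe_ham_of_coeff (coeff_tau_pot u)]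
    rfl
  have h' : (nDH F n (pot F 3 n u) : Derivation F (DivPow F 3 n) (DivPow F 3 n)) ∈ H2 F 3 n := h ▸ u.2
  rw [map_sub, ← hu, act, LieSubalgebra.normalizerAd_eq_ad _ h', sub_eq_zero]
  congr 1
  exact Subtype.ext h.symm

variable (F n) in
/-- The outer derivation algebra in coordinates; for `r = 1` this needs `2 ≤ n_i`. -/
noncomputable def outerEquiv (hr : 0 < r) (hn : ∀ i, 1 ≤ n i) (hcase : 1 < r ∨ ∀ i, 2 ≤ n i) :
    Param F n ≃ₗ[F] OuterDer F (H2 F 3 n) :=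
  LinearEquiv.ofBijective _
    ⟨outerClass_outer_injective hr hn, outerClass_outer_surjective hr hn hcase⟩

end Independence

end Hamiltonian

/-! ### Brackets of the outer derivations -/

namespace Hamiltonian

open DivPow

section Brackets

variable {F : Type*} [Field F] [CharP F 3] {r : ℕ} {n : Fin r ⊕ Fin r → ℕ}

theorem outerClass_lie_eq_zero {δ ε : (H2 F 3 n).normalizer}
    (h : ⁅(δ : Derivation F (DivPow F 3 n) (DivPow F 3 n)), (ε : Derivation F _ _)⁆ ∈ H2 F 3 n) :
    ⁅outerClass F n δ, outerClass F n ε⁆ = 0 := by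
  rw [← LieHom.map_lie]
  exact outerClass_eq_zero h

theorem natCast_tau (hn : ∀ i, 1 ≤ n i) (i : Fin r ⊕ Fin r) : (tau 3 n i : F) = -1 := by
  have h : tau 3 n i + 1 = 3 ^ n i := by
    have := three_le_pow (hn i)
    simp only [tau]
    omega
  have h0 : ((3 ^ n i : ℕ) : F) = 0 := by
    rw [← Nat.cast_zero, natCast_eq_iff, three_dvd_pow hn]
  rw [← h, Nat.cast_add, Nat.cast_one] at h0
  linear_combination h0

theorem lie_euler_class (hn : ∀ i, 1 ≤ n i) :
    ⁅outerClass F n (nEuler F n), outerClass F n (nDH F n (mon F 3 n (tau 3 n)))⁆ =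
      (r + 1 : F) • outerClass F n (nDH F n (mon F 3 n (tau 3 n))) := by
  rw [← LieHom.map_lie, ← map_smul]
  congr 1
  apply Subtype.ext
  change ⁅euler F 3 n, DH F 3 n _⁆ = (r + 1 : F) • DH F 3 n _
  rw [lie_euler_DH, euler_mon, ← add_smul, map_smul]
  congr 1
  rw [Nat.cast_sum, Finset.sum_congr rfl fun i _ => natCast_tau hn i, Finset.sum_const,
    Finset.card_univ, Fintype.card_sum, Fintype.card_fin, nsmul_eq_mul]
  push_cast
  linear_combination (-(r : F) - 1) * three_eq_zero (F := F)

theorem lie_euler_sing_class (hn : ∀ i, 1 ≤ n i) (i : Fin r ⊕ Fin r) :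
    ⁅outerClass F n (nEuler F n), outerClass F n (nSing F n i)⁆ = outerClass F n (nSing F n i) := by
  rw [← LieHom.map_lie]
  congr 1
  apply Subtype.ext
  change ⁅euler F 3 n, sing F 3 n i⁆ = sing F 3 n i
  rw [sing, lie_smul_derivation, lie_euler_pderiv, euler_mon, sum_single, natCast_tau hn, smul_neg,
    neg_smul, one_smul, neg_smul]
  have h : (3 : F) • (mon F 3 n (Pi.single i (tau 3 n i)) • pderiv F 3 n i.swap) = 0 := by
    rw [three_eq_zero, zero_smul]
  rw [← sub_eq_zero, ← neg_eq_zero, ← h, show (3 : F) = 1 + 1 + 1 by norm_num, add_smul, add_smul,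
    one_smul]
  abel

theorem lie_euler_frob_class (i : Fin r ⊕ Fin r) (k : ℕ) :
    ⁅outerClass F n (nEuler F n), outerClass F n (nFrob F n i (k + 1))⁆ = 0 := by
  apply outerClass_lie_eq_zero
  convert (H2 F 3 n).zero_mem
  change ⁅euler F 3 n, (pderiv F 3 n i).frob 3 (k + 1)⁆ = 0
  ext f : 1
  refine ext_coeff fun c _ => ?_
  rw [Derivation.commutator_apply, map_sub, coeff_euler, Derivation.frob_apply,
    Derivation.frob_apply, coeff_iterate_pderiv, coeff_iterate_pderiv, coeff_euler, sum_add,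
    sum_single, Derivation.zero_apply, map_zero]
  push_cast
  rw [pow_succ]
  linear_combination -3 ^ k * coeff F 3 n (c + Pi.single i (3 ^ k * 3)) f * three_eq_zero (F := F)

theorem lie_DH_sing_class (h : DivPow F 3 n) (i : Fin r ⊕ Fin r) :
    ⁅outerClass F n (nDH F n h), outerClass F n (nSing F n i)⁆ = 0 := by
  rw [← lie_skew, neg_eq_zero]
  apply outerClass_lie_eq_zero
  change ⁅sing F 3 n i, DH F 3 n h⁆ ∈ _
  rw [lie_sing_DH, zero_smul, add_zero]
  exact DH_mem_H2 (coeff_tau_sing i h)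

theorem lie_DH_frob_class (h : DivPow F 3 n) (i : Fin r ⊕ Fin r) (k : ℕ) :
    ⁅outerClass F n (nDH F n h), outerClass F n (nFrob F n i k)⁆ = 0 := by
  rw [← lie_skew, neg_eq_zero]
  apply outerClass_lie_eq_zero
  change ⁅(pderiv F 3 n i).frob 3 k, DH F 3 n h⁆ ∈ _
  rw [lie_frob_DH, zero_smul, add_zero]
  exact DH_mem_H2 (coeff_tau_frob i k h)

theorem lie_sing_frob_class (i j : Fin r ⊕ Fin r) (hn : ∀ i, 1 ≤ n i) {k : ℕ} (hk : k < n j) :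
    ⁅outerClass F n (nSing F n i), outerClass F n (nFrob F n j k)⁆ = 0 := by
  rw [← lie_skew, neg_eq_zero]
  apply outerClass_lie_eq_zero
  change ⁅(pderiv F 3 n j).frob 3 k, sing F 3 n i⁆ ∈ _
  rw [sing, lie_smul_derivation, lie_frob_pderiv, smul_zero, add_zero, Derivation.frob_apply]
  have h0 : 0 < 3 ^ k := by positivity
  by_cases hij : j = i
  · subst hij
    have h1 : 3 ^ k < 3 ^ n j := Nat.pow_lt_pow_right (by norm_num) hk
    have h2 : tau 3 n j + 1 = 3 ^ n j := by simp only [tau]; omega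
    have e : (pderiv F 3 n j)^[3 ^ k] (mon F 3 n (Pi.single j (tau 3 n j))) =
        mon F 3 n (Pi.single j (tau 3 n j - 3 ^ k)) := by
      refine ext_coeff fun c hc => ?_
      have e : (Pi.single j (tau 3 n j) : Fin r ⊕ Fin r → ℕ) =
          Pi.single j (tau 3 n j - 3 ^ k) + Pi.single j (3 ^ k) := by
        rw [← Pi.single_add, Nat.sub_add_cancel (by omega)]
      rw [coeff_iterate_pderiv, e]
      by_cases hcj : c = Pi.single j (tau 3 n j - 3 ^ k)
      · rw [hcj, coeff_mon_self, coeff_mon_self]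
        · rwa [← hcj]
        · intro i
          rw [← e]
          by_cases hi : i = j
          · rw [hi, Pi.single_eq_same]
            exact tau_lt j
          · rw [Pi.single_eq_of_ne hi]
            positivity
      · rw [coeff_mon_of_ne hcj, coeff_mon_of_ne]
        exact fun h' => hcj (add_right_cancel h')
    have h3 := DH_mon_single (F := F) (p := 3) (n := n) j (k := tau 3 n j - 3 ^ k) (by omega)
    have h4 : mon F 3 n (Pi.single j (tau 3 n j - 3 ^ k)) • pderiv F 3 n j.swap =
        (sgn j : F) • DH F 3 n (mon F 3 n (Pi.single j (tau 3 n j - 3 ^ k + 1))) := by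
      rw [h3, smul_smul, sgn_mul_self, one_smul]
    rw [e, h4]
    exact (H2 F 3 n).smul_mem _ (DH_mem_H2 (coeff_tau_mon (pure_ne_tau hn _ _)))
  · convert (H2 F 3 n).zero_mem
    refine (congrArg (· • pderiv F 3 n i.swap) (?_ : _ = (0 : DivPow F 3 n))).trans (zero_smul _ _)
    refine ext_coeff fun c _ => ?_
    rw [coeff_iterate_pderiv, map_zero, coeff_mon_of_ne]
    intro h
    have := congrFun h j
    rw [Pi.add_apply, Pi.single_eq_same, Pi.single_eq_of_ne hij] at this
    omega

theorem lie_frob_frob_class (i j : Fin r ⊕ Fin r) (k l : ℕ) :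
    ⁅outerClass F n (nFrob F n i k), outerClass F n (nFrob F n j l)⁆ = 0 := by
  apply outerClass_lie_eq_zero
  convert (H2 F 3 n).zero_mem
  change ⁅(pderiv F 3 n i).frob 3 k, (pderiv F 3 n j).frob 3 l⁆ = 0
  ext f : 1
  refine ext_coeff fun c _ => ?_
  rw [Derivation.commutator_apply, map_sub]
  simp only [Derivation.frob_apply, coeff_iterate_pderiv]
  rw [add_right_comm, sub_self]
  exact (map_zero _).symm

theorem lie_sing_sing_of_ne {i j : Fin r ⊕ Fin r} (h : j ≠ i.swap) :
    ⁅sing F 3 n i, sing F 3 n j⁆ = 0 := by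
  have h' : i ≠ j.swap := fun e => h (by rw [e, Sum.swap_swap])
  have e : ∀ {i j : Fin r ⊕ Fin r}, j ≠ i.swap →
      pderiv F 3 n i.swap (mon F 3 n (Pi.single j (tau 3 n j))) = 0 := fun h =>
    pderiv_mon_eq_zero _ (Pi.single_eq_of_ne h.symm _)
  rw [sing, sing, lie_smul_derivation, smul_lie_derivation, lie_pderiv, smul_zero, zero_sub,
    e h', zero_smul, neg_zero, smul_zero, add_zero, Derivation.smul_apply, e h, smul_zero,
    zero_smul]

/-- The Hamiltonian derivation of `x_i^(τ_i) x_{i'}^(τ_{i'})` is up to sign a commutator of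
derivations whose potentials are out of range. -/
theorem lie_sing_sing_swap (hn : ∀ i, 1 ≤ n i) (i : Fin r ⊕ Fin r) :
    ⁅sing F 3 n i, sing F 3 n i.swap⁆ = (-sgn i : F) •
      DH F 3 n (mon F 3 n (Pi.single i (tau 3 n i) + Pi.single i.swap (tau 3 n i.swap))) := by
  have h1 : ∀ i : Fin r ⊕ Fin r, DH F 3 n (mon F 3 n (Pi.single i (tau 3 n i))) =
      (sgn i : F) • (pderiv F 3 n i (mon F 3 n (Pi.single i (tau 3 n i))) • pderiv F 3 n i.swap) := by
    intro i
    have h2 : tau 3 n i + 1 = 3 ^ n i := by have := three_le_pow (hn i); simp only [tau]; omega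
    obtain ⟨k, hk⟩ : ∃ k, tau 3 n i = k + 1 :=
      ⟨tau 3 n i - 1, by have := three_le_pow (hn i); omega⟩
    have h3 : pderiv F 3 n i (mon F 3 n (Pi.single i (k + 1))) = mon F 3 n (Pi.single i k) := by
      rw [Pi.single_add, pderiv_mon_add _ (by rw [Pi.single_eq_same]; omega)]
    rw [hk, DH_mon_single i (by omega), h3]
  ext g : 1
  rw [mon_add_single _ _ (Pi.single_eq_of_ne (swap_ne i) _), Derivation.smul_apply, DH_mul_apply,
    h1, h1, sgn_swap_cast, Sum.swap_swap]
  rw [sing, sing, lie_smul_derivation, smul_lie_derivation, lie_pderiv, Sum.swap_swap]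
  simp only [Derivation.smul_apply, Derivation.add_apply, smul_eq_mul, smul_zero, zero_sub,
    Derivation.neg_apply, smul_add, smul_neg, mul_smul_comm, smul_smul, sgn_mul_self, neg_mul,
    mul_neg, neg_smul, one_smul]
  ring

/-- For `r > 1` the derivations `x_i^(τ_i) ∂_{i'}` commute modulo inner ones. -/
theorem lie_sing_sing_class_of_rank_gt (hr : 1 < r) (hn : ∀ i, 1 ≤ n i) (i j : Fin r ⊕ Fin r) :
    ⁅outerClass F n (nSing F n i), outerClass F n (nSing F n j)⁆ = 0 := by
  apply outerClass_lie_eq_zero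
  change ⁅sing F 3 n i, sing F 3 n j⁆ ∈ _
  by_cases h : j = i.swap
  · rw [h, lie_sing_sing_swap hn]
    obtain ⟨k, hk1, hk2⟩ := exists_ne_pair hr i
    refine (H2 F 3 n).smul_mem _ (DH_mem_H2 (coeff_tau_mon fun e => ?_))
    have h1 := congrFun e k
    rw [Pi.add_apply, Pi.single_eq_of_ne hk1, Pi.single_eq_of_ne hk2] at h1
    have := three_le_pow (hn k)
    simp only [tau] at h1
    omega
  · rw [lie_sing_sing_of_ne h]
    exact (H2 F 3 n).zero_mem

/-- For `r = 1` the derivations `x_i^(τ_i) ∂_{i'}` generate a Heisenberg algebra with centre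
`D_H(x^(τ))`. -/
theorem lie_sing_sing_class_of_rank_one (hr : r = 1) (hn : ∀ i, 1 ≤ n i) (i : Fin r ⊕ Fin r) :
    ⁅outerClass F n (nSing F n i), outerClass F n (nSing F n i.swap)⁆ =
      (-sgn i : F) • outerClass F n (nDH F n (mon F 3 n (tau 3 n))) := by
  subst hr
  rw [← LieHom.map_lie, ← map_smul]
  congr 1
  apply Subtype.ext
  change ⁅sing F 3 n i, sing F 3 n i.swap⁆ = (-sgn i : F) • DH F 3 n _
  rw [lie_sing_sing_swap hn]
  congr 3
  funext k
  by_cases hk : k = i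
  · subst hk
    simp [(swap_ne k).symm]
  · obtain rfl : k = i.swap := by
      revert hk
      rcases i with i | i <;> rcases k with k | k <;> simp [Subsingleton.elim i k]
    simp [hk]

end Brackets

end Hamiltonian

namespace Hamiltonian

section OuterBracket

variable {F : Type*} [Field F] [CharP F 3] {r : ℕ} {n : Fin r ⊕ Fin r → ℕ}

/-- The bracket of the outer derivation algebra in coordinates (a bilinear map on parameters),
where `c` describes the brackets of the derivations `x_i^(τ_i) ∂_{i'}`. -/
def paramBracket (c : Fin r ⊕ Fin r → Fin r ⊕ Fin r → F) (w w' : Param F n) : Param F n :=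
  (0, (r + 1) * (w.1 * w'.2.1 - w'.1 * w.2.1) + ∑ i, ∑ j, w.2.2.1 i * w'.2.2.1 j * c i j,
    w.1 • w'.2.2.1 - w'.1 • w.2.2.1, 0)

theorem lie_linearCombination {L : Type*} [LieRing L] [LieAlgebra F L] {e x : L}
    {a : Fin r ⊕ Fin r → L} {p : (Σ i, Fin (n i - 1)) → L} {c : Fin r ⊕ Fin r → Fin r ⊕ Fin r → F}
    (hex : ⁅e, x⁆ = (r + 1 : F) • x) (hea : ∀ i, ⁅e, a i⁆ = a i) (hep : ∀ q, ⁅e, p q⁆ = 0)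
    (hxa : ∀ i, ⁅x, a i⁆ = 0) (hxp : ∀ q, ⁅x, p q⁆ = 0) (haa : ∀ i j, ⁅a i, a j⁆ = c i j • x)
    (hap : ∀ i q, ⁅a i, p q⁆ = 0) (hpp : ∀ q q', ⁅p q, p q'⁆ = 0) (w w' : Param F n) :
    ⁅w.1 • e + (w.2.1 • x + (∑ i, w.2.2.1 i • a i + ∑ q, w.2.2.2 q • p q)),
      w'.1 • e + (w'.2.1 • x + (∑ i, w'.2.2.1 i • a i + ∑ q, w'.2.2.2 q • p q))⁆ =
    (paramBracket c w w').1 • e + ((paramBracket c w w').2.1 • x +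
      (∑ i, (paramBracket c w w').2.2.1 i • a i + ∑ q, (paramBracket c w w').2.2.2 q • p q)) := by
  have h0 : ∀ {y : L}, (∀ i, ⁅y, a i⁆ = 0) → ∀ A : Fin r ⊕ Fin r → F, ⁅y, ∑ i, A i • a i⁆ = 0 := by
    intro y h A
    simp only [lie_sum, lie_smul, h, smul_zero, Finset.sum_const_zero]
  have h0' : ∀ {y : L}, (∀ q, ⁅y, p q⁆ = 0) → ∀ P : (Σ i, Fin (n i - 1)) → F,
      ⁅y, ∑ q, P q • p q⁆ = 0 := by
    intro y h P
    simp only [lie_sum, lie_smul, h, smul_zero, Finset.sum_const_zero]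
  have swap : ∀ {y z : L}, ⁅y, z⁆ = 0 → ⁅z, y⁆ = 0 := fun h => by rw [← lie_skew, h, neg_zero]
  have h1 : ⁅∑ i, w.2.2.1 i • a i, ∑ j, w'.2.2.1 j • a j⁆ =
      (∑ i, ∑ j, w.2.2.1 i * w'.2.2.1 j * c i j) • x := by
    rw [sum_lie, Finset.sum_smul]
    refine Finset.sum_congr rfl fun i _ => ?_
    rw [lie_sum, Finset.sum_smul]
    refine Finset.sum_congr rfl fun j _ => ?_
    rw [lie_smul, smul_lie, haa, smul_smul, smul_smul, mul_comm (w'.2.2.1 j)]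
  have h2 : ∀ A : Fin r ⊕ Fin r → F, ⁅e, ∑ i, A i • a i⁆ = ∑ i, A i • a i := fun A => by
    simp only [lie_sum, lie_smul, hea]
  have h4 : ∑ i, (paramBracket c w w').2.2.1 i • a i =
      w.1 • ∑ i, w'.2.2.1 i • a i - w'.1 • ∑ i, w.2.2.1 i • a i := by
    simp only [paramBracket, Pi.sub_apply, Pi.smul_apply, smul_eq_mul, sub_smul, mul_smul,
      Finset.sum_sub_distrib, Finset.smul_sum]
  have h5 : ∑ q, (paramBracket c w w').2.2.2 q • p q = 0 := by
    simp only [paramBracket, Pi.zero_apply, zero_smul, Finset.sum_const_zero]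
  have hA := h2 w.2.2.1
  have hA' := h2 w'.2.2.1
  have hxA := h0 hxa w.2.2.1
  have hxA' := h0 hxa w'.2.2.1
  have hP := h0' hep w.2.2.2
  have hP' := h0' hep w'.2.2.2
  have hxP := h0' hxp w.2.2.2
  have hxP' := h0' hxp w'.2.2.2
  have hAP' := h0' (fun q => swap (h0 (fun i => swap (hap i q)) w.2.2.1)) w'.2.2.2
  have hA'P := h0' (fun q => swap (h0 (fun i => swap (hap i q)) w'.2.2.1)) w.2.2.2
  have hPP' := h0' (fun q => swap (h0' (fun q' => hpp q q') w.2.2.2)) w'.2.2.2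
  rw [h4, h5]
  generalize ∑ i, w.2.2.1 i • a i = A at *
  generalize ∑ i, w'.2.2.1 i • a i = A' at *
  generalize ∑ q, w.2.2.2 q • p q = P at *
  generalize ∑ q, w'.2.2.2 q • p q = P' at *
  have hAe : ⁅A, e⁆ = -A := by rw [← lie_skew, hA]
  have hxe : ⁅x, e⁆ = -((r + 1 : F) • x) := by rw [← lie_skew, hex]
  simp only [lie_add, add_lie, lie_smul, smul_lie, lie_self, hex, hxe, hA', hAe, hP', swap hP, hxA',
    swap hxA, hxP', swap hxP, hAP', swap hA'P, hPP', h1, smul_zero, add_zero, zero_add]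
  simp only [paramBracket]
  module

theorem lie_outerClass_outer (hn : ∀ i, 1 ≤ n i) {c : Fin r ⊕ Fin r → Fin r ⊕ Fin r → F}
    (hc : ∀ i j, ⁅outerClass F n (nSing F n i), outerClass F n (nSing F n j)⁆ =
      c i j • outerClass F n (nDH F n (DivPow.mon F 3 n (tau 3 n)))) (w w' : Param F n) :
    ⁅outerClass F n (outer F n w), outerClass F n (outer F n w')⁆ =
      outerClass F n (outer F n (paramBracket c w w')) := by
  have h : ∀ w : Param F n, outerClass F n (outer F n w) =
      w.1 • outerClass F n (nEuler F n) +
        (w.2.1 • outerClass F n (nDH F n (DivPow.mon F 3 n (tau 3 n))) +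
          (∑ i, w.2.2.1 i • outerClass F n (nSing F n i) +
            ∑ q, w.2.2.2 q • outerClass F n (nFrob F n q.1 (q.2 + 1)))) := fun w => by
    simp only [outer_apply, map_add, map_smul, map_sum]
  rw [h, h, h]
  exact lie_linearCombination (lie_euler_class hn) (lie_euler_sing_class hn)
    (fun q => lie_euler_frob_class _ _) (lie_DH_sing_class _) (fun q => lie_DH_frob_class _ _ _) hc
    (fun i q => lie_sing_frob_class _ _ hn (by have := q.2.2; omega))
    (fun q q' => lie_frob_frob_class _ _ _ _) w w'

/-- The structure constants of the `x_i^(τ_i) ∂_{i'}` for `r = 1`. -/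
def heisCoeff (F : Type*) [Field F] {r : ℕ} (i j : Fin r ⊕ Fin r) : F :=
  if j = i.swap then -sgn i else 0

theorem lie_sing_sing_of_rank_gt (hr : 1 < r) (hn : ∀ i, 1 ≤ n i) (i j : Fin r ⊕ Fin r) :
    ⁅outerClass F n (nSing F n i), outerClass F n (nSing F n j)⁆ =
      (0 : Fin r ⊕ Fin r → Fin r ⊕ Fin r → F) i j •
        outerClass F n (nDH F n (DivPow.mon F 3 n (tau 3 n))) := by
  rw [lie_sing_sing_class_of_rank_gt hr hn, Pi.zero_apply, Pi.zero_apply, zero_smul]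

theorem lie_sing_sing_of_rank_one (hr : r = 1) (hn : ∀ i, 1 ≤ n i) (i j : Fin r ⊕ Fin r) :
    ⁅outerClass F n (nSing F n i), outerClass F n (nSing F n j)⁆ =
      heisCoeff F i j • outerClass F n (nDH F n (DivPow.mon F 3 n (tau 3 n))) := by
  rw [heisCoeff]
  split_ifs with h
  · rw [h, lie_sing_sing_class_of_rank_one hr hn]
  · rw [zero_smul]
    apply outerClass_lie_eq_zero
    change ⁅sing F 3 n i, sing F 3 n j⁆ ∈ _
    rw [lie_sing_sing_of_ne h]
    exact (H2 F 3 n).zero_mem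

end OuterBracket

end Hamiltonian

/-! ### Derived series -/

section DerivedSeries

open LieAlgebra

variable {F L : Type*} [CommRing F] [LieRing L] [LieAlgebra F L]

theorem LieAlgebra.derivedSeries_succ_le {J J' : Submodule F L} {k : ℕ}
    (hJ : (derivedSeries F L k).toSubmodule ≤ J) (h : ∀ u ∈ J, ∀ v ∈ J, ⁅u, v⁆ ∈ J') :
    (derivedSeries F L (k + 1)).toSubmodule ≤ J' := by
  rw [derivedSeries_def, derivedSeriesOfIdeal_succ, LieSubmodule.lieIdeal_oper_eq_linear_span',
    Submodule.span_le]
  rintro _ ⟨u, hu, v, hv, rfl⟩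
  exact h u (hJ hu) v (hJ hv)

theorem LieAlgebra.lie_mem_derivedSeries_succ {k : ℕ} {u v : L} (hu : u ∈ derivedSeries F L k)
    (hv : v ∈ derivedSeries F L k) : ⁅u, v⁆ ∈ derivedSeries F L (k + 1) := by
  rw [derivedSeries_def, derivedSeriesOfIdeal_succ]
  exact LieSubmodule.lie_mem_lie hu hv

theorem LieAlgebra.derivedLength_eq_succ {k : ℕ} {u : L} (hu : u ∈ derivedSeries F L k)
    (hu0 : u ≠ 0) (h : (derivedSeries F L (k + 1)).toSubmodule ≤ ⊥) :
    IsSolvable L ∧ derivedLength F L = k + 1 := by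
  have h' : derivedSeries F L (k + 1) = ⊥ := (LieSubmodule.toSubmodule_eq_bot _).1 (le_bot_iff.1 h)
  refine ⟨.mk h', (derivedSeries_of_derivedLength_succ F L _ _).2
    ⟨(abelian_iff_derived_succ_eq_bot _ _).2 h', fun h0 => hu0 ?_⟩⟩
  rw [derivedSeries_def, h0] at hu
  exact (LieSubmodule.mem_bot _).1 hu

end DerivedSeries

namespace Hamiltonian

section Structure

variable {F : Type*} [Field F] [CharP F 3] {r : ℕ} {n : Fin r ⊕ Fin r → ℕ}

/-- The first derived algebra has no Euler component, so it is abelian. -/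
theorem derivedLength_eq_two (hr : 0 < r) {L : Type*} [LieRing L] [LieAlgebra F L]
    (ψ : Param F n ≃ₗ[F] L) (hψ : ∀ w w', ⁅ψ w, ψ w'⁆ = ψ (paramBracket 0 w w')) :
    LieAlgebra.IsSolvable L ∧ LieAlgebra.derivedLength F L = 2 := by
  let i : Fin r ⊕ Fin r := Sum.inl ⟨0, by omega⟩
  have hb : paramBracket 0 (1, 0, 0, 0) ((0, 0, Pi.single i 1, 0) : Param F n) =
      (0, 0, Pi.single i 1, 0) := by simp [paramBracket]
  refine LieAlgebra.derivedLength_eq_succ (k := 1) (u := ψ (0, 0, Pi.single i 1, 0)) ?_ ?_ ?_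
  · rw [← hb, ← hψ]
    exact LieAlgebra.lie_mem_derivedSeries_succ (k := 0) trivial trivial
  · intro h
    have := (LinearEquiv.map_eq_zero_iff ψ).1 h
    simpa using congrFun (congrArg (fun w => w.2.2.1) this) i
  · refine LieAlgebra.derivedSeries_succ_le (J := LinearMap.ker
      (LinearMap.fst F _ _ ∘ₗ (ψ.symm : L →ₗ[F] Param F n))) ?_ ?_
    · refine LieAlgebra.derivedSeries_succ_le (k := 0) (J := ⊤) le_top fun u _ v _ => ?_
      obtain ⟨w, rfl⟩ := ψ.surjective u
      obtain ⟨w', rfl⟩ := ψ.surjective v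
      rw [hψ]
      simp [paramBracket]
    · intro u hu v hv
      obtain ⟨w, rfl⟩ := ψ.surjective u
      obtain ⟨w', rfl⟩ := ψ.surjective v
      have h1 : w.1 = 0 := by simpa using hu
      have h2 : w'.1 = 0 := by simpa using hv
      rw [hψ]
      simp [paramBracket, h1, h2]

/-- The first derived algebra has no Euler component, and the second one is spanned by the class of
`D_H(x^(τ))`. -/
theorem derivedLength_eq_three {n : Fin 1 ⊕ Fin 1 → ℕ} {L : Type*} [LieRing L] [LieAlgebra F L]
    (ψ : Param F n ≃ₗ[F] L) (hψ : ∀ w w', ⁅ψ w, ψ w'⁆ = ψ (paramBracket (heisCoeff F) w w')) :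
    LieAlgebra.IsSolvable L ∧ LieAlgebra.derivedLength F L = 3 := by
  have hb : ∀ i, paramBracket (heisCoeff F) (1, 0, 0, 0) ((0, 0, Pi.single i 1, 0) : Param F n) =
      (0, 0, Pi.single i 1, 0) := fun i => by simp [paramBracket]
  have hb' : paramBracket (heisCoeff F) (0, 0, Pi.single (Sum.inl 0) 1, 0)
      ((0, 0, Pi.single (Sum.inr 0) 1, 0) : Param F n) = (0, -1, 0, 0) := by
    simp [paramBracket, heisCoeff, sgn]
  have h1 : ∀ i, ψ (0, 0, Pi.single i 1, 0) ∈ LieAlgebra.derivedSeries F L 1 := fun i => by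
    rw [← hb, ← hψ]
    exact LieAlgebra.lie_mem_derivedSeries_succ (k := 0) trivial trivial
  refine LieAlgebra.derivedLength_eq_succ (k := 2) (u := ψ (0, -1, 0, 0)) ?_ ?_ ?_
  · rw [← hb', ← hψ]
    exact LieAlgebra.lie_mem_derivedSeries_succ (h1 _) (h1 _)
  · intro h
    have := (LinearEquiv.map_eq_zero_iff ψ).1 h
    simpa using congrArg (fun w => w.2.1) this
  · refine LieAlgebra.derivedSeries_succ_le (J := Submodule.span F {ψ (0, 1, 0, 0)}) ?_ ?_
    · refine LieAlgebra.derivedSeries_succ_le (J := LinearMap.ker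
        (LinearMap.fst F _ _ ∘ₗ (ψ.symm : L →ₗ[F] Param F n))) ?_ ?_
      · refine LieAlgebra.derivedSeries_succ_le (k := 0) (J := ⊤) le_top fun u _ v _ => ?_
        obtain ⟨w, rfl⟩ := ψ.surjective u
        obtain ⟨w', rfl⟩ := ψ.surjective v
        rw [hψ]
        simp [paramBracket]
      · intro u hu v hv
        obtain ⟨w, rfl⟩ := ψ.surjective u
        obtain ⟨w', rfl⟩ := ψ.surjective v
        have h1 : w.1 = 0 := by simpa using hu
        have h2 : w'.1 = 0 := by simpa using hv
        rw [hψ, Submodule.mem_span_singleton]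
        refine ⟨(paramBracket (heisCoeff F) w w').2.1, ?_⟩
        rw [← map_smul]
        congr 1
        simp [paramBracket, h1, h2]
    · intro u hu v hv
      obtain ⟨s, rfl⟩ := Submodule.mem_span_singleton.1 hu
      obtain ⟨t, rfl⟩ := Submodule.mem_span_singleton.1 hv
      rw [smul_lie, lie_smul, lie_self, smul_zero, smul_zero]
      exact Submodule.zero_mem _

end Structure

end Hamiltonian

/-! ### The model Lie algebras -/

namespace Hamiltonian

section Models

variable {F : Type*} [Field F] [CharP F 3] {r : ℕ} {n : Fin r ⊕ Fin r → ℕ}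

/-- A linear isomorphism that respects brackets in coordinates is one of Lie algebras. -/
theorem nonempty_lieEquiv {L M : Type*} [LieRing L] [LieAlgebra F L] [LieRing M] [LieAlgebra F M]
    {c : Fin r ⊕ Fin r → Fin r ⊕ Fin r → F} (ψ : Param F n ≃ₗ[F] L)
    (hψ : ∀ w w', ⁅ψ w, ψ w'⁆ = ψ (paramBracket c w w')) (φ : Param F n ≃ₗ[F] M)
    (hφ : ∀ w w', φ (paramBracket c w w') = ⁅φ w, φ w'⁆) : Nonempty (L ≃ₗ⁅F⁆ M) :=
  ⟨{ ψ.symm.trans φ with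
      map_lie' := fun {u v} => by
        obtain ⟨w, rfl⟩ := ψ.surjective u
        obtain ⟨w', rfl⟩ := ψ.surjective v
        change φ (ψ.symm ⁅ψ w, ψ w'⁆) = ⁅φ (ψ.symm (ψ w)), φ (ψ.symm (ψ w'))⁆
        rw [hψ, ψ.symm_apply_apply, ψ.symm_apply_apply, ψ.symm_apply_apply, hφ] }⟩

variable (r) in
/-- The numbering `0, …, 2r - 1` of the variables. -/
def indexEquiv : Fin (2 * r) ≃ Fin r ⊕ Fin r :=
  (finCongr (two_mul r)).trans finSumFinEquiv.symm

/-- A numbering of the derivations `∂_i ^ (3 ^ k)`, `0 < k < n_i`, of which there are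
`∑ i, (n_i - 1) = |n| - 2r`. -/
noncomputable def frobIndexEquiv (hn : ∀ i, 1 ≤ n i) :
    Fin ((∑ i, n i) - 2 * r) ≃ Σ i, Fin (n i - 1) :=
  (Fintype.equivFinOfCardEq <| by
    simp only [Fintype.card_sigma, Fintype.card_fin]
    have h : ∑ i, (n i - 1) + ∑ _i : Fin r ⊕ Fin r, 1 = ∑ i, n i := by
      rw [← Finset.sum_add_distrib]
      exact Finset.sum_congr rfl fun i _ => Nat.sub_add_cancel (hn i)
    rw [Finset.sum_const, Finset.card_univ, Fintype.card_sum, Fintype.card_fin, smul_eq_mul] at h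
    omega).symm

theorem snoc_add {k : ℕ} (f g : Fin k → F) (x y : F) :
    (Fin.snoc (f + g) (x + y) : Fin (k + 1) → F) = Fin.snoc f x + Fin.snoc g y := by
  funext i
  refine Fin.lastCases ?_ (fun i => ?_) i <;> simp

theorem snoc_smul {k : ℕ} (t : F) (f : Fin k → F) (x : F) :
    (Fin.snoc (t • f) (t • x) : Fin (k + 1) → F) = t • (Fin.snoc f x : Fin (k + 1) → F) := by
  funext i
  refine Fin.lastCases ?_ (fun i => ?_) i <;> simp

variable (F) in
/-- Coordinates for which `D_H(x^(τ))` is the last basis vector of `F ^ (2r + 1)`, acted on by the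
Euler derivation. -/
noncomputable def snocModel (hn : ∀ i, 1 ≤ n i) (d : Fin (2 * r + 1) → F) : Param F n ≃ₗ[F]
    LineExt (AbelianLie.diagDer d) × AbelianLie (Fin ((∑ i, n i) - 2 * r) → F) where
  toFun w := (⟨(Fin.snoc (α := fun _ => F) (w.2.2.1 ∘ indexEquiv r) w.2.1 : Fin (2 * r + 1) → F),
    w.1⟩, (w.2.2.2 ∘ frobIndexEquiv hn : Fin ((∑ i, n i) - 2 * r) → F))
  invFun v := ((show F from v.1.right), (show Fin (2 * r + 1) → F from v.1.left) (Fin.last _),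
    (fun i => (show Fin (2 * r + 1) → F from v.1.left) ((indexEquiv r).symm i).castSucc),
    fun q => (show Fin ((∑ i, n i) - 2 * r) → F from v.2) ((frobIndexEquiv hn).symm q))
  map_add' w w' := Prod.ext (LieAlgebra.SemiDirectSum.ext
    (snoc_add (w.2.2.1 ∘ indexEquiv r) (w'.2.2.1 ∘ indexEquiv r) w.2.1 w'.2.1) rfl) rfl
  map_smul' t w := Prod.ext (LieAlgebra.SemiDirectSum.ext
    (snoc_smul t (w.2.2.1 ∘ indexEquiv r) w.2.1) rfl) rfl
  left_inv w := by
    refine Prod.ext rfl (Prod.ext ?_ (Prod.ext (funext fun i => ?_) (funext fun q => ?_)))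
    · exact Fin.snoc_last (α := fun _ => F) _ _
    · refine (Fin.snoc_castSucc (α := fun _ => F) _ _ _).trans ?_
      exact congrArg w.2.2.1 ((indexEquiv r).apply_symm_apply i)
    · exact congrArg w.2.2.2 ((frobIndexEquiv hn).apply_symm_apply q)
  right_inv v := by
    refine Prod.ext (LieAlgebra.SemiDirectSum.ext (funext fun i => ?_) rfl) (funext fun q => ?_)
    · refine Fin.lastCases ?_ (fun i => ?_) i
      · exact Fin.snoc_last (α := fun _ => F) _ _
      · refine (Fin.snoc_castSucc (α := fun _ => F) _ _ _).trans ?_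
        exact congrArg (fun i => (show Fin (2 * r + 1) → F from v.1.left) (Fin.castSucc i))
          ((indexEquiv r).symm_apply_apply i)
    · exact congrArg (show Fin ((∑ i, n i) - 2 * r) → F from v.2)
        ((frobIndexEquiv hn).symm_apply_apply q)

theorem snocModel_paramBracket (hn : ∀ i, 1 ≤ n i) {d : Fin (2 * r + 1) → F}
    (hd : ∀ i : Fin (2 * r), d i.castSucc = 1) (hd' : d (Fin.last _) = r + 1) (w w' : Param F n) :
    snocModel F hn d (paramBracket 0 w w') = ⁅snocModel F hn d w, snocModel F hn d w'⁆ := by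
  refine Prod.ext (LieAlgebra.SemiDirectSum.ext (funext fun i => ?_) rfl) rfl
  change Fin.snoc (α := fun _ => F) ((paramBracket 0 w w').2.2.1 ∘ indexEquiv r)
    (paramBracket 0 w w').2.1 i =
    0 + w.1 * (d i * Fin.snoc (α := fun _ => F) (w'.2.2.1 ∘ indexEquiv r) w'.2.1 i) -
      w'.1 * (d i * Fin.snoc (α := fun _ => F) (w.2.2.1 ∘ indexEquiv r) w.2.1 i)
  refine Fin.lastCases ?_ (fun i => ?_) i
  · rw [Fin.snoc_last, Fin.snoc_last, Fin.snoc_last, hd']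
    simp only [paramBracket, Pi.zero_apply, mul_zero, Finset.sum_const_zero]
    ring
  · rw [Fin.snoc_castSucc, Fin.snoc_castSucc, Fin.snoc_castSucc, hd]
    simp only [paramBracket, Function.comp_apply, Pi.sub_apply, Pi.smul_apply, smul_eq_mul]
    ring

variable (F) in
/-- Coordinates for which `D_H(x^(τ))` is the last basis vector of the abelian summand. -/
noncomputable def centralModel (hn : ∀ i, 1 ≤ n i) : Param F n ≃ₗ[F]
    LineExt (AbelianLie.diagDer fun _ : Fin (2 * r) => (1 : F)) ×
      AbelianLie (Fin ((∑ i, n i) - 2 * r + 1) → F) where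
  toFun w := (⟨(w.2.2.1 ∘ indexEquiv r : Fin (2 * r) → F), w.1⟩,
    (Fin.snoc (α := fun _ => F) (w.2.2.2 ∘ frobIndexEquiv hn) w.2.1 :
      Fin ((∑ i, n i) - 2 * r + 1) → F))
  invFun v := ((show F from v.1.right),
    (show Fin ((∑ i, n i) - 2 * r + 1) → F from v.2) (Fin.last _),
    (fun i => (show Fin (2 * r) → F from v.1.left) ((indexEquiv r).symm i)),
    fun q => (show Fin ((∑ i, n i) - 2 * r + 1) → F from v.2)
      ((frobIndexEquiv hn).symm q).castSucc)
  map_add' w w' := Prod.ext rfl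
    (snoc_add (w.2.2.2 ∘ frobIndexEquiv hn) (w'.2.2.2 ∘ frobIndexEquiv hn) w.2.1 w'.2.1)
  map_smul' t w := Prod.ext rfl (snoc_smul t (w.2.2.2 ∘ frobIndexEquiv hn) w.2.1)
  left_inv w := by
    refine Prod.ext rfl (Prod.ext ?_ (Prod.ext (funext fun i => ?_) (funext fun q => ?_)))
    · exact Fin.snoc_last (α := fun _ => F) _ _
    · exact congrArg w.2.2.1 ((indexEquiv r).apply_symm_apply i)
    · refine (Fin.snoc_castSucc (α := fun _ => F) _ _ _).trans ?_
      exact congrArg w.2.2.2 ((frobIndexEquiv hn).apply_symm_apply q)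
  right_inv v := by
    refine Prod.ext (LieAlgebra.SemiDirectSum.ext (funext fun i => ?_) rfl) (funext fun q => ?_)
    · exact congrArg (show Fin (2 * r) → F from v.1.left) ((indexEquiv r).symm_apply_apply i)
    · refine Fin.lastCases ?_ (fun q => ?_) q
      · exact Fin.snoc_last (α := fun _ => F) _ _
      · refine (Fin.snoc_castSucc (α := fun _ => F) _ _ _).trans ?_
        exact congrArg (fun q => (show Fin ((∑ i, n i) - 2 * r + 1) → F from v.2) (Fin.castSucc q))
          ((frobIndexEquiv hn).symm_apply_apply q)

theorem centralModel_paramBracket (hn : ∀ i, 1 ≤ n i) (hr : (r + 1 : F) = 0) (w w' : Param F n) :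
    centralModel F hn (paramBracket 0 w w') = ⁅centralModel F hn w, centralModel F hn w'⁆ := by
  refine Prod.ext (LieAlgebra.SemiDirectSum.ext (funext fun i => ?_) rfl) (funext fun q => ?_)
  · change w.1 * w'.2.2.1 (indexEquiv r i) - w'.1 * w.2.2.1 (indexEquiv r i) =
      0 + w.1 * (1 * w'.2.2.1 (indexEquiv r i)) - w'.1 * (1 * w.2.2.1 (indexEquiv r i))
    ring
  · refine Fin.lastCases ?_ (fun q => ?_) q
    · refine (Fin.snoc_last (α := fun _ => F) _ _).trans ?_
      change _ = (0 : F)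
      simp only [paramBracket, Pi.zero_apply, mul_zero, Finset.sum_const_zero, hr, zero_mul,
        add_zero]
    · exact Fin.snoc_castSucc (α := fun _ => F) _ _ _

variable (F) in
/-- Coordinates adapted to the Heisenberg algebra for `r = 1`; the bracket of
`e_1 = x_1^(τ_1) ∂_2` and `e_2 = x_2^(τ_2) ∂_1` is `e_3 = -D_H(x^(τ))`, whence the sign. -/
noncomputable def heisModel {n : Fin 1 ⊕ Fin 1 → ℕ} (hn : ∀ i, 1 ≤ n i) : Param F n ≃ₗ[F]
    LineExt (Heis.diagDer (F := F)) × AbelianLie (Fin ((∑ i, n i) - 2) → F) where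
  toFun w := (⟨(![w.2.2.1 (Sum.inl 0), w.2.2.1 (Sum.inr 0), -w.2.1] : Fin 3 → F), w.1⟩,
    (w.2.2.2 ∘ frobIndexEquiv hn : Fin ((∑ i, n i) - 2 * 1) → F))
  invFun v := ((show F from v.1.right), -(show Fin 3 → F from v.1.left) 2,
    Sum.elim (fun _ => (show Fin 3 → F from v.1.left) 0) (fun _ => (show Fin 3 → F from v.1.left) 1),
    fun q => (show Fin ((∑ i, n i) - 2 * 1) → F from v.2) ((frobIndexEquiv hn).symm q))
  map_add' w w' :=
    Prod.ext (LieAlgebra.SemiDirectSum.ext (Heis.ext' rfl rfl (neg_add _ _)) rfl) rfl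
  map_smul' t w :=
    Prod.ext (LieAlgebra.SemiDirectSum.ext (Heis.ext' rfl rfl (mul_neg _ _).symm) rfl) rfl
  left_inv w := by
    refine Prod.ext rfl (Prod.ext (neg_neg _) (Prod.ext (funext fun i => ?_) (funext fun q => ?_)))
    · rcases i with i | i
      · exact congrArg (fun i => w.2.2.1 (Sum.inl i)) (Subsingleton.elim 0 i)
      · exact congrArg (fun i => w.2.2.1 (Sum.inr i)) (Subsingleton.elim 0 i)
    · exact congrArg w.2.2.2 ((frobIndexEquiv hn).apply_symm_apply q)
  right_inv v := by
    refine Prod.ext (LieAlgebra.SemiDirectSum.ext (Heis.ext' rfl rfl (neg_neg _)) rfl)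
      (funext fun q => ?_)
    exact congrArg (show Fin ((∑ i, n i) - 2 * 1) → F from v.2)
      ((frobIndexEquiv hn).symm_apply_apply q)

theorem heisModel_paramBracket {n : Fin 1 ⊕ Fin 1 → ℕ} (hn : ∀ i, 1 ≤ n i) (w w' : Param F n) :
    heisModel F hn (paramBracket (heisCoeff F) w w') = ⁅heisModel F hn w, heisModel F hn w'⁆ := by
  refine Prod.ext (LieAlgebra.SemiDirectSum.ext (Heis.ext' ?_ ?_ ?_) rfl) rfl
  · change w.1 * w'.2.2.1 (Sum.inl 0) - w'.1 * w.2.2.1 (Sum.inl 0) =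
      0 + w.1 * w'.2.2.1 (Sum.inl 0) - w'.1 * w.2.2.1 (Sum.inl 0)
    ring
  · change w.1 * w'.2.2.1 (Sum.inr 0) - w'.1 * w.2.2.1 (Sum.inr 0) =
      0 + w.1 * w'.2.2.1 (Sum.inr 0) - w'.1 * w.2.2.1 (Sum.inr 0)
    ring
  · change -(((1 : ℕ) + 1 : F) * (w.1 * w'.2.1 - w'.1 * w.2.1) +
        ∑ i, ∑ j, w.2.2.1 i * w'.2.2.1 j * heisCoeff F i j) =
      w.2.2.1 (Sum.inl 0) * w'.2.2.1 (Sum.inr 0) - w.2.2.1 (Sum.inr 0) * w'.2.2.1 (Sum.inl 0) +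
        w.1 * - -w'.2.1 - w'.1 * - -w.2.1
    simp only [heisCoeff, Fintype.sum_sum_type, Finset.univ_unique, Finset.sum_singleton,
      Fin.default_eq_zero, Sum.swap_inl, Sum.swap_inr, sgn, Sum.elim_inl, Sum.elim_inr, reduceCtorEq,
      if_true, if_false]
    push_cast
    linear_combination -(w.1 * w'.2.1 - w'.1 * w.2.1) * three_eq_zero (F := F)

end Models

end Hamiltonian

theorem theorem3p6 {F : Type*} [Field F] [IsAlgClosed F] [CharP F 3] :
    -- the case `r = 1`, `1 < n_1 ≤ n_2`
    (∀ n : Fin 1 ⊕ Fin 1 → ℕ, 1 < n (Sum.inl 0) → n (Sum.inl 0) ≤ n (Sum.inr 0) →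
      LieAlgebra.IsSolvable (OuterDer F (Hamiltonian.H2 F 3 n)) ∧
      LieAlgebra.derivedLength F (OuterDer F (Hamiltonian.H2 F 3 n)) = 3 ∧
      Nonempty (OuterDer F (Hamiltonian.H2 F 3 n) ≃ₗ⁅F⁆
        LineExt (Heis.diagDer (F := F)) × AbelianLie (Fin ((∑ i, n i) - 2) → F))) ∧
    -- the case `r > 1`
    (∀ r : ℕ, 1 < r → ∀ n : Fin r ⊕ Fin r → ℕ, (∀ i, 1 ≤ n i) →
      LieAlgebra.IsSolvable (OuterDer F (Hamiltonian.H2 F 3 n)) ∧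
      LieAlgebra.derivedLength F (OuterDer F (Hamiltonian.H2 F 3 n)) = 2 ∧
      (r ≡ 0 [MOD 3] → Nonempty (OuterDer F (Hamiltonian.H2 F 3 n) ≃ₗ⁅F⁆
        LineExt (AbelianLie.diagDer (fun _ : Fin (2 * r + 1) => (1 : F))) ×
          AbelianLie (Fin ((∑ i, n i) - 2 * r) → F))) ∧
      (r ≡ 1 [MOD 3] → Nonempty (OuterDer F (Hamiltonian.H2 F 3 n) ≃ₗ⁅F⁆
        LineExt (AbelianLie.diagDer
          (fun i : Fin (2 * r + 1) => if i = Fin.last (2 * r) then (-1 : F) else 1)) ×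
          AbelianLie (Fin ((∑ i, n i) - 2 * r) → F))) ∧
      (r ≡ 2 [MOD 3] → Nonempty (OuterDer F (Hamiltonian.H2 F 3 n) ≃ₗ⁅F⁆
        LineExt (AbelianLie.diagDer (fun _ : Fin (2 * r) => (1 : F))) ×
          AbelianLie (Fin ((∑ i, n i) - 2 * r + 1) → F)))) := by
  open Hamiltonian in
  refine ⟨fun n h1 h2 => ?_, fun r hr n hn => ?_⟩
  · have hn : ∀ i, 2 ≤ n i := by
      rintro (i | i) <;> rw [Subsingleton.elim i 0] <;> omega
    have hn1 : ∀ i, 1 ≤ n i := fun i => by have := hn i; omega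
    have hψ := lie_outerClass_outer hn1 (lie_sing_sing_of_rank_one (F := F) rfl hn1)
    let ψ := outerEquiv F n (by omega) hn1 (Or.inr hn)
    obtain ⟨hs, hl⟩ := derivedLength_eq_three ψ hψ
    exact ⟨hs, hl, nonempty_lieEquiv ψ hψ (heisModel F hn1) (heisModel_paramBracket hn1)⟩
  · have hψ := lie_outerClass_outer hn (lie_sing_sing_of_rank_gt (F := F) hr hn)
    let ψ := outerEquiv F n (by omega) hn (Or.inl hr)
    obtain ⟨hs, hl⟩ := derivedLength_eq_two (by omega) ψ hψ
    refine ⟨hs, hl, fun h => ?_, fun h => ?_, fun h => ?_⟩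
    · refine nonempty_lieEquiv ψ hψ (snocModel F hn _)
        (snocModel_paramBracket hn (fun _ => rfl) ?_)
      rw [natCast_eq_iff.2 h, Nat.cast_zero, zero_add]
    · refine nonempty_lieEquiv ψ hψ (snocModel F hn _)
        (snocModel_paramBracket hn (fun i => if_neg (Fin.castSucc_lt_last i).ne) ?_)
      rw [if_pos rfl, natCast_eq_iff.2 h, Nat.cast_one]
      linear_combination -three_eq_zero (F := F)
    · refine nonempty_lieEquiv ψ hψ (centralModel F hn) (centralModel_paramBracket hn ?_)
      rw [natCast_eq_iff.2 h]
      push_cast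
      linear_combination three_eq_zero (F := F)
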